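/- Let $P$ be a partial order $\preceq$ on a set of $n\ge 2$ elements, let $0\le\beta\le n$, and put $f=1+\beta-\lceil\beta\rceil\in(0,1]$. A permutation $\sigma$ is written as the sequence $\sigma(1),\dots,\sigma(n)$ of the elements by position; it is a linear extension of $P$ if there are no $i<j$ with $\sigma(j)\preceq\sigma(i)$. Fix a linear extension $\sigma_{\rm home}$. The displacement of an element $a$ at position $i$ is $d(a,i)=i-\sigma_{\rm home}^{-1}(a)$. The weight of $\sigma$ is $w(\sigma)=\prod_{i=1}^n\bigl(f\,\mathbf 1[d(\sigma(i),i)=\lceil\beta\rceil]+\mathbf 1[d(\sigma(i),i)<\lceil\beta\rceil]\bigr)$, and $Z(\beta)=\sum_\sigma w(\sigma)$ over all linear extensions. A bounding state is a vector $B$ of length $n$ whose entries are elements or the symbol $\theta$; the initial one is $B_0=(\theta,\dots,\theta,\sigma_{\rm home}(1))$. For an element $a$ at position $i$ and a bit $C_2$, say that $a$ may move if $d(a,i)<\lceil\beta\rceil-1$, or if $d(a,i)=\lceil\beta\rceil-1$ and $C_2=1$. The step BoundingChainStep$(\sigma,B,i,C_3,C_2)$, with $1\le i\le n-1$ and $C_2,C_3\in\{0,1\}$,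 is as follows. 1. Put $C_1=1-C_3$ if $\sigma(i)=B(i+1)$, and $C_1=C_3$ otherwise. 2. If $C_1=1$, not $\sigma(i)\preceq\sigma(i+1)$, and $\sigma(i)$ at position $i$ may move, exchange $\sigma(i)$ and $\sigma(i+1)$. 3. If $C_3=1$, not $B(i)\preceq B(i+1)$, and $B(i)$ at position $i$ may move, exchange $B(i)$ and $B(i+1)$. (The symbol $\theta$ is not comparable with anything and may always move.) 4. If now $B(n)=\theta$, put $B(n)=\sigma_{\rm home}(p+1)$, where $p$ is the number of entries of $B$ different from $\theta$. The procedure Generate$(t)$ (non-Markovian coupling from the past) draws, independently for $j=1,\dots,t$, $i(j)$ uniform on $\{1,\dots,n-1\}$, a fair coin $C_3(j)$, and $C_2(j)\sim\mathrm{Bern}(f)$, and runs the $t$ steps with these draws from $(\sigma_{\rm home},B_0)$. If the resulting $B$ has no entry $\theta$, it returns $\sigma=B$. Otherwise it calls Generate$(2t)$, with new independent draws, to obtain a state $\sigma$, runs the $t$ steps again from $(\sigma,B_0)$ with the same draws $i(j),C_3(j),C_2(j)$, and returns the resulting $\sigma$. All draws are made exactly from independent fair random bits: the coin $C_3(j)$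 is one bit. The variable $C_2(j)$ is found by reading bits, as the binary digits of a uniform number $U$, up to and including the first one that differs from the corresponding binary digit of $f$ (in the expansion of $f\in(0,1]$ that does not end in zeros), and $C_2(j)=1$ if and only if $U<f$. The index $i(j)$ is found as follows, with $m=n-1$: start with $(v,c)=(1,0)$; as long as not both $v\ge m$ and $c<m$, read a bit $b$ and replace $(v,c)$ by $(2v,2c+b)$, and then by $(v-m,c-m)$ if $v\ge m$ and $c\ge m$; at the end $i(j)=c+1$. The number of random bits of a call is the number of bits read, including those read in recursive calls. The number of comparisons is the number of questions "is $x\preceq y$?" in steps 2 and 3, where step 2 asks one if and only if $C_1=1$ and step 3 counts as one if and only if $C_3=1$; the repeated steps and the recursive calls are included. **Theorem.** For every $t\ge1$, Generate$(t)$ returns each linear extension $\sigma$ of $P$ with probability exactly $w(\sigma)/Z(\beta)$. If moreover $t\le n^3\ln n$ (for instance $t=1$), then the expected number of random bits used by Generate$(t)$ is at most $4.3\,n^3(\ln n)(\lceil\log_2 n\rceil+3)$, and the expected number of comparisons is at most $8.6\,n^3\ln n$. -/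

import Mathlib

noncomputable section

open scoped ENNReal Classical

namespace LinExt

/-! ### Linear extensions and the weighted distribution

The poset is a finite partial order `α` with `n` elements. A permutation is written as the sequence
of the elements by position: `σ i` is the element at position `i`. -/

/-- `σ` lists the elements of the poset so that no element precedes a smaller one. -/
def IsLinearExtension {n : ℕ} {α : Type*} [PartialOrder α] (σ : Fin n ≃ α) : Prop :=
  ∀ i j : Fin n, i < j → ¬ σ j ≤ σ i

/-- How far position `i` lies to the right of the home position of the element `a`. -/
def displacement {n : ℕ} {α : Type*} (home : Fin n ≃ α) (a : α) (i : Fin n) : ℤ :=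
  ((i : ℕ) : ℤ) - ((home.symm a : ℕ) : ℤ)

/-- The penalty factor `1 + β - ⌈β⌉`, a number in `(0, 1]`. -/
def penalty (β : ℝ) : ℝ := 1 + β - (⌈β⌉ : ℝ)

/-- The weight of a permutation: every element at displacement `⌈β⌉` contributes the penalty
factor, and no element may have a larger displacement. -/
def weight {n : ℕ} {α : Type*} (β : ℝ) (home σ : Fin n ≃ α) : ℝ :=
  ∏ i : Fin n,
    (penalty β * (if displacement home (σ i) i = ⌈β⌉ then 1 else 0)
      + (if displacement home (σ i) i < ⌈β⌉ then 1 else 0))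

/-- The normalizing constant: the total weight of the linear extensions. -/
def partitionFunction {n : ℕ} {α : Type*} [Fintype α] [PartialOrder α]
    (β : ℝ) (home : Fin n ≃ α) : ℝ :=
  ∑ σ : Fin n ≃ α with IsLinearExtension σ, weight β home σ

/-! ### Random bits, and exact sampling from random bits -/

/-- The first natural number with property `p`, or `none` if the search never ends. -/
def firstTime (p : ℕ → Prop) : Option {k : ℕ // p k} :=
  if h : ∃ k, p k then some ⟨Nat.find h, Nat.find_spec h⟩ else none

/-- The state `(v, c)` of the dice roller after `k` bits: as long as it has not stopped, `c` is
uniform on `{0, …, v - 1}`. A new bit doubles the range; the part of the range from `m` on is kept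
for the following rounds. -/
def diceState (m : ℕ) (b : ℕ → Bool) : ℕ → ℕ × ℕ
  | 0 => (1, 0)
  | k + 1 =>
    let v := 2 * (diceState m b k).1
    let c := 2 * (diceState m b k).2 + (b k).toNat
    if m ≤ v ∧ m ≤ c then (v - m, c - m) else (v, c)

/-- Draws a uniform element of `Fin m` from the fair bits `b`: bits are read until the range has at
least `m` values and the current value is one of the first `m`. Returns the element and the number
of bits that were read. -/
def drawUniform (m : ℕ) (b : ℕ → Bool) : Option (Fin m × ℕ) :=
  (firstTime fun k => m ≤ (diceState m b k).1 ∧ (diceState m b k).2 < m).map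
    fun k => (⟨(diceState m b k.1).2, k.2.2⟩, k.1)

/-- The binary digits of `p ∈ (0, 1]`, that is `p = ∑ k, digit p k / 2 ^ (k + 1)`. -/
def digit (p : ℝ) (k : ℕ) : Bool :=
  decide ((⌈(2 : ℝ) ^ (k + 1) * p⌉ - 1) % 2 = 1)

/-- Draws a Bernoulli variable of parameter `p ∈ (0, 1]` from the fair bits `b`: the bits are the
binary digits of a uniform number `U`, and they are read until they differ from the digits of `p`,
which decides whether `U < p`. Returns the outcome and the number of bits that were read. -/
def drawBernoulli (p : ℝ) (b : ℕ → Bool) : Option (Bool × ℕ) :=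
  (firstTime fun k => b k ≠ digit p k).map fun k => (digit p k.1, k.1 + 1)

/-- The supply of random bits. In the call of the algorithm with `t` steps, the draw number
`r ∈ {0, 1, 2}` of step `j` reads the bits at `(t, j, r, 0), (t, j, r, 1), …` in this order. -/
abbrev BitSource : Type := ℕ × ℕ × Fin 3 × ℕ → Bool

/-- The law of independent fair bits. -/
def fairBits : MeasureTheory.Measure BitSource :=
  MeasureTheory.Measure.infinitePi fun _ => (PMF.uniformOfFintype Bool).toMeasure

/-- The random choices of one step: the left one `i` of the two adjacent positions `i`, `i + 1`, a
fair coin, and a coin whose success probability is the penalty factor; and the number of random bits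
that were used for them. -/
structure Draw (n : ℕ) where
  i : Fin (n - 1)
  coin : Bool
  accept : Bool
  bits : ℕ

/-- The draws of step `j` of the call with `t` steps. -/
def drawStep (n : ℕ) (β : ℝ) (ω : BitSource) (t j : ℕ) : Option (Draw n) := do
  let u ← drawUniform (n - 1) fun k => ω (t, j, 0, k)
  let a ← drawBernoulli (penalty β) fun k => ω (t, j, 2, k)
  some ⟨u.1, ω (t, j, 1, 0), a.1, u.2 + 1 + a.2⟩

/-- All draws of the call with `t` steps, in the order of the steps. -/
def drawAll (n : ℕ) (β : ℝ) (ω : BitSource) (t : ℕ) : Option (List (Draw n)) :=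
  (List.range t).mapM (drawStep n β ω t)

/-! ### The chain and its bounding chain -/

/-- A state `σ`, a bounding state `B` (`none` is the symbol `θ`), and the number of comparisons in
the poset made so far. -/
structure State (n : ℕ) (α : Type*) where
  σ : Fin n → α
  B : Fin n → Option α
  comparisons : ℕ

/-- The position `i`, for `i < n - 1`. -/
def leftPos {n : ℕ} (i : Fin (n - 1)) : Fin n := ⟨i, by omega⟩

/-- The position `i + 1`, for `i < n - 1`. -/
def rightPos {n : ℕ} (i : Fin (n - 1)) : Fin n := ⟨i + 1, by omega⟩

/-- Whether the penalty lets the element `a` move from position `i` to position `i + 1`: always if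
its new displacement is less than `⌈β⌉`, if the coin `accept` allows it when its new displacement
is `⌈β⌉`, and never if its new displacement is larger. -/
def MayMove {n : ℕ} {α : Type*} (β : ℝ) (home : Fin n ≃ α) (accept : Bool) (a : α) (i : Fin n) :
    Prop :=
  displacement home a i < ⌈β⌉ - 1 ∨ (displacement home a i = ⌈β⌉ - 1 ∧ accept = true)

/-- If the last entry of `B` is `θ`, it is replaced by the element number `p + 1` of the home
state, where `p` is the number of entries of `B` other than `θ`. -/
def refill {n : ℕ} {α : Type*} (home : Fin n ≃ α) (B : Fin n → Option α) : Fin n → Option α :=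
  fun i =>
    if h : (i : ℕ) + 1 = n ∧ B i = none then
      some (home ⟨(Finset.univ.filter fun j => B j ≠ none).card,
        (Finset.card_lt_univ_of_notMem (x := i) (by simp [h.2])).trans_eq (Fintype.card_fin n)⟩)
    else B i

/-- The bounding state `(θ, …, θ, home(1))`. -/
def initialBound {n : ℕ} {α : Type*} (home : Fin n ≃ α) : Fin n → Option α :=
  fun i => if (i : ℕ) + 1 = n then some (home ⟨0, i.pos⟩) else none

/-- One step of the chain together with the bounding chain. The coin of the draw is the coin `c₃` of
the bounding state. The coin `c₁` of the state is the opposite of `c₃` if `σ(i) = B(i + 1)`, and is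
equal to `c₃` otherwise. A comparison in the poset is made for the state when `c₁ = 1` and for the
bounding state when `c₃ = 1`; nothing is comparable with `θ`, and `θ` has no displacement. -/
def boundingChainStep {n : ℕ} {α : Type*} [PartialOrder α] (β : ℝ) (home : Fin n ≃ α)
    (s : State n α) (d : Draw n) : State n α :=
  let l : Fin n := leftPos d.i
  let r : Fin n := rightPos d.i
  let c₃ : Bool := d.coin
  let c₁ : Bool := if s.B r = some (s.σ l) then !c₃ else c₃
  let σ' : Fin n → α :=
    if c₁ = true ∧ ¬ s.σ l ≤ s.σ r ∧ MayMove β home d.accept (s.σ l) l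
    then s.σ ∘ Equiv.swap l r else s.σ
  let B' : Fin n → Option α :=
    if c₃ = true ∧ (∀ a ∈ s.B l, ∀ b ∈ s.B r, ¬ a ≤ b) ∧
      (∀ a ∈ s.B l, MayMove β home d.accept a l)
    then s.B ∘ Equiv.swap l r else s.B
  { σ := σ'
    B := refill home B'
    comparisons := s.comparisons + c₁.toNat + c₃.toNat }

/-- The steps with the given draws, from the state `σ` and the bounding state
`(θ, …, θ, home(1))`. -/
def runSteps {n : ℕ} {α : Type*} [PartialOrder α] (β : ℝ) (home : Fin n ≃ α)
    (σ : Fin n → α) (draws : List (Draw n)) : State n α :=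
  draws.foldl (boundingChainStep β home) ⟨σ, initialBound home, 0⟩

/-- What a call of the algorithm returns, with its total number of random bits and of comparisons,
including those of the recursive calls. -/
structure Output (n : ℕ) (α : Type*) where
  σ : Fin n → α
  bits : ℕ
  comparisons : ℕ

/-- Non-Markovian coupling from the past, started with `t` steps, where at most `depth` nested calls
are carried out; `none` means that a draw does not terminate or that more calls are needed. If the
bounding state has no `θ` left after `t` steps, it is returned. Otherwise a state is generated by an
independent call with `2 t` steps, and the `t` steps are run again from that state, with the same
draws. -/
def generateDepth {n : ℕ} {α : Type*} [PartialOrder α] (β : ℝ) (home : Fin n ≃ α)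
    (ω : BitSource) : (depth t : ℕ) → Option (Output n α)
  | 0, _ => none
  | depth + 1, t => (drawAll n β ω t).bind fun draws =>
    let bits := (draws.map Draw.bits).sum
    let s := runSteps β home home draws
    if h : ∀ i, (s.B i).isSome then
      some ⟨fun i => (s.B i).get (h i), bits, s.comparisons⟩
    else
      (generateDepth β home ω depth (2 * t)).map fun g =>
        let s' := runSteps β home g.σ draws
        ⟨s'.σ, bits + g.bits, s.comparisons + g.comparisons + s'.comparisons⟩

/-- Non-Markovian coupling from the past, started with `t` steps, with no limit on the number of
nested calls. The value `none` means that the procedure does not terminate. -/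
def generate {n : ℕ} {α : Type*} [PartialOrder α] (β : ℝ) (home : Fin n ≃ α) (ω : BitSource)
    (t : ℕ) : Option (Output n α) :=
  (firstTime fun depth => (generateDepth β home ω depth t).isSome).bind
    fun depth => generateDepth β home ω depth.1 t

/-- The probability that the procedure terminates and returns `σ`. -/
def outputProb {n : ℕ} {α : Type*} [PartialOrder α] (β : ℝ) (home : Fin n ≃ α) (t : ℕ)
    (σ : Fin n → α) : ℝ≥0∞ :=
  fairBits {ω | ∃ g, generate β home ω t = some g ∧ g.σ = σ}

/-- The expected number of random bits used; a run that does not terminate counts as `∞`. -/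
def expectedBits {n : ℕ} {α : Type*} [PartialOrder α] (β : ℝ) (home : Fin n ≃ α) (t : ℕ) : ℝ≥0∞ :=
  ∫⁻ ω, (generate β home ω t).elim ⊤ (fun g => (g.bits : ℝ≥0∞)) ∂fairBits

/-- The expected number of comparisons made; a run that does not terminate counts as `∞`. -/
def expectedComparisons {n : ℕ} {α : Type*} [PartialOrder α] (β : ℝ) (home : Fin n ≃ α) (t : ℕ) :
    ℝ≥0∞ :=
  ∫⁻ ω, (generate β home ω t).elim ⊤ (fun g => (g.comparisons : ℝ≥0∞)) ∂fairBits

end LinExt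

end

/-!
The state of a call is a Markov chain that proposes to exchange two adjacent elements. It satisfies
detailed balance for the weights (`weight_mul_weightFactor`): an element is moved to the right with
the probability that is its weight factor at the new position. The weighted distribution `target` is
therefore stationary (`sum_target_mul_iterate`).

The bounding chain has its own Markovian law, and the two chains use coupled coins. The coupling
keeps every element of the bounding state at or to the right of its position in the state
(`bounds_step`). Once the symbol `θ` has disappeared, the bounding state therefore equals the state,
whatever that was at the beginning (`StateInv.eq_of_complete`).

*Correctness.* By induction on the depth of the recursion, each value is returned with at most its
probability under `target` (`lintegral_generateDepth_state_le`): the output of a call is that of a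
run from a stationary state, if the bounding state is complete, and otherwise that of a run
from the output of the recursive call, which reads other random bits. As the procedure
terminates almost surely, both are probability distributions and have to agree
(`outputProb_eq_target`).

*Disappearance of `θ`.* The symbols `θ` move at least as far to the right as in a symmetric walk on
the positions that is killed at the last one: an exchange may be refused if it would bring a `θ` to
the left, but never if it would bring a `θ` to the right (`thetaSum_step_le`). The test of Schur with
the lowest mode of this walk, a cosine, bounds the norm of its transition operator by `1 - walkGap n`
(`sum_walkOp_sq_le`), so that a `θ` is left after `t` steps with probability at most
`(n - 1) * (1 - walkGap n) ^ t` (`failProb_le`).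

*Cost.* A call with `t` steps makes `t` draws and, with probability `failProb t`, a call with `2 t`
steps. An explicit function, `stepBound`, satisfies the resulting recursive inequality
(`stepBound_recursion`) and so bounds the expected number of steps drawn. A step reads at most
`⌈log₂ (n - 1)⌉ + 4` random bits on average: `⌈log₂ (n - 1)⌉ + 1` for the position
(`lintegral_drawUniform_bits_le`), `2` for the penalty coin and one for the fair coin. It makes one
comparison on average, and repeating it at most two more; the repeated steps are paid for by those
of the recursive calls, which are twice as many (`expectedComparisons_le`).
-/

noncomputable section

open scoped ENNReal Classical
open MeasureTheory ProbabilityTheory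

namespace LinExt

/-! ### Functions of countable range of disjoint sets of random bits -/

/-- The events that depend only on the bits with index in `S`. -/
@[reducible] def bitEvents (S : Set (ℕ × ℕ × Fin 3 × ℕ)) : MeasurableSpace BitSource :=
  ⨆ i ∈ S, MeasurableSpace.comap (fun ω : BitSource => ω i) inferInstance

/-- The function `X`, meant to have countable range, depends measurably on the bits with index
in `S` only. -/
def ReadsOnly {A : Type*} (S : Set (ℕ × ℕ × Fin 3 × ℕ)) (X : BitSource → A) : Prop :=
  ∀ a, MeasurableSet[bitEvents S] (X ⁻¹' {a})

instance : IsProbabilityMeasure fairBits := by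
  unfold fairBits; infer_instance

theorem bitEvents_mono {S T : Set (ℕ × ℕ × Fin 3 × ℕ)} (h : S ⊆ T) :
    bitEvents S ≤ bitEvents T :=
  biSup_mono h

theorem bitEvents_le (S : Set (ℕ × ℕ × Fin 3 × ℕ)) :
    bitEvents S ≤ (inferInstance : MeasurableSpace BitSource) :=
  iSup₂_le fun i _ => (measurable_pi_apply i).comap_le

namespace ReadsOnly

variable {A B C : Type*} {S T : Set (ℕ × ℕ × Fin 3 × ℕ)}

theorem mono {X : BitSource → A} (h : ReadsOnly S X) (hST : S ⊆ T) : ReadsOnly T X :=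
  fun a => bitEvents_mono hST _ (h a)

theorem preimage [Countable A] {X : BitSource → A} (h : ReadsOnly S X) (s : Set A) :
    MeasurableSet[bitEvents S] (X ⁻¹' s) := by
  rw [← Set.biUnion_preimage_singleton]
  exact MeasurableSet.biUnion (Set.to_countable s) fun a _ => h a

theorem measurable [Countable A] {D : Type*} [MeasurableSpace D] {X : BitSource → A}
    (h : ReadsOnly S X) (F : A → D) : Measurable[bitEvents S] fun ω => F (X ω) :=
  fun s _ => h.preimage (F ⁻¹' s)

theorem measurable' [Countable A] {D : Type*} [MeasurableSpace D] {X : BitSource → A}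
    (h : ReadsOnly S X) (F : A → D) : Measurable fun ω => F (X ω) :=
  fun s _ => bitEvents_le S _ (h.preimage (F ⁻¹' s))

theorem comp [Countable A] {X : BitSource → A} (h : ReadsOnly S X) (F : A → B) :
    ReadsOnly S fun ω => F (X ω) :=
  fun b => h.preimage (F ⁻¹' {b})

theorem comp₂ [Countable A] [Countable B] {X : BitSource → A} {Y : BitSource → B}
    (hX : ReadsOnly S X) (hY : ReadsOnly S Y) (F : A → B → C) :
    ReadsOnly S fun ω => F (X ω) (Y ω) := by
  intro c
  have : (fun ω => F (X ω) (Y ω)) ⁻¹' {c} =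
      ⋃ a : A, (X ⁻¹' {a} ∩ Y ⁻¹' {b | F a b = c}) := by
    ext ω; simp
  rw [this]
  exact MeasurableSet.iUnion fun a => (hX a).inter (hY.preimage _)

theorem const (a : A) : ReadsOnly S fun _ => a :=
  fun _ => MeasurableSet.const _

theorem bit {i : ℕ × ℕ × Fin 3 × ℕ} (hi : i ∈ S) : ReadsOnly S fun ω => ω i := by
  intro b
  exact le_biSup (fun i => MeasurableSpace.comap (fun ω : BitSource => ω i) inferInstance) hi _
    ⟨{b}, measurableSet_singleton b, rfl⟩

theorem of_prop_iff {p : BitSource → Prop} :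
    ReadsOnly S p ↔ MeasurableSet[bitEvents S] {ω | p ω} := by
  constructor
  · intro h
    have := h True
    simpa [Set.preimage] using this
  · intro h a
    by_cases ha : a
    · simpa [Set.preimage, ha] using h
    · have e : p ⁻¹' {a} = {ω | p ω}ᶜ := by ext ω; simp [ha]
      rw [e]; exact h.compl

theorem forall_prop {ι : Type*} [Countable ι] {p : ι → BitSource → Prop}
    (h : ∀ k, ReadsOnly S (p k)) : ReadsOnly S fun ω => ∀ k, p k ω := by
  rw [of_prop_iff, Set.ofPred_forall]
  exact MeasurableSet.iInter fun k => of_prop_iff.1 (h k)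

/-- A search that stops depends only on the bits that its tests depend on. -/
theorem firstTime [Countable A] {p : ℕ → BitSource → Prop} {X : ℕ → BitSource → A}
    (hp : ∀ k, ReadsOnly S (p k)) (hX : ∀ k, ReadsOnly S (X k))
    {Y : BitSource → Option A}
    (hY : ∀ ω k, p k ω → (∀ j < k, ¬ p j ω) → Y ω = some (X k ω))
    (hY' : ∀ ω, (∀ k, ¬ p k ω) → Y ω = none) : ReadsOnly S Y := by
  intro y
  have key : Y ⁻¹' {y} =
      {ω | (∀ k, ¬ p k ω) ∧ none = y} ∪
      ⋃ k, {ω | (p k ω ∧ ∀ j < k, ¬ p j ω) ∧ some (X k ω) = y} := by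
    ext ω
    simp only [Set.mem_preimage, Set.mem_singleton_iff, Set.mem_union, Set.mem_ofPred_eq,
      Set.mem_iUnion]
    by_cases h : ∃ k, p k ω
    · have h1 := Nat.find_spec h
      have h2 : ∀ j < Nat.find h, ¬ p j ω := fun j hj => Nat.find_min h hj
      constructor
      · intro e
        exact Or.inr ⟨_, ⟨h1, h2⟩, (hY ω _ h1 h2).symm.trans e⟩
      · rintro (⟨h3, -⟩ | ⟨k, ⟨h3, h4⟩, e⟩)
        · exact absurd h1 (h3 _)
        · rw [hY ω k h3 h4, e]
    · push Not at h
      constructor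
      · intro e
        exact Or.inl ⟨h, (hY' ω h).symm.trans e⟩
      · rintro (⟨-, e⟩ | ⟨k, ⟨h3, -⟩, -⟩)
        · rw [hY' ω h, e]
        · exact absurd h3 (h k)
  rw [key]
  refine MeasurableSet.union ?_ (MeasurableSet.iUnion fun k => ?_)
  · refine MeasurableSet.inter ?_ (MeasurableSet.const _)
    exact of_prop_iff.1 (forall_prop fun k => (hp k).comp Not)
  · refine MeasurableSet.inter (MeasurableSet.inter (of_prop_iff.1 (hp k)) ?_)
      ((hX k).preimage {x | some x = y})
    refine of_prop_iff.1 (forall_prop fun j => ?_)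
    exact (hp j).comp fun q => j < k → ¬ q

end ReadsOnly

/-- The indicator of a proposition, as a number. -/
def ind (q : Prop) : ℝ≥0∞ := if q then 1 else 0

@[simp] theorem ind_true : ind True = 1 := if_pos trivial

@[simp] theorem ind_false : ind False = 0 := if_neg not_false

theorem ind_of {q : Prop} (h : q) : ind q = 1 := if_pos h

theorem ind_not_of {q : Prop} (h : ¬ q) : ind q = 0 := if_neg h

/-- Fubini for two functions of countable range that depend on disjoint sets of bits. -/
theorem lintegral_of_disjoint {A B : Type*} [Countable A] [Countable B]
    {S T : Set (ℕ × ℕ × Fin 3 × ℕ)} (hST : Disjoint S T) {X : BitSource → A} {Y : BitSource → B}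
    (hX : ReadsOnly S X) (hY : ReadsOnly T Y) (F : A → B → ℝ≥0∞) :
    ∫⁻ ω, F (X ω) (Y ω) ∂fairBits = ∫⁻ ω, ∫⁻ ω', F (X ω) (Y ω') ∂fairBits ∂fairBits := by
  have hind : Indep (bitEvents S) (bitEvents T) fairBits := by
    refine indep_iSup_of_disjoint (fun i => (measurable_pi_apply i).comap_le) ?_ hST
    exact iIndepFun_infinitePi (P := fun _ : ℕ × ℕ × Fin 3 × ℕ =>
      (PMF.uniformOfFintype Bool).toMeasure) (X := fun _ b => b) (fun _ => measurable_id)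
  have split : ∀ G : A → BitSource → ℝ≥0∞, ∀ ω,
      G (X ω) ω = ∑' a, (if X ω = a then 1 else 0) * G a ω := by
    intro G ω
    rw [tsum_eq_single (X ω)]
    · simp
    · intro a ha; simp [ha.symm]
  have m1 : ∀ a, Measurable[bitEvents S] fun ω => if X ω = a then (1 : ℝ≥0∞) else 0 :=
    fun a => hX.measurable fun x => if x = a then (1 : ℝ≥0∞) else 0
  have m1' : ∀ a, Measurable fun ω => if X ω = a then (1 : ℝ≥0∞) else 0 :=
    fun a => hX.measurable' fun x => if x = a then (1 : ℝ≥0∞) else 0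
  calc ∫⁻ ω, F (X ω) (Y ω) ∂fairBits
      = ∫⁻ ω, ∑' a, (if X ω = a then 1 else 0) * F a (Y ω) ∂fairBits := by
        congr 1; ext ω; exact split (fun a ω => F a (Y ω)) ω
    _ = ∑' a, ∫⁻ ω, (if X ω = a then 1 else 0) * F a (Y ω) ∂fairBits :=
        lintegral_tsum fun a => ((m1' a).mul (hY.measurable' (F a))).aemeasurable
    _ = ∑' a, ∫⁻ ω, (if X ω = a then 1 else 0) * ∫⁻ ω', F a (Y ω') ∂fairBits ∂fairBits := by
        congr 1; ext a
        rw [lintegral_mul_eq_lintegral_mul_lintegral_of_independent_measurableSpace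
          (bitEvents_le S) (bitEvents_le T) hind (m1 a) (hY.measurable (F a)),
          lintegral_mul_const _ (m1' a)]
    _ = ∫⁻ ω, ∑' a, (if X ω = a then 1 else 0) * ∫⁻ ω', F a (Y ω') ∂fairBits ∂fairBits :=
        (lintegral_tsum fun a => ((m1' a).mul measurable_const).aemeasurable).symm
    _ = _ := by
        congr 1; ext ω; exact (split (fun a _ => ∫⁻ ω', F a (Y ω') ∂fairBits) ω).symm

/-- Every single bit is fair. -/
theorem lintegral_bit (i : ℕ × ℕ × Fin 3 × ℕ) (F : Bool → ℝ≥0∞) :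
    ∫⁻ ω, F (ω i) ∂fairBits = ∑ b, 2⁻¹ * F b := by
  have h : fairBits.map (fun ω => ω i) = (PMF.uniformOfFintype Bool).toMeasure :=
    Measure.infinitePi_map_eval _ i
  rw [← lintegral_map (f := F) (g := fun ω : BitSource => ω i) (measurable_of_countable _)
    (measurable_pi_apply i), h, lintegral_fintype]
  refine Finset.sum_congr rfl fun b _ => ?_
  rw [PMF.toMeasure_apply_singleton _ _ (measurableSet_singleton b), mul_comm]
  simp

theorem measure_setOf_eq_lintegral {S : Set (ℕ × ℕ × Fin 3 × ℕ)} {p : BitSource → Prop}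
    (hp : ReadsOnly S p) :
    fairBits {ω | p ω} = ∫⁻ ω, ind (p ω) ∂fairBits := by
  rw [← lintegral_indicator_one (bitEvents_le _ _ (ReadsOnly.of_prop_iff.1 hp))]
  refine lintegral_congr fun ω => ?_
  by_cases h : p ω
  · rw [ind_of h, Set.indicator_of_mem (by exact h)]; rfl
  · rw [ind_not_of h, Set.indicator_of_notMem (by exact h)]

/-- A fresh bit has a given value with probability `1 / 2`, given an event of other bits. -/
theorem measure_inter_bit {S : Set (ℕ × ℕ × Fin 3 × ℕ)} {p : BitSource → Prop}
    (hp : ReadsOnly S p) {i : ℕ × ℕ × Fin 3 × ℕ} (hi : i ∉ S) (b : Bool) :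
    fairBits {ω | p ω ∧ ω i = b} = 2⁻¹ * fairBits {ω | p ω} := by
  have h := lintegral_of_disjoint (Set.disjoint_singleton_right.2 hi) hp
    (ReadsOnly.bit (Set.mem_singleton i)) fun q c => ind (q ∧ c = b)
  have hp' : ReadsOnly Set.univ p := hp.mono (Set.subset_univ _)
  rw [measure_setOf_eq_lintegral hp', measure_setOf_eq_lintegral
    (hp'.comp₂ (ReadsOnly.bit (Set.mem_univ i)) fun q c => q ∧ c = b),
    ← lintegral_const_mul _ (hp.measurable' ind), h]
  congr 1; ext ω
  rw [lintegral_bit i fun c => ind (p ω ∧ c = b)]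
  by_cases hq : p ω <;> cases b <;> simp [hq]

/-! ### Searches -/

theorem firstTime_eq_some {p : ℕ → Prop} {k : ℕ} (hk : p k) (h : ∀ j < k, ¬ p j) :
    firstTime p = some ⟨k, hk⟩ := by
  have hex : ∃ k, p k := ⟨k, hk⟩
  have : Nat.find hex = k := (Nat.find_eq_iff hex).2 ⟨hk, h⟩
  unfold firstTime
  rw [dif_pos hex]
  simp [this]

theorem firstTime_eq_none {p : ℕ → Prop} (h : ∀ k, ¬ p k) : firstTime p = none := by
  unfold firstTime
  rw [dif_neg]
  push Not
  exact h

theorem lt_of_firstTime {p : ℕ → Prop} {k : ℕ} {hk : p k} (h : firstTime p = some ⟨k, hk⟩) :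
    ∀ j < k, ¬ p j := by
  by_contra! hc
  obtain ⟨j, hj, hpj⟩ := hc
  have hex : ∃ k, p k := ⟨k, hk⟩
  have h1 := firstTime_eq_some (Nat.find_spec hex) fun i hi => Nat.find_min hex hi
  rw [h1] at h
  have : Nat.find hex = k := by simpa using h
  have := Nat.find_min' hex hpj
  omega

/-- The length of a search counts the times up to which it has not succeeded. -/
theorem elim_firstTime_eq_tsum (p : ℕ → Prop) :
    (firstTime p).elim ⊤ (fun k => (k.1 : ℝ≥0∞)) =
      ∑' k : ℕ, ind (∀ j ≤ k, ¬ p j) := by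
  by_cases hex : ∃ k, p k
  · have h1 := Nat.find_spec hex
    rw [firstTime_eq_some h1 fun i hi => Nat.find_min hex hi]
    have : ∀ k, (∀ j ≤ k, ¬ p j) ↔ k ∈ Finset.range (Nat.find hex) := by
      intro k
      rw [Finset.mem_range, Nat.lt_find_iff]
    simp_rw [this]
    rw [tsum_eq_sum (s := Finset.range (Nat.find hex))]
    · rw [Finset.sum_congr rfl fun k hk => ind_of hk]
      simp
    · exact fun k hk => ind_not_of hk
  · push Not at hex
    rw [firstTime_eq_none hex]
    simp [hex]

/-! ### The dice roller -/

/-- The range of the dice roller after `k` bits, as long as it has not stopped. -/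
def diceRange (m : ℕ) : ℕ → ℕ
  | 0 => 1
  | k + 1 => if m ≤ 2 * diceRange m k then 2 * diceRange m k - m else 2 * diceRange m k

/-- The test that ends the dice roller after `k` bits. -/
def diceStop (m : ℕ) (b : ℕ → Bool) (k : ℕ) : Prop :=
  m ≤ (diceState m b k).1 ∧ (diceState m b k).2 < m

theorem drawUniform_eq (m : ℕ) (b : ℕ → Bool) :
    drawUniform m b = (firstTime (diceStop m b)).map
      fun k => (⟨(diceState m b k.1).2, k.2.2⟩, k.1) := rfl

/-- The dice roller has not stopped after `k` bits. -/
def diceAlive (m : ℕ) (b : ℕ → Bool) (k : ℕ) : Prop :=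
  ∀ j ≤ k, ¬ diceStop m b j

theorem diceAlive_succ {m : ℕ} {b : ℕ → Bool} {k : ℕ} :
    diceAlive m b (k + 1) ↔ diceAlive m b k ∧ ¬ diceStop m b (k + 1) := by
  constructor
  · exact fun h => ⟨fun j hj => h j (by omega), h _ le_rfl⟩
  · rintro ⟨h, h'⟩ j hj
    rcases Nat.lt_or_eq_of_le hj with h1 | rfl
    · exact h j (by omega)
    · exact h'

theorem diceState_of_alive {m : ℕ} (hm : 2 ≤ m) {b : ℕ → Bool} :
    ∀ {k : ℕ}, diceAlive m b k → (diceState m b k).1 = diceRange m k ∧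
      diceRange m k < m ∧ (diceState m b k).2 < diceRange m k
  | 0, _ => by simp [diceState, diceRange]; omega
  | k + 1, h => by
    obtain ⟨h1, h2⟩ := diceAlive_succ.1 h
    obtain ⟨e, hlt, hc⟩ := diceState_of_alive hm h1
    have hb : (b k).toNat ≤ 1 := Bool.toNat_le _
    simp only [diceStop, diceState, diceRange, e] at h2 ⊢
    by_cases h3 : m ≤ 2 * diceRange m k <;>
      by_cases h4 : m ≤ 2 * (diceState m b k).2 + (b k).toNat <;>
      simp only [h3, h4, and_self, and_true, true_and, and_false, false_and, if_true, if_false,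
        not_and, not_lt] at h2 ⊢ <;> omega

theorem diceRange_lt {m : ℕ} (hm : 2 ≤ m) : ∀ k, diceRange m k < m
  | 0 => by simp [diceRange]; omega
  | k + 1 => by
    have := diceRange_lt hm k
    simp only [diceRange]
    split_ifs <;> omega

theorem exists_bit_eq (y : ℕ) (c : ℕ) (β : Bool) :
    2 * c + β.toNat = y ↔ c = y / 2 ∧ β = decide (y % 2 = 1) := by
  cases β <;> simp <;> omega

/-- Of the bit strings of length `k + 1`, exactly one leads to each value `y` before the reduction
modulo `m`. -/
theorem diceAlive_succ_value {m : ℕ} (hm : 2 ≤ m) {b : ℕ → Bool} {k x : ℕ} :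
    (diceAlive m b (k + 1) ∧ (diceState m b (k + 1)).2 = x) ↔
      (diceAlive m b k ∧ (diceState m b k).2 =
        (x + if m ≤ 2 * diceRange m k then m else 0) / 2) ∧
      b k = decide ((x + if m ≤ 2 * diceRange m k then m else 0) % 2 = 1) := by
  rw [diceAlive_succ, and_assoc, and_assoc, and_congr_right_iff]
  intro h1
  obtain ⟨e, hlt, hc⟩ := diceState_of_alive hm h1
  rw [← exists_bit_eq]
  have hb : (b k).toNat ≤ 1 := Bool.toNat_le _
  simp only [diceStop, diceState, e]
  split_ifs <;> simp only [not_and, not_lt] at * <;> omega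

theorem diceStop_succ_value {m : ℕ} (hm : 2 ≤ m) {b : ℕ → Bool} {k x : ℕ} (hx : x < m) :
    (diceAlive m b k ∧ diceStop m b (k + 1) ∧ (diceState m b (k + 1)).2 = x) ↔
      m ≤ 2 * diceRange m k ∧ (diceAlive m b k ∧ (diceState m b k).2 = x / 2) ∧
        b k = decide (x % 2 = 1) := by
  rw [and_left_comm (a := m ≤ 2 * diceRange m k), and_assoc, and_congr_right_iff]
  intro h1
  obtain ⟨e, hlt, hc⟩ := diceState_of_alive hm h1
  rw [and_left_comm (b := m ≤ _), ← exists_bit_eq]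
  have hb : (b k).toNat ≤ 1 := Bool.toNat_le _
  simp only [diceStop, diceState, e]
  split_ifs <;> simp only at * <;> omega

section Stream

variable {e : ℕ → ℕ × ℕ × Fin 3 × ℕ}

theorem readsOnly_diceState (m k : ℕ) :
    ReadsOnly (e '' {j | j < k}) fun ω => diceState m (fun j => ω (e j)) k := by
  induction k with
  | zero => exact ReadsOnly.const _
  | succ k ih =>
    exact ReadsOnly.comp₂ (ih.mono (Set.image_mono fun j hj => Nat.lt_succ_of_lt hj))
      (ReadsOnly.bit (S := e '' {j | j < k + 1}) ⟨k, Nat.lt_succ_self k, rfl⟩)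
      fun s β => if m ≤ 2 * s.1 ∧ m ≤ 2 * s.2 + β.toNat
        then (2 * s.1 - m, 2 * s.2 + β.toNat - m) else (2 * s.1, 2 * s.2 + β.toNat)

theorem readsOnly_diceStop (m k : ℕ) :
    ReadsOnly (e '' {j | j < k}) fun ω => diceStop m (fun j => ω (e j)) k :=
  (readsOnly_diceState m k).comp fun s => m ≤ s.1 ∧ s.2 < m

theorem readsOnly_diceAlive (m k : ℕ) :
    ReadsOnly (e '' {j | j < k}) fun ω => diceAlive m (fun j => ω (e j)) k := by
  refine ReadsOnly.forall_prop fun i => ?_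
  by_cases hi : i ≤ k
  · refine ((readsOnly_diceStop (e := e) m i).mono (Set.image_mono fun j hj => ?_)).comp
      fun q => i ≤ k → ¬ q
    exact lt_of_lt_of_le hj hi
  · simp only [hi, false_imp_iff]
    exact ReadsOnly.const _

theorem readsOnly_drawUniform (m : ℕ) :
    ReadsOnly (Set.range e) fun ω => drawUniform m fun k => ω (e k) := by
  have h1 := fun k => (readsOnly_diceStop (e := e) m k).mono (Set.image_subset_range e _)
  have h2 := fun k => (readsOnly_diceState (e := e) m k).mono (Set.image_subset_range e _)
  -- the value found at time `k`, with a junk value where the search does not stop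
  by_cases hm : 0 < m
  · refine ReadsOnly.firstTime (X := fun k ω =>
      ((⟨(diceState m (fun j => ω (e j)) k).2 % m, Nat.mod_lt _ hm⟩ : Fin m), k)) h1
      (fun k => (h2 k).comp fun s => ((⟨s.2 % m, Nat.mod_lt _ hm⟩ : Fin m), k)) ?_ ?_
    · intro ω k hk hj
      rw [drawUniform_eq, firstTime_eq_some hk hj]
      simp [Nat.mod_eq_of_lt hk.2]
    · intro ω h
      rw [drawUniform_eq, firstTime_eq_none h]
      rfl
  · have : ∀ ω : BitSource, drawUniform m (fun k => ω (e k)) = none := by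
      intro ω
      rw [drawUniform_eq, firstTime_eq_none]
      · rfl
      · intro k hk
        have := hk.2
        omega
    simp_rw [this]
    exact ReadsOnly.const _

variable (he : Function.Injective e)
include he

theorem notMem_image_of_injective (k : ℕ) : e k ∉ e '' {j | j < k} := by
  rintro ⟨j, hj, h⟩
  have := he h
  simp only [Set.mem_ofPred_eq] at hj
  omega

theorem measure_diceAlive_value {m : ℕ} (hm : 2 ≤ m) :
    ∀ k x, x < diceRange m k →
      fairBits {ω | diceAlive m (fun j => ω (e j)) k ∧
        (diceState m (fun j => ω (e j)) k).2 = x} = 2⁻¹ ^ k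
  | 0, x, hx => by
    have h0 : x = 0 := by simpa [diceRange] using hx
    have : {ω : BitSource | diceAlive m (fun j => ω (e j)) 0 ∧
        (diceState m (fun j => ω (e j)) 0).2 = x} = Set.univ := by
      ext ω
      simp only [Set.mem_ofPred_eq, Set.mem_univ, iff_true]
      constructor
      · intro j hj
        simp [Nat.le_zero.1 hj, diceStop, diceState]
        omega
      · simp [diceState, h0]
    rw [this]; simp
  | k + 1, x, hx => by
    simp_rw [diceAlive_succ_value hm]
    rw [measure_inter_bit (S := e '' {j | j < k}) _ (notMem_image_of_injective he k),
      measure_diceAlive_value hm k, pow_succ']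
    · have := diceRange_lt hm k
      simp only [diceRange] at hx
      split_ifs at hx ⊢ <;> omega
    · exact (readsOnly_diceAlive m k).comp₂ (readsOnly_diceState m k) fun q s => q ∧ s.2 = _

theorem measure_diceStop_value {m : ℕ} (hm : 2 ≤ m) (k : ℕ) {x : ℕ} (hx : x < m) :
    fairBits {ω | diceAlive m (fun j => ω (e j)) k ∧ diceStop m (fun j => ω (e j)) (k + 1) ∧
        (diceState m (fun j => ω (e j)) (k + 1)).2 = x} =
      if m ≤ 2 * diceRange m k then 2⁻¹ ^ (k + 1) else 0 := by
  simp_rw [diceStop_succ_value hm hx]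
  split_ifs with h
  · simp only [h, true_and]
    rw [measure_inter_bit (S := e '' {j | j < k}) _ (notMem_image_of_injective he k),
      measure_diceAlive_value he hm k, pow_succ']
    · omega
    · exact (readsOnly_diceAlive m k).comp₂ (readsOnly_diceState m k) fun q s => q ∧ s.2 = _
  · simp [h]

theorem measure_diceAlive {m : ℕ} (hm : 2 ≤ m) (k : ℕ) :
    fairBits {ω | diceAlive m (fun j => ω (e j)) k} = diceRange m k * 2⁻¹ ^ k := by
  have : {ω : BitSource | diceAlive m (fun j => ω (e j)) k} = ⋃ x ∈ Finset.range (diceRange m k),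
      {ω | diceAlive m (fun j => ω (e j)) k ∧ (diceState m (fun j => ω (e j)) k).2 = x} := by
    ext ω
    simp only [Set.mem_ofPred_eq, Set.mem_iUnion, Finset.mem_range]
    constructor
    · exact fun h => ⟨_, (diceState_of_alive hm h).2.2, h, rfl⟩
    · rintro ⟨x, -, h, -⟩; exact h
  rw [this, measure_biUnion_finset]
  · rw [Finset.sum_congr rfl fun x hx =>
      measure_diceAlive_value he hm k x (Finset.mem_range.1 hx)]
    simp
  · intro x _ y _ hxy
    refine Set.disjoint_left.2 fun ω h1 h2 => hxy ?_
    exact h1.2.symm.trans h2.2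
  · intro x _
    exact bitEvents_le _ _ (ReadsOnly.of_prop_iff.1
      ((readsOnly_diceAlive m k).comp₂ (readsOnly_diceState m k) fun q s => q ∧ s.2 = x))

omit he in
/-- The range `v` after `k` bits bounds the expected number of further tests: every further bit
costs `v / 2 ^ k` and the new range is `2 v` or `2 v - m`. -/
theorem sum_diceRange_le {m : ℕ} (hm : 2 ≤ m) (K k : ℕ) :
    ∑ j ∈ Finset.range K, (diceRange m (k + j) : ℝ) * 2⁻¹ ^ (k + j) ≤
      ((diceRange m k : ℝ) + m) * 2⁻¹ ^ k := by
  induction K generalizing k with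
  | zero => simp; positivity
  | succ K ih =>
    rw [Finset.sum_range_succ']
    have h := ih (k + 1)
    simp only [add_assoc, add_comm 1] at h
    have key : ((diceRange m (k + 1) : ℝ) + m) * 2⁻¹ + diceRange m k ≤ diceRange m k + m := by
      have h1 := diceRange_lt hm k
      have h2 : (diceRange m (k + 1) : ℝ) ≤ m := by exact_mod_cast (diceRange_lt hm (k + 1)).le
      linarith
    have hp : (0 : ℝ) ≤ 2⁻¹ ^ k := by positivity
    have := mul_le_mul_of_nonneg_right key hp
    rw [pow_succ'] at h
    simp only [add_zero]
    linarith

end Stream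

/-! ### The laws of a uniform and of a Bernoulli draw -/

/-- The law of the outcome of a draw, expressed by integrals. -/
theorem lintegral_outcome {A : Type*} [Fintype A] {S : Set (ℕ × ℕ × Fin 3 × ℕ)}
    {X : BitSource → Option (A × ℕ)} (hX : ReadsOnly S X) (H : A → ℝ≥0∞) :
    ∫⁻ ω, (X ω).elim 0 (fun u => H u.1) ∂fairBits =
      ∑ a, fairBits {ω | ∃ k, X ω = some (a, k)} * H a := by
  have hm : ∀ a, ReadsOnly S fun ω => ∃ k, X ω = some (a, k) := fun a =>
    hX.comp fun x => ∃ k, x = some (a, k)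
  have : ∀ ω, (X ω).elim 0 (fun u => H u.1) =
      ∑ a, ind (∃ k, X ω = some (a, k)) * H a := by
    intro ω
    rcases X ω with _ | ⟨a, k⟩
    · simp
    · rw [Finset.sum_eq_single a]
      · simp
      · intro b _ hb; simp [hb.symm]
      · simp
  simp_rw [this]
  rw [lintegral_finsetSum _ fun a _ => ((hm a).measurable' ind).mul_const _]
  refine Finset.sum_congr rfl fun a _ => ?_
  rw [lintegral_mul_const _ ((hm a).measurable' ind),
    measure_setOf_eq_lintegral (hm a)]

/-- A draw with a finite expected number of bits terminates almost surely. -/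
theorem ae_isSome_of_lintegral {A : Type*} [Countable A] {S : Set (ℕ × ℕ × Fin 3 × ℕ)}
    {X : BitSource → Option A} (hX : ReadsOnly S X) (g : A → ℝ≥0∞)
    (h : ∫⁻ ω, (X ω).elim ⊤ g ∂fairBits ≠ ⊤) : ∀ᵐ ω ∂fairBits, (X ω).isSome := by
  filter_upwards [ae_lt_top (hX.measurable' fun x => x.elim ⊤ g) h] with ω hω
  rcases hx : X ω with _ | a
  · simp [hx] at hω
  · rfl

theorem sum_outcome_eq_one {A : Type*} [Fintype A] {S : Set (ℕ × ℕ × Fin 3 × ℕ)}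
    {X : BitSource → Option (A × ℕ)} (hX : ReadsOnly S X)
    (h : ∀ᵐ ω ∂fairBits, (X ω).isSome) :
    ∑ a, fairBits {ω | ∃ k, X ω = some (a, k)} = 1 := by
  have h1 := lintegral_outcome hX fun _ => 1
  simp only [mul_one] at h1
  rw [← h1, lintegral_congr_ae (g := fun _ => 1)]
  · simp
  · filter_upwards [h] with ω hω
    rcases hx : X ω with _ | a
    · simp [hx] at hω
    · rfl

section Stream

variable {e : ℕ → ℕ × ℕ × Fin 3 × ℕ}

theorem diceRange_eq_two_pow {m : ℕ} : ∀ {k : ℕ}, 2 ^ k < m → diceRange m k = 2 ^ k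
  | 0, _ => rfl
  | k + 1, h => by
    rw [pow_succ] at h ⊢
    have : diceRange m k = 2 ^ k := diceRange_eq_two_pow (by omega)
    rw [diceRange, this, if_neg (by omega)]
    ring

theorem sum_diceRange_le_clog {m : ℕ} (hm : 2 ≤ m) (N : ℕ) :
    ∑ k ∈ Finset.range N, (diceRange m k : ℝ) * 2⁻¹ ^ k ≤ Nat.clog 2 m + 1 := by
  have hmono : ∑ k ∈ Finset.range N, (diceRange m k : ℝ) * 2⁻¹ ^ k ≤
      ∑ k ∈ Finset.range (Nat.clog 2 m + N), (diceRange m k : ℝ) * 2⁻¹ ^ k :=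
    Finset.sum_le_sum_of_subset_of_nonneg (Finset.range_mono (by omega))
      fun k _ _ => by positivity
  refine hmono.trans ?_
  rw [Finset.sum_range_add]
  have hK : 0 < Nat.clog 2 m := Nat.clog_pos (by norm_num) hm
  refine add_le_add ?_ ((sum_diceRange_le hm N _).trans ?_)
  · calc ∑ k ∈ Finset.range (Nat.clog 2 m), (diceRange m k : ℝ) * 2⁻¹ ^ k
        ≤ ∑ k ∈ Finset.range (Nat.clog 2 m), (1 : ℝ) := by
          refine Finset.sum_le_sum fun k hk => ?_
          rw [diceRange_eq_two_pow ((Nat.lt_clog_iff_pow_lt (by norm_num)).1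
            (Finset.mem_range.1 hk))]
          push_cast
          rw [← mul_pow]; norm_num
      _ = Nat.clog 2 m := by simp
  · -- the range `2 ^ K` is the first that reaches `m`, and is reduced to `2 ^ K - m`
    obtain ⟨K, hKe⟩ : ∃ K, Nat.clog 2 m = K + 1 := ⟨Nat.clog 2 m - 1, by omega⟩
    rw [hKe]
    have h1 : 2 ^ K < m := (Nat.lt_clog_iff_pow_lt (by norm_num)).1 (by omega)
    have h2 : m ≤ 2 ^ (K + 1) := hKe ▸ Nat.le_pow_clog (by norm_num) m
    have h3 : diceRange m (K + 1) + m = 2 ^ (K + 1) := by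
      rw [diceRange, diceRange_eq_two_pow h1, ← pow_succ', if_pos h2]
      omega
    have h4 : (diceRange m (K + 1) : ℝ) + m = 2 ^ (K + 1) := by exact_mod_cast h3
    rw [h4, ← mul_pow]; norm_num

variable (he : Function.Injective e)
include he

/-- The dice roller reads at most `⌈log₂ m⌉ + 1` bits on average. -/
theorem lintegral_drawUniform_bits_le {m : ℕ} (hm : 1 ≤ m) :
    ∫⁻ ω, (drawUniform m fun k => ω (e k)).elim ⊤ (fun u => (u.2 : ℝ≥0∞)) ∂fairBits ≤
      (Nat.clog 2 m + 1 : ℕ) := by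
  rcases Nat.lt_or_eq_of_le hm with hm | rfl
  · have h1 : ∀ ω : BitSource, (drawUniform m fun k => ω (e k)).elim ⊤ (fun u => (u.2 : ℝ≥0∞)) =
        ∑' k : ℕ, ind (diceAlive m (fun k => ω (e k)) k) := by
      intro ω
      have := elim_firstTime_eq_tsum (diceStop m fun k => ω (e k))
      rw [drawUniform_eq]
      refine Eq.trans ?_ this
      rcases firstTime (diceStop m fun k => ω (e k)) with _ | k <;> rfl
    have hr : ∀ k, ReadsOnly Set.univ fun ω => diceAlive m (fun k => ω (e k)) k := fun k =>
      (readsOnly_diceAlive m k).mono (Set.subset_univ _)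
    simp_rw [h1]
    rw [lintegral_tsum fun k =>
      ((hr k).measurable' ind).aemeasurable]
    refine ENNReal.tsum_le_of_sum_range_le fun N => ?_
    have h2 : ∀ k, ∫⁻ ω, ind (diceAlive m (fun k => ω (e k)) k) ∂fairBits =
        ENNReal.ofReal ((diceRange m k : ℝ) * 2⁻¹ ^ k) := by
      intro k
      rw [← measure_setOf_eq_lintegral (hr k), measure_diceAlive he hm k,
        ENNReal.ofReal_mul (by positivity), ENNReal.ofReal_pow (by positivity),
        ENNReal.ofReal_inv_of_pos (by norm_num)]
      simp
    simp_rw [h2]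
    rw [← ENNReal.ofReal_sum_of_nonneg fun k _ => by positivity]
    refine (ENNReal.ofReal_le_ofReal (sum_diceRange_le_clog hm N)).trans ?_
    rw [show (Nat.clog 2 m : ℝ) + 1 = ((Nat.clog 2 m + 1 : ℕ) : ℝ) by push_cast; ring,
      ENNReal.ofReal_natCast]
  · have : ∀ ω : BitSource, (drawUniform 1 fun k => ω (e k)).elim ⊤
        (fun u => (u.2 : ℝ≥0∞)) = 0 := by
      intro ω
      rw [drawUniform_eq, firstTime_eq_some (k := 0) (by simp [diceStop, diceState])
        fun j hj => absurd hj (Nat.not_lt_zero j)]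
      simp
    simp_rw [this]
    simp

theorem ae_isSome_drawUniform {m : ℕ} (hm : 1 ≤ m) :
    ∀ᵐ ω ∂fairBits, (drawUniform m fun k => ω (e k)).isSome :=
  ae_isSome_of_lintegral (readsOnly_drawUniform m) (fun u => (u.2 : ℝ≥0∞))
    ((lintegral_drawUniform_bits_le he hm).trans_lt (ENNReal.natCast_lt_top _)).ne

/-- At each time the dice roller stops with equal probability at each value. -/
theorem measure_drawUniform_value {m : ℕ} (hm : 2 ≤ m) (x : Fin m) :
    fairBits {ω | ∃ k, (drawUniform m fun k => ω (e k)) = some (x, k)} =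
      ∑' k : ℕ, if m ≤ 2 * diceRange m k then 2⁻¹ ^ (k + 1) else 0 := by
  have hset : {ω : BitSource | ∃ k, (drawUniform m fun k => ω (e k)) = some (x, k)} =
      ⋃ k, {ω : BitSource | diceAlive m (fun j => ω (e j)) k ∧
        diceStop m (fun j => ω (e j)) (k + 1) ∧
        (diceState m (fun j => ω (e j)) (k + 1)).2 = x} := by
    ext ω
    simp only [Set.mem_ofPred_eq, Set.mem_iUnion]
    constructor
    · rintro ⟨k, hk⟩
      rw [drawUniform_eq] at hk
      obtain ⟨⟨K, hK⟩, hK', hK''⟩ := Option.map_eq_some_iff.1 hk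
      have h1 := lt_of_firstTime hK'
      simp only [Prod.mk.injEq] at hK''
      rcases K with _ | K
      · exact absurd hK.1 (by simp [diceState]; omega)
      · exact ⟨K, fun j hj => h1 j (by omega), hK, congrArg Fin.val hK''.1⟩
    · rintro ⟨k, h1, h2, h3⟩
      refine ⟨k + 1, ?_⟩
      rw [drawUniform_eq, firstTime_eq_some h2 fun j hj => h1 j (by omega)]
      simp [h3]
  rw [hset, measure_iUnion]
  · exact tsum_congr fun k => measure_diceStop_value he hm k x.2
  · intro k l hkl
    refine Set.disjoint_left.2 fun ω h1 h2 => ?_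
    rcases lt_or_gt_of_ne hkl with h | h
    · exact h2.1 (k + 1) (by omega) h1.2.1
    · exact h1.1 (l + 1) (by omega) h2.2.1
  · intro k
    refine bitEvents_le Set.univ _ (ReadsOnly.of_prop_iff.1 ?_)
    refine ((readsOnly_diceAlive (e := e) m k).mono (Set.subset_univ _)).comp₂
      (((readsOnly_diceStop (e := e) m (k + 1)).mono (Set.subset_univ _)).comp₂
      ((readsOnly_diceState (e := e) m (k + 1)).mono (Set.subset_univ _))
      fun q s => q ∧ s.2 = x) And

theorem lintegral_drawUniform {m : ℕ} (hm : 1 ≤ m) (H : Fin m → ℝ≥0∞) :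
    ∫⁻ ω, (drawUniform m fun k => ω (e k)).elim 0 (fun u => H u.1) ∂fairBits =
      ∑ x, (m : ℝ≥0∞)⁻¹ * H x := by
  have hX := readsOnly_drawUniform (e := e) m
  have h1 := sum_outcome_eq_one hX (ae_isSome_drawUniform he hm)
  rw [lintegral_outcome hX]
  refine Finset.sum_congr rfl fun x _ => ?_
  congr 1
  have h2 : ∀ y, fairBits {ω | ∃ k, (drawUniform m fun k => ω (e k)) = some (y, k)} =
      fairBits {ω | ∃ k, (drawUniform m fun k => ω (e k)) = some (x, k)} := by
    intro y
    rcases Nat.lt_or_eq_of_le hm with hm | rfl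
    · rw [measure_drawUniform_value he hm, measure_drawUniform_value he hm]
    · rw [Subsingleton.elim x y]
  simp_rw [h2] at h1
  rw [Finset.sum_const, Finset.card_univ, Fintype.card_fin, nsmul_eq_mul] at h1
  exact ENNReal.eq_inv_of_mul_eq_one_left (by rwa [mul_comm])

omit he in
theorem readsOnly_bitsMatch (p : ℝ) (k : ℕ) :
    ReadsOnly (e '' {j | j < k}) fun ω => ∀ j < k, ω (e j) = digit p j := by
  refine ReadsOnly.forall_prop fun j => ?_
  by_cases hj : j < k
  · exact (ReadsOnly.bit (S := e '' {j | j < k}) ⟨j, hj, rfl⟩).comp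
      fun b => j < k → b = digit p j
  · simp only [hj, false_imp_iff]
    exact ReadsOnly.const _

omit he in
theorem readsOnly_drawBernoulli (p : ℝ) :
    ReadsOnly (Set.range e) fun ω => drawBernoulli p fun k => ω (e k) := by
  refine ReadsOnly.firstTime (p := fun k ω => ω (e k) ≠ digit p k)
    (X := fun k _ => (digit p k, k + 1)) (fun k => ?_) (fun k => ReadsOnly.const _) ?_ ?_
  · exact (ReadsOnly.bit (S := Set.range e) ⟨k, rfl⟩).comp fun b => b ≠ digit p k
  · intro ω k hk hj
    unfold drawBernoulli
    rw [firstTime_eq_some hk hj]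
    rfl
  · intro ω h
    unfold drawBernoulli
    rw [firstTime_eq_none h]
    rfl

theorem measure_bitsMatch (p : ℝ) :
    ∀ k, fairBits {ω | ∀ j < k, ω (e j) = digit p j} = 2⁻¹ ^ k
  | 0 => by simp
  | k + 1 => by
    have : {ω : BitSource | ∀ j < k + 1, ω (e j) = digit p j} =
        {ω | (∀ j < k, ω (e j) = digit p j) ∧ ω (e k) = digit p k} := by
      ext ω
      simp only [Set.mem_ofPred_eq]
      constructor
      · exact fun h => ⟨fun j hj => h j (by omega), h k (by omega)⟩
      · rintro ⟨h, h'⟩ j hj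
        rcases Nat.lt_succ_iff_lt_or_eq.1 hj with h1 | rfl
        · exact h j h1
        · exact h'
    rw [this, measure_inter_bit (readsOnly_bitsMatch p k) (notMem_image_of_injective he k),
      measure_bitsMatch p k, pow_succ']

theorem lintegral_drawBernoulli_bits (p : ℝ) :
    ∫⁻ ω, (drawBernoulli p fun k => ω (e k)).elim ⊤ (fun u => (u.2 : ℝ≥0∞)) ∂fairBits = 2 := by
  have h1 : ∀ ω : BitSource,
      (drawBernoulli p fun k => ω (e k)).elim ⊤ (fun u => (u.2 : ℝ≥0∞)) =
        ∑' k : ℕ, ind (∀ j < k, ω (e j) = digit p j) := by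
    intro ω
    have h := elim_firstTime_eq_tsum fun k => ω (e k) ≠ digit p k
    rw [tsum_eq_zero_add' ENNReal.summable]
    simp only [not_ne_iff] at h
    simp only [Nat.not_lt_zero, false_imp_iff, implies_true, ind_true, Nat.lt_succ_iff]
    rw [← h]
    unfold drawBernoulli
    rcases firstTime fun k => ω (e k) ≠ digit p k with _ | k
    · simp
    · simp [add_comm]
  have hr : ∀ k, ReadsOnly Set.univ fun ω : BitSource => ∀ j < k, ω (e j) = digit p j :=
    fun k => (readsOnly_bitsMatch p k).mono (Set.subset_univ _)
  simp_rw [h1]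
  rw [lintegral_tsum fun k =>
    ((hr k).measurable' ind).aemeasurable]
  simp_rw [← measure_setOf_eq_lintegral (hr _), measure_bitsMatch he p]
  rw [ENNReal.tsum_geometric, ENNReal.one_sub_inv_two, inv_inv]

end Stream

section Stream

variable {e : ℕ → ℕ × ℕ × Fin 3 × ℕ}

theorem ceil_two_mul_sub (y : ℝ) :
    ⌈2 * y⌉ - 1 = 2 * (⌈y⌉ - 1) + if (⌈2 * y⌉ - 1) % 2 = 1 then 1 else 0 := by
  have h1 : 2 * ⌈y⌉ - 2 < ⌈2 * y⌉ := by
    rw [Int.lt_ceil]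
    push_cast
    have := Int.ceil_lt_add_one y
    linarith
  have h2 : ⌈2 * y⌉ ≤ 2 * ⌈y⌉ := by
    rw [Int.ceil_le]
    push_cast
    have := Int.le_ceil y
    linarith
  split_ifs <;> omega

/-- The partial sums of the binary expansion that does not end in zeros. -/
theorem sum_digit {p : ℝ} (hp : 0 < p) (hp1 : p ≤ 1) (K : ℕ) :
    ∑ k ∈ Finset.range K, (if digit p k = true then (2⁻¹ : ℝ) ^ (k + 1) else 0) =
      ((⌈(2 : ℝ) ^ K * p⌉ : ℝ) - 1) * 2⁻¹ ^ K := by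
  induction K with
  | zero =>
    have : ⌈p⌉ = 1 := by
      rw [Int.ceil_eq_iff]
      simp [hp, hp1]
    simp [this]
  | succ K ih =>
    rw [Finset.sum_range_succ, ih]
    have h := ceil_two_mul_sub ((2 : ℝ) ^ K * p)
    rw [← mul_assoc, ← pow_succ'] at h
    have h' : ((⌈(2 : ℝ) ^ (K + 1) * p⌉ : ℝ) - 1) = 2 * ((⌈(2 : ℝ) ^ K * p⌉ : ℝ) - 1) +
        if (⌈(2 : ℝ) ^ (K + 1) * p⌉ - 1) % 2 = 1 then 1 else 0 := by
      exact_mod_cast h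
    rw [h']
    simp only [digit, decide_eq_true_eq]
    split_ifs <;> ring

theorem tsum_digit {p : ℝ} (hp : 0 < p) (hp1 : p ≤ 1) :
    ∑' k : ℕ, (if digit p k = true then (2⁻¹ : ℝ≥0∞) ^ (k + 1) else 0) = ENNReal.ofReal p := by
  refine tendsto_nhds_unique (ENNReal.tendsto_nat_tsum _) ?_
  have h1 : ∀ K, ∑ k ∈ Finset.range K, (if digit p k = true then (2⁻¹ : ℝ≥0∞) ^ (k + 1) else 0) =
      ENNReal.ofReal (((⌈(2 : ℝ) ^ K * p⌉ : ℝ) - 1) * 2⁻¹ ^ K) := by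
    intro K
    rw [← sum_digit hp hp1, ENNReal.ofReal_sum_of_nonneg]
    · refine Finset.sum_congr rfl fun k _ => ?_
      split_ifs
      · rw [ENNReal.ofReal_pow (by positivity), ENNReal.ofReal_inv_of_pos (by norm_num)]
        simp
      · simp
    · intro k _
      split_ifs <;> positivity
  simp_rw [h1]
  refine (ENNReal.continuous_ofReal.tendsto p).comp ?_
  have h2 : Filter.Tendsto (fun K : ℕ => p - (2⁻¹ : ℝ) ^ K) Filter.atTop (nhds p) := by
    simpa using tendsto_const_nhds.sub
      (tendsto_pow_atTop_nhds_zero_of_lt_one (r := (2⁻¹ : ℝ)) (by norm_num) (by norm_num))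
  refine tendsto_of_tendsto_of_tendsto_of_le_of_le h2 tendsto_const_nhds (fun K => ?_)
    (fun K => ?_)
  · have h3 : (0 : ℝ) ≤ 2⁻¹ ^ K := by positivity
    have h4 : (2 : ℝ) ^ K * 2⁻¹ ^ K = 1 := by rw [← mul_pow]; norm_num
    have := mul_le_mul_of_nonneg_right (Int.le_ceil ((2 : ℝ) ^ K * p)) h3
    simp only
    nlinarith
  · have h3 : (0 : ℝ) ≤ 2⁻¹ ^ K := by positivity
    have h4 : (2 : ℝ) ^ K * 2⁻¹ ^ K = 1 := by rw [← mul_pow]; norm_num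
    have := mul_le_mul_of_nonneg_right (Int.ceil_lt_add_one ((2 : ℝ) ^ K * p)).le h3
    simp only
    nlinarith

/-- The probabilities of the outcomes of a coin with success probability `p`. -/
def coinWeight (p : ℝ) (a : Bool) : ℝ≥0∞ :=
  if a then ENNReal.ofReal p else ENNReal.ofReal (1 - p)

theorem sum_coinWeight {p : ℝ} (hp : 0 ≤ p) (hp1 : p ≤ 1) : ∑ a, coinWeight p a = 1 := by
  simp only [coinWeight, Fintype.sum_bool, if_true, Bool.false_eq_true, if_false]
  rw [← ENNReal.ofReal_add hp (by linarith)]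
  simp

variable (he : Function.Injective e)
include he

theorem ae_isSome_drawBernoulli (p : ℝ) :
    ∀ᵐ ω ∂fairBits, (drawBernoulli p fun k => ω (e k)).isSome :=
  ae_isSome_of_lintegral (readsOnly_drawBernoulli p) (fun u => (u.2 : ℝ≥0∞))
    (by rw [lintegral_drawBernoulli_bits he p]; norm_num)

/-- The draw succeeds if the first digit of `p` from which the bits differ is a `1`. -/
theorem measure_drawBernoulli_true {p : ℝ} (hp : 0 < p) (hp1 : p ≤ 1) :
    fairBits {ω | ∃ k, (drawBernoulli p fun k => ω (e k)) = some (true, k)} =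
      ENNReal.ofReal p := by
  have hset : {ω : BitSource | ∃ k, (drawBernoulli p fun k => ω (e k)) = some (true, k)} =
      ⋃ k, {ω : BitSource | ((∀ j < k, ω (e j) = digit p j) ∧ digit p k = true) ∧
        ω (e k) = false} := by
    ext ω
    simp only [Set.mem_ofPred_eq, Set.mem_iUnion]
    constructor
    · rintro ⟨k, hk⟩
      obtain ⟨⟨K, hK⟩, hK', hK''⟩ := Option.map_eq_some_iff.1 hk
      simp only [Prod.mk.injEq] at hK''
      refine ⟨K, ⟨fun j hj => not_not.1 (lt_of_firstTime hK' j hj), hK''.1⟩, ?_⟩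
      simpa [hK''.1] using hK
    · rintro ⟨k, ⟨h1, h2⟩, h3⟩
      refine ⟨k + 1, ?_⟩
      unfold drawBernoulli
      rw [firstTime_eq_some (k := k) (by rw [h2, h3]; simp) fun j hj => not_not.2 (h1 j hj)]
      simp [h2]
  have hr : ∀ k, ReadsOnly (e '' {j | j < k}) fun ω : BitSource =>
      (∀ j < k, ω (e j) = digit p j) ∧ digit p k = true := fun k =>
    (readsOnly_bitsMatch p k).comp fun q => q ∧ digit p k = true
  rw [hset, measure_iUnion, ← tsum_digit hp hp1]
  · refine tsum_congr fun k => ?_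
    rw [measure_inter_bit (hr k) (notMem_image_of_injective he k)]
    split_ifs with h
    · simp only [h, and_true]
      rw [measure_bitsMatch he, pow_succ']
    · simp [h]
  · intro k l hkl
    refine Set.disjoint_left.2 fun ω h1 h2 => ?_
    rcases lt_or_gt_of_ne hkl with h | h
    · have := h2.1.1 k h
      rw [h1.2, h1.1.2] at this
      exact absurd this (by simp)
    · have := h1.1.1 l h
      rw [h2.2, h2.1.2] at this
      exact absurd this (by simp)
  · intro k
    refine bitEvents_le Set.univ _ (ReadsOnly.of_prop_iff.1 ?_)
    exact ((hr k).mono (Set.subset_univ _)).comp₂ (ReadsOnly.bit (Set.mem_univ (e k)))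
      fun q b => q ∧ b = false

theorem lintegral_drawBernoulli {p : ℝ} (hp : 0 < p) (hp1 : p ≤ 1) (H : Bool → ℝ≥0∞) :
    ∫⁻ ω, (drawBernoulli p fun k => ω (e k)).elim 0 (fun u => H u.1) ∂fairBits =
      ∑ a, coinWeight p a * H a := by
  have hX := readsOnly_drawBernoulli (e := e) p
  have h1 := sum_outcome_eq_one hX (ae_isSome_drawBernoulli he p)
  rw [lintegral_outcome hX]
  have h2 := measure_drawBernoulli_true he hp hp1
  have h3 := sum_coinWeight hp.le hp1
  simp only [Fintype.sum_bool] at h1 h3 ⊢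
  have h4 : fairBits {ω | ∃ k, (drawBernoulli p fun k => ω (e k)) = some (false, k)} =
      coinWeight p false := by
    rw [h2, ← h3] at h1
    exact (ENNReal.add_right_inj ENNReal.ofReal_ne_top).1 h1
  rw [h2, h4]
  rfl

end Stream

/-! ### The law of the draws of one call -/

theorem penalty_pos (β : ℝ) : 0 < penalty β := by
  unfold penalty
  have := Int.ceil_lt_add_one β
  linarith

theorem penalty_le_one (β : ℝ) : penalty β ≤ 1 := by
  unfold penalty
  have := Int.le_ceil β
  linarith

instance (n : ℕ) : Countable (Draw n) := by
  refine Function.Injective.countable (f := fun d : Draw n => (d.i, d.coin, d.accept, d.bits)) ?_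
  rintro ⟨a, b, c, d⟩ ⟨a', b', c', d'⟩ h
  simpa using h

/-- The expected value of a function of the choices of one step: of the position, of the fair coin,
and of the penalty coin. -/
def avgDraw (n : ℕ) (β : ℝ) (H : Fin (n - 1) → Bool → Bool → ℝ≥0∞) : ℝ≥0∞ :=
  ∑ i, ((n - 1 : ℕ) : ℝ≥0∞)⁻¹ * ∑ c, 2⁻¹ * ∑ a, coinWeight (penalty β) a * H i c a

/-- The indices of the bits of the draw number `r` of step `j` in the call with `t` steps. -/
def drawIndex (t j : ℕ) (r : Fin 3) (k : ℕ) : ℕ × ℕ × Fin 3 × ℕ := (t, j, r, k)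

theorem drawIndex_injective (t j : ℕ) (r : Fin 3) : Function.Injective (drawIndex t j r) := by
  intro k l h
  simpa [drawIndex] using h

theorem disjoint_range_drawIndex (t j : ℕ) {r s : Fin 3} (h : r ≠ s) :
    Disjoint (Set.range (drawIndex t j r)) (Set.range (drawIndex t j s)) := by
  refine Set.disjoint_left.2 ?_
  rintro _ ⟨k, rfl⟩ ⟨l, hl⟩
  simp only [drawIndex, Prod.mk.injEq] at hl
  exact h hl.2.2.1.symm

theorem drawStep_eq (n : ℕ) (β : ℝ) (ω : BitSource) (t j : ℕ) :
    drawStep n β ω t j =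
      (drawUniform (n - 1) fun k => ω (drawIndex t j 0 k)).bind fun u =>
        (drawBernoulli (penalty β) fun k => ω (drawIndex t j 2 k)).map fun a =>
          ⟨u.1, ω (drawIndex t j 1 0), a.1, u.2 + 1 + a.2⟩ := by
  unfold drawStep
  rcases h1 : (drawUniform (n - 1) fun k => ω (drawIndex t j 0 k)) with _ | u <;>
    rcases h2 : (drawBernoulli (penalty β) fun k => ω (drawIndex t j 2 k)) with _ | a <;>
    simp only [drawIndex] at h1 h2 <;> simp [h1, h2, drawIndex]

theorem readsOnly_drawStep (n : ℕ) (β : ℝ) (t j : ℕ) :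
    ReadsOnly {x | x.1 = t ∧ x.2.1 = j} fun ω => drawStep n β ω t j := by
  have hsub : ∀ r, Set.range (drawIndex t j r) ⊆ {x | x.1 = t ∧ x.2.1 = j} := by
    rintro r _ ⟨k, rfl⟩
    exact ⟨rfl, rfl⟩
  simp_rw [drawStep_eq]
  refine ((readsOnly_drawUniform (n - 1)).mono (hsub 0)).comp₂
    (((ReadsOnly.bit (S := Set.range (drawIndex t j 1)) ⟨0, rfl⟩).mono (hsub 1)).comp₂
      ((readsOnly_drawBernoulli (penalty β)).mono (hsub 2)) Prod.mk)
    fun u y => u.bind fun u => y.2.map fun a => (⟨u.1, y.1, a.1, u.2 + 1 + a.2⟩ : Draw n)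

theorem lintegral_drawStep {n : ℕ} (hn : 2 ≤ n) (β : ℝ) (t j : ℕ)
    (H : Fin (n - 1) → Bool → Bool → ℝ≥0∞) :
    ∫⁻ ω, (drawStep n β ω t j).elim 0 (fun d => H d.i d.coin d.accept) ∂fairBits =
      avgDraw n β H := by
  have hU := readsOnly_drawUniform (e := drawIndex t j 0) (n - 1)
  have hB := readsOnly_drawBernoulli (e := drawIndex t j 2) (penalty β)
  have hC : ReadsOnly (Set.range (drawIndex t j 1)) fun ω => ω (drawIndex t j 1 0) :=
    ReadsOnly.bit ⟨0, rfl⟩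
  have hCB := (hC.mono (Set.subset_union_left (t := Set.range (drawIndex t j 2)))).comp₂
    (hB.mono (Set.subset_union_right (s := Set.range (drawIndex t j 1)))) Prod.mk
  have h1 : ∀ ω, (drawStep n β ω t j).elim 0 (fun d => H d.i d.coin d.accept) =
      (drawUniform (n - 1) fun k => ω (drawIndex t j 0 k)).elim 0 fun u =>
        (drawBernoulli (penalty β) fun k => ω (drawIndex t j 2 k)).elim 0 fun a =>
          H u.1 (ω (drawIndex t j 1 0)) a.1 := by
    intro ω
    rw [drawStep_eq]
    rcases (drawUniform (n - 1) fun k => ω (drawIndex t j 0 k)) with _ | u <;>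
    rcases (drawBernoulli (penalty β) fun k => ω (drawIndex t j 2 k)) with _ | a <;> rfl
  have hd : Disjoint (Set.range (drawIndex t j 0))
      (Set.range (drawIndex t j 1) ∪ Set.range (drawIndex t j 2)) :=
    Set.disjoint_union_right.2 ⟨disjoint_range_drawIndex t j (by decide),
      disjoint_range_drawIndex t j (by decide)⟩
  simp_rw [h1]
  refine (lintegral_of_disjoint hd hU hCB fun u y => u.elim 0 fun u => y.2.elim 0 fun a =>
    H u.1 y.1 a.1).trans ?_
  have h2 : ∀ i, ∫⁻ ω, (drawBernoulli (penalty β) fun k => ω (drawIndex t j 2 k)).elim 0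
      (fun a => H i (ω (drawIndex t j 1 0)) a.1) ∂fairBits =
      ∑ c, 2⁻¹ * ∑ a, coinWeight (penalty β) a * H i c a := by
    intro i
    refine (lintegral_of_disjoint (disjoint_range_drawIndex t j (by decide)) hC hB
      fun c y => y.elim 0 fun a => H i c a.1).trans ?_
    simp_rw [lintegral_drawBernoulli (drawIndex_injective t j 2) (penalty_pos β)
      (penalty_le_one β)]
    exact lintegral_bit _ fun c => ∑ a, coinWeight (penalty β) a * H i c a
  refine Eq.trans ?_ (lintegral_drawUniform (drawIndex_injective t j 0) (m := n - 1) (by omega)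
    fun i => ∑ c, 2⁻¹ * ∑ a, coinWeight (penalty β) a * H i c a)
  refine lintegral_congr fun ω => ?_
  rcases (drawUniform (n - 1) fun k => ω (drawIndex t j 0 k)) with _ | u
  · simp
  · exact h2 u.1

theorem lintegral_drawStep_bits_le {n : ℕ} (hn : 2 ≤ n) (β : ℝ) (t j : ℕ) :
    ∫⁻ ω, (drawStep n β ω t j).elim ⊤ (fun d => (d.bits : ℝ≥0∞)) ∂fairBits ≤
      (Nat.clog 2 (n - 1) + 4 : ℕ) := by
  have hU := readsOnly_drawUniform (e := drawIndex t j 0) (n - 1)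
  have hB := readsOnly_drawBernoulli (e := drawIndex t j 2) (penalty β)
  have h1 : ∀ ω, (drawStep n β ω t j).elim ⊤ (fun d => (d.bits : ℝ≥0∞)) ≤
      ((drawUniform (n - 1) fun k => ω (drawIndex t j 0 k)).elim ⊤ (fun u => (u.2 : ℝ≥0∞)) + 1) +
      (drawBernoulli (penalty β) fun k => ω (drawIndex t j 2 k)).elim ⊤
        (fun u => (u.2 : ℝ≥0∞)) := by
    intro ω
    rw [drawStep_eq]
    rcases (drawUniform (n - 1) fun k => ω (drawIndex t j 0 k)) with _ | u <;>
    rcases (drawBernoulli (penalty β) fun k => ω (drawIndex t j 2 k)) with _ | a <;> simp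
  refine (lintegral_mono h1).trans ?_
  rw [lintegral_add_right _ (hB.measurable' fun x => x.elim ⊤ fun u => (u.2 : ℝ≥0∞)),
    lintegral_add_right _ measurable_const,
    lintegral_drawBernoulli_bits (drawIndex_injective t j 2)]
  refine (add_le_add_left (add_le_add_left (lintegral_drawUniform_bits_le
    (drawIndex_injective t j 0) (by omega)) _) _).trans ?_
  simp only [lintegral_const, measure_univ, mul_one]
  rw [show (Nat.clog 2 (n - 1) + 4 : ℕ) = (Nat.clog 2 (n - 1) + 1) + 1 + 2 by ring]
  push_cast
  exact le_rfl

theorem ae_isSome_drawStep {n : ℕ} (hn : 2 ≤ n) (β : ℝ) (t j : ℕ) :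
    ∀ᵐ ω ∂fairBits, (drawStep n β ω t j).isSome :=
  ae_isSome_of_lintegral (readsOnly_drawStep n β t j) (fun d => (d.bits : ℝ≥0∞))
    ((lintegral_drawStep_bits_le hn β t j).trans_lt (ENNReal.natCast_lt_top _)).ne

/-- The draws of the first `k` steps of the call with `t` steps. -/
def drawFirst (n : ℕ) (β : ℝ) (ω : BitSource) (t k : ℕ) : Option (List (Draw n)) :=
  (List.range k).mapM (drawStep n β ω t)

theorem drawFirst_succ (n : ℕ) (β : ℝ) (ω : BitSource) (t k : ℕ) :
    drawFirst n β ω t (k + 1) = (drawFirst n β ω t k).bind fun l =>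
      (drawStep n β ω t k).map fun d => l ++ [d] := by
  unfold drawFirst
  rw [List.range_succ, List.mapM_append]
  rcases (List.range k).mapM (drawStep n β ω t) with _ | l
  · rfl
  · rcases h : drawStep n β ω t k with _ | d <;> simp [h]

theorem length_of_drawFirst {n : ℕ} {β : ℝ} {ω : BitSource} {t : ℕ} :
    ∀ {k : ℕ} {l : List (Draw n)}, drawFirst n β ω t k = some l → l.length = k
  | 0, l, h => by
    have : l = [] := by simpa [drawFirst, eq_comm] using h
    simp [this]
  | k + 1, l, h => by
    rw [drawFirst_succ] at h
    obtain ⟨l', h1, h2⟩ := Option.bind_eq_some_iff.1 h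
    obtain ⟨d, -, rfl⟩ := Option.map_eq_some_iff.1 h2
    simp [length_of_drawFirst h1]

theorem readsOnly_drawFirst (n : ℕ) (β : ℝ) (t k : ℕ) :
    ReadsOnly {x | x.1 = t ∧ x.2.1 < k} fun ω => drawFirst n β ω t k := by
  induction k with
  | zero => exact ReadsOnly.const _
  | succ k ih =>
    simp_rw [drawFirst_succ]
    have h1 : {x : ℕ × ℕ × Fin 3 × ℕ | x.1 = t ∧ x.2.1 < k} ⊆ {x | x.1 = t ∧ x.2.1 < k + 1} :=
      fun x hx => ⟨hx.1, Nat.lt_succ_of_lt hx.2⟩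
    have h2 : {x : ℕ × ℕ × Fin 3 × ℕ | x.1 = t ∧ x.2.1 = k} ⊆ {x | x.1 = t ∧ x.2.1 < k + 1} :=
      fun x hx => ⟨hx.1, hx.2.trans_lt (Nat.lt_succ_self k)⟩
    exact (ih.mono h1).comp₂ ((readsOnly_drawStep n β t k).mono h2)
      fun l d => l.bind fun l => d.map fun d => l ++ [d]

theorem ae_isSome_drawFirst {n : ℕ} (hn : 2 ≤ n) (β : ℝ) (t k : ℕ) :
    ∀ᵐ ω ∂fairBits, (drawFirst n β ω t k).isSome := by
  induction k with
  | zero => exact Filter.Eventually.of_forall fun ω => rfl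
  | succ k ih =>
    filter_upwards [ih, ae_isSome_drawStep hn β t k] with ω h1 h2
    obtain ⟨l, hl⟩ := Option.isSome_iff_exists.1 h1
    obtain ⟨d, hd⟩ := Option.isSome_iff_exists.1 h2
    rw [drawFirst_succ, hl, hd]
    rfl

theorem lintegral_drawFirst_bits_le {n : ℕ} (hn : 2 ≤ n) (β : ℝ) (t k : ℕ) :
    ∫⁻ ω, (drawFirst n β ω t k).elim 0 (fun l => ((l.map Draw.bits).sum : ℝ≥0∞)) ∂fairBits ≤
      (k * (Nat.clog 2 (n - 1) + 4) : ℕ) := by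
  induction k with
  | zero => simp [drawFirst]
  | succ k ih =>
    have h1 : ∀ ω, (drawFirst n β ω t (k + 1)).elim 0
        (fun l => ((l.map Draw.bits).sum : ℝ≥0∞)) ≤
        (drawFirst n β ω t k).elim 0 (fun l => ((l.map Draw.bits).sum : ℝ≥0∞)) +
        (drawStep n β ω t k).elim ⊤ (fun d => (d.bits : ℝ≥0∞)) := by
      intro ω
      rw [drawFirst_succ]
      rcases drawFirst n β ω t k with _ | l <;> rcases drawStep n β ω t k with _ | d <;> simp
    refine (lintegral_mono h1).trans ?_
    rw [lintegral_add_right _ ((readsOnly_drawStep n β t k).measurable'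
      fun x => x.elim ⊤ fun d => (d.bits : ℝ≥0∞))]
    refine (add_le_add ih (lintegral_drawStep_bits_le hn β t k)).trans ?_
    rw [← Nat.cast_add, add_mul, one_mul]

variable {n : ℕ} {α : Type*} [PartialOrder α]

/-- The expected value of a function of the state after one step. -/
def stepOp (β : ℝ) (home : Fin n ≃ α) (Γ : State n α → ℝ≥0∞) (s : State n α) : ℝ≥0∞ :=
  avgDraw n β fun i c a => Γ (boundingChainStep β home s ⟨i, c, a, 0⟩)

/-- The expected value of a function of the state after `k` steps with random draws. -/
theorem lintegral_drawFirst (hn : 2 ≤ n) (β : ℝ) (home : Fin n ≃ α) (t : ℕ) (σ : Fin n → α)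
    (k : ℕ) (Γ : State n α → ℝ≥0∞) :
    ∫⁻ ω, (drawFirst n β ω t k).elim 0 (fun l => Γ (runSteps β home σ l)) ∂fairBits =
      (stepOp β home)^[k] Γ ⟨σ, initialBound home, 0⟩ := by
  induction k generalizing Γ with
  | zero =>
    simp [drawFirst, runSteps]
  | succ k ih =>
    rw [Function.iterate_succ_apply, ← ih]
    have hd : Disjoint {x : ℕ × ℕ × Fin 3 × ℕ | x.1 = t ∧ x.2.1 < k}
        {x | x.1 = t ∧ x.2.1 = k} :=
      Set.disjoint_left.2 fun x h1 h2 => absurd h2.2 h1.2.ne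
    refine Eq.trans ?_ ((lintegral_of_disjoint hd (readsOnly_drawFirst n β t k)
      (readsOnly_drawStep n β t k) fun l d => l.elim 0 fun l => d.elim 0 fun d =>
        Γ (boundingChainStep β home (runSteps β home σ l) d)).trans ?_)
    · refine lintegral_congr fun ω => ?_
      rw [drawFirst_succ]
      rcases drawFirst n β ω t k with _ | l <;> rcases drawStep n β ω t k with _ | d <;>
        simp [runSteps]
    · refine lintegral_congr fun ω => ?_
      rcases drawFirst n β ω t k with _ | l
      · simp
      · exact lintegral_drawStep hn β t k fun i c a =>
          Γ (boundingChainStep β home (runSteps β home σ l) ⟨i, c, a, 0⟩)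

/-! ### The invariants of the chain and of its bounding chain -/

section Invariants

variable {n : ℕ} {α : Type*} [PartialOrder α] {β : ℝ} {home : Fin n ≃ α}

/-- The linear extensions of nonzero weight. -/
structure Admissible (β : ℝ) (home : Fin n ≃ α) (σ : Fin n → α) : Prop where
  bij : Function.Bijective σ
  lin : ∀ i j, i < j → ¬ σ j ≤ σ i
  disp : ∀ i, displacement home (σ i) i ≤ ⌈β⌉

/-- The invariants of the bounding state. Its elements are distinct, are the first ones of the home
state, and are in an order that is compatible with the poset. An element may lie beyond its largest
admissible displacement, as it enters at the last position; but then it has never moved to the right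
and therefore no element that entered later has passed it. -/
structure BoundInv (β : ℝ) (home : Fin n ≃ α) (B : Fin n → Option α) : Prop where
  inj : ∀ i j a, B i = some a → B j = some a → i = j
  mem_iff : ∀ a, (∃ i, B i = some a) ↔
    (home.symm a : ℕ) < (Finset.univ.filter fun j => B j ≠ none).card
  ord : ∀ i j a b, i < j → B i = some a → B j = some b → ¬ b ≤ a
  late : ∀ i j a b, B i = some a → B j = some b → j < i → home.symm a < home.symm b →
    displacement home a i ≤ ⌈β⌉

/-- Every element of the bounding state lies in the state at the same position or further left. -/
def Bounds (σ : Fin n → α) (B : Fin n → Option α) : Prop :=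
  ∀ i j a, B i = some a → σ j = a → j ≤ i

omit [PartialOrder α] in
theorem MayMove.le {a : α} {i : Fin n} {acc : Bool} (h : MayMove β home acc a i) :
    displacement home a i ≤ ⌈β⌉ - 1 := by
  rcases h with h | ⟨h, -⟩ <;> omega

omit [PartialOrder α] in
theorem le_of_not_mayMove {a : α} {i : Fin n} {acc : Bool} (h : ¬ MayMove β home acc a i) :
    ⌈β⌉ - 1 ≤ displacement home a i := by
  by_contra hc
  exact h (Or.inl (by omega))

theorem swap_cases {l r : Fin n} (i : Fin n) :
    (i = l ∧ Equiv.swap l r i = r) ∨ (i = r ∧ Equiv.swap l r i = l) ∨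
      (i ≠ l ∧ i ≠ r ∧ Equiv.swap l r i = i) := by
  by_cases h1 : i = l
  · exact Or.inl ⟨h1, by rw [h1, Equiv.swap_apply_left]⟩
  by_cases h2 : i = r
  · exact Or.inr (Or.inl ⟨h2, by rw [h2, Equiv.swap_apply_right]⟩)
  · exact Or.inr (Or.inr ⟨h1, h2, Equiv.swap_apply_of_ne_of_ne h1 h2⟩)

theorem lin_swap {σ : Fin n → α} (h : ∀ i j, i < j → ¬ σ j ≤ σ i) {l r : Fin n}
    (hlr : (l : ℕ) + 1 = r) (hle : ¬ σ l ≤ σ r) (i j : Fin n) (hij : i < j) :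
    ¬ (σ ∘ Equiv.swap l r) j ≤ (σ ∘ Equiv.swap l r) i := by
  have h1 := swap_cases (l := l) (r := r) i
  have h2 := swap_cases (l := l) (r := r) j
  simp only [Function.comp]
  rcases h1 with ⟨rfl, e1⟩ | ⟨rfl, e1⟩ | ⟨n1, n1', e1⟩ <;>
  rcases h2 with ⟨rfl, e2⟩ | ⟨rfl, e2⟩ | ⟨n2, n2', e2⟩ <;>
  first
  | exact absurd hij (lt_irrefl _)
  | (rw [e1, e2]; exact hle)
  | (rw [e1, e2]; exact h _ _ hij)
  | (rw [e1, e2]; refine h _ _ ?_; simp only [Fin.lt_def, ne_eq, Fin.ext_iff] at *; omega)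

theorem Admissible.swap {σ : Fin n → α} (h : Admissible β home σ) {l r : Fin n}
    (hlr : (l : ℕ) + 1 = r) (hle : ¬ σ l ≤ σ r) {acc : Bool}
    (hm : MayMove β home acc (σ l) l) : Admissible β home (σ ∘ Equiv.swap l r) where
  bij := h.bij.comp (Equiv.bijective _)
  lin := lin_swap h.lin hlr hle
  disp i := by
    have h1 := swap_cases (l := l) (r := r) i
    simp only [Function.comp]
    have h2 := hm.le
    have h3 := h.disp r
    have h4 := h.disp i
    unfold displacement at *
    rcases h1 with ⟨rfl, e1⟩ | ⟨rfl, e1⟩ | ⟨n1, n1', e1⟩ <;> rw [e1] <;> omega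

theorem BoundInv.swap {B : Fin n → Option α} (h : BoundInv β home B) {l r : Fin n}
    (hlr : (l : ℕ) + 1 = r) (hle : ∀ a ∈ B l, ∀ b ∈ B r, ¬ a ≤ b) {acc : Bool}
    (hm : ∀ a ∈ B l, MayMove β home acc a l) : BoundInv β home (B ∘ Equiv.swap l r) where
  inj i j a hi hj := (Equiv.swap l r).injective (h.inj _ _ a hi hj)
  mem_iff a := by
    have hc : (Finset.univ.filter fun j => (B ∘ Equiv.swap l r) j ≠ none).card =
        (Finset.univ.filter fun j => B j ≠ none).card :=
      Finset.card_equiv (Equiv.swap l r) (by simp)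
    rw [hc, ← h.mem_iff]
    constructor
    · rintro ⟨i, hi⟩; exact ⟨_, hi⟩
    · rintro ⟨i, hi⟩; exact ⟨Equiv.swap l r i, by simpa using hi⟩
  ord i j a b hij hi hj := by
    have h1 := swap_cases (l := l) (r := r) i
    have h2 := swap_cases (l := l) (r := r) j
    simp only [Function.comp] at hi hj
    rcases h1 with ⟨rfl, e1⟩ | ⟨rfl, e1⟩ | ⟨n1, n1', e1⟩ <;>
    rcases h2 with ⟨rfl, e2⟩ | ⟨rfl, e2⟩ | ⟨n2, n2', e2⟩ <;> rw [e1] at hi <;> rw [e2] at hj <;>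
    first
    | exact hle _ hj _ hi
    | (refine h.ord _ _ _ _ ?_ hi hj; simp only [Fin.lt_def, ne_eq, Fin.ext_iff] at *; omega)
  late i j a b hi hj hji hab := by
    have h1 := swap_cases (l := l) (r := r) i
    have h2 := swap_cases (l := l) (r := r) j
    simp only [Function.comp] at hi hj
    have h3 : ∀ {i j : Fin n}, B i = some a → B j = some b → j < i →
        ((i : ℕ) : ℤ) - (home.symm a : ℕ) ≤ ⌈β⌉ := fun hi hj hji => h.late _ _ _ _ hi hj hji hab
    unfold displacement
    rcases h1 with ⟨rfl, e1⟩ | ⟨rfl, e1⟩ | ⟨n1, n1', e1⟩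
    · -- the element that moves to the left only lowers its displacement
      rw [e1] at hi
      rcases h2 with ⟨rfl, e2⟩ | ⟨rfl, e2⟩ | ⟨n2, n2', e2⟩ <;> rw [e2] at hj
      · exact absurd hji (lt_irrefl _)
      · simp only [Fin.lt_def] at *; omega
      · have := h3 hi hj (by simp only [Fin.lt_def] at *; omega)
        omega
    · rw [e1] at hi
      have := (hm a hi).le
      unfold displacement at this
      omega
    · rw [e1] at hi
      refine h3 hi hj ?_
      rcases h2 with ⟨rfl, e2⟩ | ⟨rfl, e2⟩ | ⟨n2, n2', e2⟩ <;> rw [e2] <;>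
      simp only [Fin.lt_def, ne_eq, Fin.ext_iff] at * <;> omega

omit [PartialOrder α] in
theorem refill_apply_of_ne {B : Fin n → Option α} {i : Fin n}
    (h : ¬ ((i : ℕ) + 1 = n ∧ B i = none)) :
    refill home B i = B i := by
  unfold refill
  rw [dif_neg h]

omit [PartialOrder α] in
theorem refill_eq_self {B : Fin n → Option α} (h : ∀ i : Fin n, (i : ℕ) + 1 = n → B i ≠ none) :
    refill home B = B :=
  funext fun i => refill_apply_of_ne fun hc => h i hc.1 hc.2

omit [PartialOrder α] in
theorem refill_ne_none (B : Fin n → Option α) {i : Fin n} (hi : (i : ℕ) + 1 = n) :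
    refill home B i ≠ none := by
  unfold refill
  split_ifs with h
  · simp
  · intro hB
    exact h ⟨hi, hB⟩

theorem BoundInv.refill {B : Fin n → Option α} (hhome : IsLinearExtension home)
    (h : BoundInv β home B) : BoundInv β home (refill home B) := by
  by_cases hlast : ∀ i : Fin n, (i : ℕ) + 1 = n → B i ≠ none
  · rwa [refill_eq_self hlast]
  push Not at hlast
  obtain ⟨z, hz, hBz⟩ := hlast
  obtain ⟨p, hp⟩ : ∃ p : Fin n, (p : ℕ) = (Finset.univ.filter fun j => B j ≠ none).card :=
    ⟨⟨_, (Finset.card_lt_univ_of_notMem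
      (s := Finset.univ.filter fun j => B j ≠ none) (x := z) (by simp [hBz])).trans_eq
        (Fintype.card_fin n)⟩,
      rfl⟩
  have hz' : LinExt.refill home B z = some (home p) := by
    unfold LinExt.refill
    rw [dif_pos ⟨hz, hBz⟩]
    congr 2
    exact Fin.ext hp.symm
  have ho : ∀ i, i ≠ z → LinExt.refill home B i = B i := by
    intro i hi
    refine refill_apply_of_ne fun hc => hi (Fin.ext ?_)
    omega
  have hlt : ∀ {i a}, B i = some a → home.symm a < p := by
    intro i a hi
    rw [Fin.lt_def, hp]
    exact (h.mem_iff a).1 ⟨i, hi⟩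
  have hle : ∀ i : Fin n, i ≤ z := fun i => by rw [Fin.le_def]; omega
  have hcases : ∀ {i a}, LinExt.refill home B i = some a →
      (i = z ∧ a = home p) ∨ (i ≠ z ∧ B i = some a) := by
    intro i a hi
    by_cases hiz : i = z
    · rw [hiz, hz'] at hi
      exact Or.inl ⟨hiz, (Option.some.inj hi).symm⟩
    · rw [ho i hiz] at hi
      exact Or.inr ⟨hiz, hi⟩
  have hcard : (Finset.univ.filter fun j => LinExt.refill home B j ≠ none).card = p + 1 := by
    have : (Finset.univ.filter fun j => LinExt.refill home B j ≠ none) =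
        insert z (Finset.univ.filter fun j => B j ≠ none) := by
      ext j
      by_cases hj : j = z
      · simp [hj, hz']
      · simp [hj, ho j hj]
    rw [this, Finset.card_insert_of_notMem (by simp [hBz]), hp]
  refine ⟨fun i j a hi hj => ?_, fun a => ?_, fun i j a b hij hi hj => ?_,
    fun i j a b hi hj hji hab => ?_⟩
  · rcases hcases hi with ⟨h1, h2⟩ | ⟨h1, h2⟩ <;> rcases hcases hj with ⟨h3, h4⟩ | ⟨h3, h4⟩
    · rw [h1, h3]
    · exact absurd (hlt h4) (by simp [h2])
    · exact absurd (hlt h2) (by simp [h4])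
    · exact h.inj i j a h2 h4
  · rw [hcard]
    constructor
    · rintro ⟨i, hi⟩
      rcases hcases hi with ⟨-, h2⟩ | ⟨-, h2⟩
      · simp [h2]
      · have := hlt h2
        rw [Fin.lt_def] at this
        omega
    · intro ha
      rcases Nat.lt_succ_iff_lt_or_eq.1 ha with h1 | h1
      · obtain ⟨i, hi⟩ := (h.mem_iff a).2 (hp ▸ h1)
        refine ⟨i, ?_⟩
        rw [ho i, hi]
        rintro rfl
        rw [hBz] at hi
        exact absurd hi (by simp)
      · refine ⟨z, ?_⟩
        rw [hz', ← Fin.ext h1, Equiv.apply_symm_apply]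
  · rcases hcases hi with ⟨h1, h2⟩ | ⟨h1, h2⟩
    · exact absurd hij (not_lt.2 (h1 ▸ hle j))
    rcases hcases hj with ⟨h3, h4⟩ | ⟨h3, h4⟩
    · have := hhome _ _ (hlt h2)
      rwa [Equiv.apply_symm_apply, ← h4] at this
    · exact h.ord i j a b hij h2 h4
  · rcases hcases hj with ⟨h1, h2⟩ | ⟨h1, h2⟩
    · exact absurd hji (not_lt.2 (h1 ▸ hle i))
    rcases hcases hi with ⟨h3, h4⟩ | ⟨h3, h4⟩
    · rw [h4, Equiv.symm_apply_apply] at hab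
      exact absurd hab (not_lt.2 (hlt h2).le)
    · exact h.late i j a b h4 h2 hji hab

theorem boundInv_initialBound (hn : 1 ≤ n) : BoundInv β home (initialBound home) := by
  have hc : ∀ {i : Fin n} {a : α}, initialBound home i = some a →
      (i : ℕ) + 1 = n ∧ home ⟨0, hn⟩ = a := by
    intro i a hi
    unfold initialBound at hi
    split_ifs at hi with h
    exact ⟨h, Option.some.inj hi⟩
  have hz : initialBound home ⟨n - 1, by omega⟩ = some (home ⟨0, hn⟩) := by
    unfold initialBound
    rw [if_pos (by simp; omega)]
  have hcard : (Finset.univ.filter fun j => initialBound home j ≠ none).card = 1 := by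
    rw [Finset.card_eq_one]
    refine ⟨⟨n - 1, by omega⟩, ?_⟩
    ext j
    simp only [Finset.mem_filter, Finset.mem_univ, true_and, Finset.mem_singleton]
    constructor
    · intro hj
      obtain ⟨a, ha⟩ := Option.ne_none_iff_exists'.1 hj
      refine Fin.ext ?_
      have := (hc ha).1
      simp only
      omega
    · rintro rfl
      rw [hz]; simp
  refine ⟨fun i j a hi hj => ?_, fun a => ?_, fun i j a b hij hi hj => ?_,
    fun i j a b hi hj hji hab => ?_⟩
  · have h1 := (hc hi).1
    have h2 := (hc hj).1
    exact Fin.ext (by omega)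
  · rw [hcard]
    constructor
    · rintro ⟨i, hi⟩
      rw [← (hc hi).2]
      simp
    · intro ha
      refine ⟨_, hz.trans ?_⟩
      rw [← Equiv.apply_symm_apply home a]
      congr 2
      exact Fin.ext (by simp only; omega)
  · have h1 := (hc hi).1
    have h2 := (hc hj).1
    rw [Fin.lt_def] at hij
    omega
  · have h1 := (hc hi).1
    have h2 := (hc hj).1
    rw [Fin.lt_def] at hji
    omega

omit [PartialOrder α] in
theorem bounds_initialBound (σ : Fin n → α) : Bounds σ (initialBound home) := by
  intro i j a hi _
  unfold initialBound at hi
  split_ifs at hi with h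
  rw [Fin.le_def]
  omega

omit [PartialOrder α] in
theorem Bounds.refill {σ : Fin n → α} {B : Fin n → Option α} (h : Bounds σ B) :
    Bounds σ (refill home B) := by
  intro i j a hi hj
  by_cases hc : (i : ℕ) + 1 = n
  · rw [Fin.le_def]; omega
  · rw [refill_apply_of_ne fun h => hc h.1] at hi
    exact h i j a hi hj

theorem symm_lt_symm_of_le (hhome : IsLinearExtension home) {x y : α} (hxy : x ≤ y) (hne : x ≠ y) :
    home.symm x < home.symm y := by
  rcases lt_trichotomy (home.symm x) (home.symm y) with h | h | h
  · exact h
  · exact absurd (home.symm.injective h) hne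
  · have := hhome _ _ h
    simp only [Equiv.apply_symm_apply] at this
    exact absurd hxy this

/-- The coupled coins keep the bounding property. The state moves its element to the right past the
bounding position only if the bounding state holds the same element there and may move it as well;
and the bounding state moves an element to the left only if the state does the same move. -/
theorem bounds_step (hhome : IsLinearExtension home) {σ : Fin n → α} {B : Fin n → Option α}
    (hσ : Admissible β home σ) (hB : BoundInv β home B) (hb : Bounds σ B) {l r : Fin n}
    (hlr : (l : ℕ) + 1 = r) {c₁ c₃ acc : Bool} (hc : c₁ = if B r = some (σ l) then !c₃ else c₃) :
    Bounds
      (if c₁ = true ∧ ¬ σ l ≤ σ r ∧ MayMove β home acc (σ l) l then σ ∘ Equiv.swap l r else σ)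
      (if c₃ = true ∧ (∀ a ∈ B l, ∀ b ∈ B r, ¬ a ≤ b) ∧ (∀ a ∈ B l, MayMove β home acc a l)
        then B ∘ Equiv.swap l r else B) := by
  have hne : l ≠ r := by rintro rfl; omega
  intro i j a hi hj
  by_contra hij
  split_ifs at hi hj with hBs hσs hσs
  · -- both states exchange their entries
    simp only [Function.comp] at hi hj
    have h0 := hb _ _ _ hi hj
    have h1 := swap_cases (l := l) (r := r) i
    have h2 := swap_cases (l := l) (r := r) j
    rcases h1 with ⟨rfl, e1⟩ | ⟨rfl, e1⟩ | ⟨n1, n1', e1⟩ <;>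
    rcases h2 with ⟨rfl, e2⟩ | ⟨rfl, e2⟩ | ⟨n2, n2', e2⟩ <;>
    first
    | exact hij le_rfl
    | (rw [e1, e2] at h0; exfalso; simp only [Fin.le_def, ne_eq, Fin.ext_iff] at *; omega)
    | (rw [e1] at hi h0; rw [e2] at hj h0)
    rw [if_pos (hj ▸ hi), hσs.1, hBs.1] at hc
    exact absurd hc (by simp)
  · -- only the bounding state exchanges its entries
    simp only [Function.comp] at hi
    have h0 := hb _ _ _ hi hj
    have h1 := swap_cases (l := l) (r := r) i
    obtain ⟨rfl, rfl⟩ : i = l ∧ j = r := by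
      rcases h1 with ⟨h1, e1⟩ | ⟨h1, e1⟩ | ⟨n1, n1', e1⟩ <;> rw [e1] at h0 <;>
      simp only [Fin.le_def, Fin.ext_iff] at * <;> omega
    rw [Equiv.swap_apply_left] at hi
    subst hj
    have hxy : σ i ≠ σ j := fun h => hne (hσ.bij.1 h)
    have hc1 : c₁ = true := by
      rw [hc, if_neg (by rw [hi]; simpa using hxy.symm), hBs.1]
    have hstuck : σ i ≤ σ j ∨ ¬ MayMove β home acc (σ i) i := by
      by_contra hcon
      push Not at hcon
      exact hσs ⟨hc1, hcon⟩
    have hhp : home.symm (σ i) < home.symm (σ j) := by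
      rcases hstuck with h | h
      · exact symm_lt_symm_of_le hhome h hxy
      · have h1 := le_of_not_mayMove h
        have h2 := hσ.disp j
        have h3 : home.symm (σ i) ≠ home.symm (σ j) := fun h => hxy (home.symm.injective h)
        unfold displacement at h1 h2
        rw [ne_eq, Fin.ext_iff] at h3
        rw [Fin.lt_def]
        omega
    -- as `σ i` is earlier than `σ j` in the home state, it has entered the bounding state as well
    obtain ⟨k, hk⟩ := (hB.mem_iff (σ i)).2
      ((Fin.lt_def.1 hhp).trans ((hB.mem_iff (σ j)).1 ⟨j, hi⟩))
    have hki := hb _ _ _ hk rfl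
    have hkj : k ≠ j := by
      rintro rfl
      rw [hi] at hk
      exact hxy (Option.some.inj hk).symm
    by_cases hke : k = i
    · -- what stops the state stops the bounding state too
      subst hke
      rcases hstuck with h | h
      · exact hBs.2.1 _ hk _ hi h
      · exact h (hBs.2.2 _ hk)
    · -- the later element `σ j` has passed `σ i`, which is then within its largest displacement
      have hjk : j < k := by
        simp only [Fin.le_def, Fin.lt_def, ne_eq, Fin.ext_iff] at *
        omega
      rcases hstuck with h | h
      · exact hB.ord _ _ _ _ hjk hi hk h
      · have h1 := le_of_not_mayMove h
        have h2 := hB.late _ _ _ _ hk hi hjk hhp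
        rw [Fin.lt_def] at hjk
        unfold displacement at h1 h2
        omega
  · -- only the state exchanges its entries
    simp only [Function.comp] at hj
    have h0 := hb _ _ _ hi hj
    have h1 := swap_cases (l := l) (r := r) j
    obtain ⟨rfl, rfl⟩ : i = l ∧ j = r := by
      rcases h1 with ⟨h1, e1⟩ | ⟨h1, e1⟩ | ⟨n1, n1', e1⟩ <;> rw [e1] at h0 <;>
      simp only [Fin.le_def, Fin.ext_iff] at * <;> omega
    rw [Equiv.swap_apply_right] at hj
    subst hj
    have hr : B j ≠ some (σ i) := fun h => hne (hB.inj _ _ _ hi h)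
    rw [if_neg hr] at hc
    refine hBs ⟨hc ▸ hσs.1, ?_, ?_⟩
    · intro a ha b hb' hab
      obtain rfl : σ i = a := Option.some.inj (hi.symm.trans ha)
      obtain ⟨k, rfl⟩ := hσ.bij.2 b
      have hkj := hb _ _ _ hb' rfl
      have hki : ¬ k < i := fun h => hσ.lin _ _ h hab
      have hki' : k ≠ i := fun h => hr (h ▸ hb')
      obtain rfl : k = j := by
        simp only [Fin.le_def, Fin.lt_def, ne_eq, Fin.ext_iff] at *
        omega
      exact hσs.2.1 hab
    · intro a ha
      obtain rfl : σ i = a := Option.some.inj (hi.symm.trans ha)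
      exact hσs.2.2
  · exact hij (hb _ _ _ hi hj)

/-- All invariants of a state. -/
structure StateInv (β : ℝ) (home : Fin n ≃ α) (s : State n α) : Prop where
  adm : Admissible β home s.σ
  bound : BoundInv β home s.B
  bounds : Bounds s.σ s.B

theorem StateInv.step (hhome : IsLinearExtension home) {s : State n α} (h : StateInv β home s)
    (d : Draw n) : StateInv β home (boundingChainStep β home s d) where
  adm := by
    unfold boundingChainStep
    simp only
    split_ifs with h1 h2 h2
    all_goals first
      | exact h.adm.swap rfl h2.2.1 h2.2.2
      | exact h.adm
  bound := by
    unfold boundingChainStep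
    refine BoundInv.refill hhome ?_
    split_ifs with h1
    · exact h.bound.swap rfl h1.2.1 h1.2.2
    · exact h.bound
  bounds := (bounds_step hhome h.adm h.bound h.bounds rfl rfl).refill

theorem stateInv_runSteps (hhome : IsLinearExtension home) (hn : 1 ≤ n) {σ : Fin n → α}
    (hσ : Admissible β home σ) (l : List (Draw n)) : StateInv β home (runSteps β home σ l) := by
  unfold runSteps
  induction l using List.reverseRecOn with
  | nil => exact ⟨hσ, boundInv_initialBound hn, bounds_initialBound σ⟩
  | append_singleton l d ih =>
    rw [List.foldl_append]
    exact ih.step hhome d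

/-- A bounding state without `θ` determines the state. -/
theorem StateInv.eq_of_complete {s : State n α} (h : StateInv β home s) {b : Fin n → α}
    (hb : ∀ i, s.B i = some (b i)) : b = s.σ := by
  funext i
  induction i using WellFoundedLT.induction with
  | ind i ih =>
    obtain ⟨j, hj⟩ := h.adm.bij.2 (b i)
    rcases (h.bounds _ _ _ (hb i) hj).lt_or_eq with hlt | rfl
    · have h1 := h.bound.inj i j (b i) (hb i) (by rw [hb j, ih j hlt, hj])
      exact absurd hlt (h1 ▸ lt_irrefl _)
    · exact hj.symm

/-- The bounding chain does not depend on the state. -/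
theorem runSteps_B_eq (σ τ : Fin n → α) (l : List (Draw n)) :
    (runSteps β home σ l).B = (runSteps β home τ l).B := by
  unfold runSteps
  induction l using List.reverseRecOn with
  | nil => rfl
  | append_singleton l d ih =>
    rw [List.foldl_append, List.foldl_append]
    simp only [List.foldl_cons, List.foldl_nil, boundingChainStep, ih]

end Invariants

/-! ### The weighted distribution is stationary -/

section Averages

theorem sum_two_inv (x : ℝ≥0∞) : ∑ _c : Bool, 2⁻¹ * x = x := by
  rw [Fintype.sum_bool, ← add_mul, ENNReal.inv_two_add_inv_two, one_mul]

theorem avgDraw_eq_of_forall {n : ℕ} (hn : 2 ≤ n) {β : ℝ}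
    {H : Fin (n - 1) → Bool → Bool → ℝ≥0∞} {x : ℝ≥0∞}
    (h : ∀ i c, ∑ a, coinWeight (penalty β) a * H i c a = x) : avgDraw n β H = x := by
  unfold avgDraw
  simp_rw [h, sum_two_inv]
  rw [Finset.sum_const, Finset.card_univ, Fintype.card_fin, nsmul_eq_mul, ← mul_assoc,
    ENNReal.mul_inv_cancel, one_mul]
  · exact Nat.cast_ne_zero.2 (by omega)
  · exact ENNReal.natCast_ne_top _

theorem avgDraw_const {n : ℕ} (hn : 2 ≤ n) (β : ℝ) (x : ℝ≥0∞) :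
    avgDraw n β (fun _ _ _ => x) = x :=
  avgDraw_eq_of_forall hn fun _ _ => by
    rw [← Finset.sum_mul, sum_coinWeight (penalty_pos β).le (penalty_le_one β), one_mul]

theorem avgDraw_mono {n : ℕ} {β : ℝ} {H G : Fin (n - 1) → Bool → Bool → ℝ≥0∞}
    (h : ∀ i c a, H i c a ≤ G i c a) : avgDraw n β H ≤ avgDraw n β G := by
  unfold avgDraw
  gcongr
  exact h _ _ _

theorem sum_mul_avgDraw {n : ℕ} {β : ℝ} {ι : Type*} (s : Finset ι) (w : ι → ℝ≥0∞)
    (H : ι → Fin (n - 1) → Bool → Bool → ℝ≥0∞) :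
    ∑ e ∈ s, w e * avgDraw n β (H e) = avgDraw n β fun i c a => ∑ e ∈ s, w e * H e i c a := by
  unfold avgDraw
  simp only [Finset.mul_sum]
  rw [Finset.sum_comm]
  refine Finset.sum_congr rfl fun i _ => ?_
  rw [Finset.sum_comm]
  refine Finset.sum_congr rfl fun c _ => ?_
  rw [Finset.sum_comm]
  refine Finset.sum_congr rfl fun a _ => ?_
  refine Finset.sum_congr rfl fun e _ => ?_
  ring

end Averages

section Stationary

variable {n : ℕ} {α : Type*} {β : ℝ} {home : Fin n ≃ α}

/-- The factor that an element of displacement `d` contributes to the weight. -/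
def weightFactor (β : ℝ) (d : ℤ) : ℝ :=
  penalty β * (if d = ⌈β⌉ then 1 else 0) + (if d < ⌈β⌉ then 1 else 0)

theorem weightFactor_of_lt {d : ℤ} (h : d < ⌈β⌉) : weightFactor β d = 1 := by
  simp [weightFactor, h, h.ne]

theorem weightFactor_of_eq {d : ℤ} (h : d = ⌈β⌉) : weightFactor β d = penalty β := by
  simp [weightFactor, h]

theorem weightFactor_of_gt {d : ℤ} (h : ⌈β⌉ < d) : weightFactor β d = 0 := by
  simp [weightFactor, h.ne', h.le]

theorem weightFactor_nonneg (d : ℤ) : 0 ≤ weightFactor β d := by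
  have := (penalty_pos β).le
  unfold weightFactor
  split_ifs <;> simp [this]; linarith

theorem weight_eq_prod (σ : Fin n ≃ α) :
    weight β home σ = ∏ i, weightFactor β (displacement home (σ i) i) := rfl

theorem weight_nonneg (σ : Fin n ≃ α) : 0 ≤ weight β home σ :=
  Finset.prod_nonneg fun _ _ => weightFactor_nonneg _

/-- The probability that a coin lets an element move is its weight factor after the move. -/
theorem sum_coinWeight_mayMove (a : α) (i : Fin n) :
    ∑ acc, coinWeight (penalty β) acc * ind (MayMove β home acc a i) =
      ENNReal.ofReal (weightFactor β (displacement home a i + 1)) := by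
  have hs := sum_coinWeight (penalty_pos β).le (penalty_le_one β)
  rw [Fintype.sum_bool] at hs ⊢
  rcases lt_trichotomy (displacement home a i + 1) ⌈β⌉ with h | h | h
  · have h1 : ∀ acc, MayMove β home acc a i := fun acc => Or.inl (by omega)
    rw [weightFactor_of_lt h, ind_of (h1 _), ind_of (h1 _), mul_one, mul_one, hs]
    simp
  · have h1 : MayMove β home true a i := Or.inr ⟨by omega, rfl⟩
    have h2 : ¬ MayMove β home false a i := by
      rintro (h | ⟨-, h⟩)
      · omega
      · exact absurd h (by simp)
    rw [weightFactor_of_eq h, ind_of h1, ind_not_of h2]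
    simp [coinWeight]
  · have h1 : ∀ acc, ¬ MayMove β home acc a i := by
      rintro acc (h | ⟨h, -⟩) <;> omega
    rw [weightFactor_of_gt h, ind_not_of (h1 _), ind_not_of (h1 _)]
    simp

/-- The state with the entries at `l` and `r` exchanged. -/
def swapped (l r : Fin n) (σ : Fin n ≃ α) : Fin n ≃ α := (Equiv.swap l r).trans σ

theorem swapped_swapped (l r : Fin n) (σ : Fin n ≃ α) : swapped l r (swapped l r σ) = σ := by
  ext i; simp [swapped]

theorem coe_swapped (l r : Fin n) (σ : Fin n ≃ α) : ⇑(swapped l r σ) = σ ∘ Equiv.swap l r := rfl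

theorem swapped_left (l r : Fin n) (σ : Fin n ≃ α) : swapped l r σ l = σ r := by
  simp [swapped]

theorem swapped_right (l r : Fin n) (σ : Fin n ≃ α) : swapped l r σ r = σ l := by
  simp [swapped]

theorem weight_eq_mul_mul {l r : Fin n} (hlr : l ≠ r) (σ : Fin n ≃ α) :
    weight β home σ = weightFactor β (displacement home (σ l) l) *
      (weightFactor β (displacement home (σ r) r) *
        ∏ i ∈ (Finset.univ.erase l).erase r, weightFactor β (displacement home (σ i) i)) := by
  rw [weight_eq_prod, Finset.mul_prod_erase (Finset.univ.erase l)
      (fun i => weightFactor β (displacement home (σ i) i)) (by simp [hlr.symm]),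
    Finset.mul_prod_erase Finset.univ
      (fun i => weightFactor β (displacement home (σ i) i)) (Finset.mem_univ l)]

/-- Detailed balance of the weights. Both sides vanish unless both elements may move from `l` to
`r`; in that case their weight factors at `l` are `1`. -/
theorem weight_mul_weightFactor {l r : Fin n} (hlr : (l : ℕ) + 1 = r) (σ : Fin n ≃ α) :
    weight β home σ * weightFactor β (displacement home (σ l) l + 1) =
      weight β home (swapped l r σ) * weightFactor β (displacement home (σ r) l + 1) := by
  have hne : l ≠ r := by rintro rfl; omega
  have hr : ∀ a : α, displacement home a r = displacement home a l + 1 := by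
    intro a; unfold displacement; omega
  have hrest : ∏ i ∈ (Finset.univ.erase l).erase r,
      weightFactor β (displacement home (swapped l r σ i) i) =
      ∏ i ∈ (Finset.univ.erase l).erase r, weightFactor β (displacement home (σ i) i) := by
    refine Finset.prod_congr rfl fun i hi => ?_
    simp only [Finset.mem_erase, Finset.mem_univ, and_true] at hi
    simp [swapped, Equiv.swap_apply_of_ne_of_ne hi.2 hi.1]
  rw [weight_eq_mul_mul hne σ, weight_eq_mul_mul hne (swapped l r σ), hrest, swapped_left,
    swapped_right, hr, hr]
  by_cases h1 : displacement home (σ l) l + 1 ≤ ⌈β⌉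
  · by_cases h2 : displacement home (σ r) l + 1 ≤ ⌈β⌉
    · rw [weightFactor_of_lt (d := displacement home (σ l) l) (by omega),
        weightFactor_of_lt (d := displacement home (σ r) l) (by omega)]
      ring
    · rw [weightFactor_of_gt (d := displacement home (σ r) l + 1) (by omega)]
      ring
  · rw [weightFactor_of_gt (d := displacement home (σ l) l + 1) (by omega)]
    ring

variable [PartialOrder α]

theorem isLinearExtension_swapped_iff {l r : Fin n} (hlr : (l : ℕ) + 1 = r) (σ : Fin n ≃ α) :
    (IsLinearExtension (swapped l r σ) ∧ ¬ swapped l r σ l ≤ swapped l r σ r) ↔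
      (IsLinearExtension σ ∧ ¬ σ l ≤ σ r) := by
  have key : ∀ σ : Fin n ≃ α, IsLinearExtension σ ∧ ¬ σ l ≤ σ r →
      IsLinearExtension (swapped l r σ) ∧ ¬ swapped l r σ l ≤ swapped l r σ r := by
    rintro σ ⟨h1, h2⟩
    refine ⟨lin_swap h1 hlr h2, ?_⟩
    rw [swapped_left, swapped_right]
    exact h1 l r (by rw [Fin.lt_def]; omega)
  refine ⟨fun h => ?_, key σ⟩
  have := key _ h
  rwa [swapped_swapped] at this

/-- The draw allows the elements at `l` and `r` to be exchanged. -/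
def Allowed (β : ℝ) (home : Fin n ≃ α) (acc : Bool) (σ : Fin n → α) (l r : Fin n) : Prop :=
  ¬ σ l ≤ σ r ∧ MayMove β home acc (σ l) l

/-- The expected value of a function of the state after one step of the chain. -/
def chainOp (β : ℝ) (home : Fin n ≃ α) (F : (Fin n → α) → ℝ≥0∞) (σ : Fin n → α) : ℝ≥0∞ :=
  avgDraw n β fun i c a => F (if c = true ∧ Allowed β home a σ (leftPos i) (rightPos i)
    then σ ∘ Equiv.swap (leftPos i) (rightPos i) else σ)

/-- Whatever the bounding state is, the coin of the state is fair, so the state is a Markov chain on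
its own. -/
theorem stepOp_state (F : (Fin n → α) → ℝ≥0∞) :
    stepOp β home (fun s => F s.σ) = fun s => chainOp β home F s.σ := by
  funext s
  unfold stepOp chainOp avgDraw
  refine Finset.sum_congr rfl fun i _ => ?_
  congr 1
  simp only [boundingChainStep, Fintype.sum_bool, Allowed]
  by_cases h1 : ¬ s.σ (leftPos i) ≤ s.σ (rightPos i) ∧
      MayMove β home true (s.σ (leftPos i)) (leftPos i) <;>
  by_cases h2 : ¬ s.σ (leftPos i) ≤ s.σ (rightPos i) ∧
      MayMove β home false (s.σ (leftPos i)) (leftPos i) <;>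
  by_cases h : s.B (rightPos i) = some (s.σ (leftPos i)) <;>
  simp only [h1, h2, h, if_true, if_false, Bool.not_true, Bool.not_false, Bool.false_eq_true,
    false_and, and_self, and_false, true_and] <;>
  first | rfl | rw [add_comm]

theorem stepOp_iterate_state (F : (Fin n → α) → ℝ≥0∞) (k : ℕ) :
    (stepOp β home)^[k] (fun s => F s.σ) = fun s => (chainOp β home)^[k] F s.σ := by
  induction k generalizing F with
  | zero => rfl
  | succ k ih =>
    rw [Function.iterate_succ_apply, stepOp_state, ih, Function.iterate_succ_apply]

variable [Fintype α]

/-- The probability of a permutation under the weighted distribution on linear extensions. -/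
def target (β : ℝ) (home σ : Fin n ≃ α) : ℝ≥0∞ :=
  if IsLinearExtension σ then ENNReal.ofReal (weight β home σ / partitionFunction β home) else 0

theorem partitionFunction_nonneg : 0 ≤ partitionFunction β home :=
  Finset.sum_nonneg fun _ _ => weight_nonneg _

omit [PartialOrder α] [Fintype α] in
theorem weight_home_pos (hβ : 0 ≤ β) : 0 < weight β home home := by
  rw [weight_eq_prod]
  refine Finset.prod_pos fun i _ => ?_
  have h0 : displacement home (home i) i = 0 := by simp [displacement]
  have hc : 0 ≤ ⌈β⌉ := Int.ceil_nonneg hβ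
  rw [h0]
  rcases hc.lt_or_eq with h | h
  · rw [weightFactor_of_lt h]; exact one_pos
  · rw [weightFactor_of_eq h]; exact penalty_pos β

theorem partitionFunction_pos (hhome : IsLinearExtension home) (hβ : 0 ≤ β) :
    0 < partitionFunction β home :=
  lt_of_lt_of_le (weight_home_pos hβ) (Finset.single_le_sum (f := fun σ => weight β home σ)
    (fun _ _ => weight_nonneg _) (by simp [hhome]))

theorem sum_target (hhome : IsLinearExtension home) (hβ : 0 ≤ β) :
    ∑ σ, target β home σ = 1 := by
  unfold target
  rw [← Finset.sum_filter, ← ENNReal.ofReal_sum_of_nonneg, ← Finset.sum_div]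
  · have : ∑ σ : Fin n ≃ α with IsLinearExtension σ, weight β home σ =
        partitionFunction β home := rfl
    rw [this, div_self (partitionFunction_pos hhome hβ).ne', ENNReal.ofReal_one]
  · exact fun σ _ => div_nonneg (weight_nonneg _) partitionFunction_nonneg

theorem admissible_of_target_ne_zero {σ : Fin n ≃ α} (h : target β home σ ≠ 0) :
    Admissible β home σ := by
  unfold target at h
  split_ifs at h with hl
  · refine ⟨σ.bijective, hl, fun i => ?_⟩
    by_contra hc
    refine h ?_
    have : weight β home σ = 0 := by
      rw [weight_eq_prod]
      exact Finset.prod_eq_zero (Finset.mem_univ i) (weightFactor_of_gt (by omega))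
    simp [this]
  · exact absurd rfl h

omit [Fintype α] in
theorem sum_coinWeight_allowed (σ : Fin n → α) (l r : Fin n) :
    ∑ acc, coinWeight (penalty β) acc * ind (Allowed β home acc σ l r) =
      ind (¬ σ l ≤ σ r) *
        ENNReal.ofReal (weightFactor β (displacement home (σ l) l + 1)) := by
  rw [← sum_coinWeight_mayMove, Finset.mul_sum]
  refine Finset.sum_congr rfl fun acc _ => ?_
  by_cases h : σ l ≤ σ r <;> simp [Allowed, h]

theorem target_balance {l r : Fin n} (hlr : (l : ℕ) + 1 = r) (σ : Fin n ≃ α) :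
    target β home σ * ∑ acc, coinWeight (penalty β) acc * ind (Allowed β home acc σ l r) =
      target β home (swapped l r σ) *
        ∑ acc, coinWeight (penalty β) acc * ind (Allowed β home acc (swapped l r σ) l r) := by
  have hiff := isLinearExtension_swapped_iff hlr σ
  rw [sum_coinWeight_allowed, sum_coinWeight_allowed]
  have key : ∀ τ : Fin n ≃ α, ¬ (IsLinearExtension τ ∧ ¬ τ l ≤ τ r) →
      ∀ x : ℝ≥0∞, target β home τ * (ind (¬ τ l ≤ τ r) * x) = 0 := by
    intro τ h x
    by_cases h1 : IsLinearExtension τ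
    · rw [ind_not_of fun h2 => h ⟨h1, h2⟩]; simp
    · simp [target, h1]
  by_cases h : IsLinearExtension σ ∧ ¬ σ l ≤ σ r
  · have h' := hiff.2 h
    rw [ind_of h.2, ind_of h'.2, one_mul, one_mul, target, target, if_pos h.1, if_pos h'.1,
      ← ENNReal.ofReal_mul (div_nonneg (weight_nonneg _) partitionFunction_nonneg),
      ← ENNReal.ofReal_mul (div_nonneg (weight_nonneg _) partitionFunction_nonneg),
      swapped_left, div_mul_eq_mul_div, div_mul_eq_mul_div, weight_mul_weightFactor hlr]
  · rw [key _ h, key _ fun h' => h (hiff.1 h')]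

theorem sum_target_mul_move {l r : Fin n} (hlr : (l : ℕ) + 1 = r) (F : (Fin n → α) → ℝ≥0∞) :
    ∑ acc, coinWeight (penalty β) acc * ∑ σ, target β home σ *
      F (if Allowed β home acc σ l r then σ ∘ Equiv.swap l r else σ) =
    ∑ σ, target β home σ * F σ := by
  have hs := sum_coinWeight (penalty_pos β).le (penalty_le_one β)
  have hF : ∀ acc (σ : Fin n ≃ α), F (if Allowed β home acc σ l r then σ ∘ Equiv.swap l r else σ) =
      ind (Allowed β home acc σ l r) * F (swapped l r σ) +
        ind (¬ Allowed β home acc σ l r) * F σ := by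
    intro acc σ
    by_cases h : Allowed β home acc σ l r <;> simp [h, coe_swapped]
  have hind : ∀ acc (σ : Fin n ≃ α),
      ind (Allowed β home acc σ l r) + ind (¬ Allowed β home acc σ l r) = 1 := by
    intro acc σ
    by_cases h : Allowed β home acc σ l r <;> simp [h]
  have hreindex : ∑ σ, target β home σ *
      (∑ acc, coinWeight (penalty β) acc * ind (Allowed β home acc σ l r)) * F (swapped l r σ) =
      ∑ σ, target β home σ *
      (∑ acc, coinWeight (penalty β) acc * ind (Allowed β home acc σ l r)) * F σ := by
    rw [Finset.sum_congr rfl fun σ _ => by rw [target_balance hlr σ]]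
    exact Equiv.sum_comp (Function.Involutive.toPerm (swapped l r)
      (swapped_swapped (α := α) l r)) fun σ => target β home σ *
        (∑ acc, coinWeight (penalty β) acc * ind (Allowed β home acc σ l r)) * F σ
  calc _ = ∑ σ, target β home σ *
      (∑ acc, coinWeight (penalty β) acc * ind (Allowed β home acc σ l r)) * F (swapped l r σ) +
      ∑ σ, target β home σ *
      (∑ acc, coinWeight (penalty β) acc * ind (¬ Allowed β home acc σ l r)) * F σ := by
        simp_rw [hF, Finset.mul_sum, Finset.sum_mul]
        rw [Finset.sum_comm, ← Finset.sum_add_distrib]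
        refine Finset.sum_congr rfl fun σ _ => ?_
        rw [← Finset.sum_add_distrib]
        refine Finset.sum_congr rfl fun acc _ => ?_
        ring
    _ = _ := by
        rw [hreindex, ← Finset.sum_add_distrib]
        refine Finset.sum_congr rfl fun σ _ => ?_
        rw [← add_mul, ← mul_add, ← Finset.sum_add_distrib]
        simp_rw [← mul_add, hind, mul_one, hs, mul_one]

theorem sum_target_mul_chainOp (hn : 2 ≤ n) (F : (Fin n → α) → ℝ≥0∞) :
    ∑ σ, target β home σ * chainOp β home F σ = ∑ σ, target β home σ * F σ := by
  unfold chainOp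
  rw [sum_mul_avgDraw]
  refine avgDraw_eq_of_forall hn fun i c => ?_
  cases c
  · simp only [Bool.false_eq_true, false_and, if_false]
    rw [← Finset.sum_mul, sum_coinWeight (penalty_pos β).le (penalty_le_one β), one_mul]
  · simp only [true_and]
    exact sum_target_mul_move rfl F

theorem sum_target_mul_iterate (hn : 2 ≤ n) (F : (Fin n → α) → ℝ≥0∞) (k : ℕ) :
    ∑ σ, target β home σ * (chainOp β home)^[k] F σ = ∑ σ, target β home σ * F σ := by
  induction k generalizing F with
  | zero => rfl
  | succ k ih =>
    rw [Function.iterate_succ_apply, ih, sum_target_mul_chainOp hn]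

end Stationary

/-! ### The walk of the symbols `θ` -/

section Walk

variable {n : ℕ}

/-- The moves of one step on the positions: nothing, or an exchange of two adjacent positions. -/
def walkPerm (d : Fin (n - 1) × Bool) : Equiv.Perm (Fin n) :=
  if d.2 then Equiv.swap (leftPos d.1) (rightPos d.1) else 1

theorem walkPerm_walkPerm (d : Fin (n - 1) × Bool) (x : Fin n) :
    walkPerm d (walkPerm d x) = x := by
  unfold walkPerm
  split_ifs <;> simp

/-- The average of `h` over the position after one step from `x`. -/
def walkAvg (h : Fin n → ℝ) (x : Fin n) : ℝ :=
  (2 * ((n - 1 : ℕ) : ℝ))⁻¹ * ∑ d : Fin (n - 1) × Bool, h (walkPerm d x)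

/-- The transition operator of the walk that is killed at the last position. -/
def walkOp (h : Fin n → ℝ) (x : Fin n) : ℝ :=
  if (x : ℕ) + 1 = n then 0 else walkAvg h x

theorem sum_walkPerm (h : Fin n → ℝ) (x : Fin n) :
    ∑ d : Fin (n - 1) × Bool, h (walkPerm d x) =
      ∑ i : Fin (n - 1), (h (Equiv.swap (leftPos i) (rightPos i) x) + h x) := by
  rw [Fintype.sum_prod_type]
  simp [walkPerm]

/-- Nonnegative functions of the position that decrease and vanish at the last position. -/
structure IsProfile (h : Fin n → ℝ) : Prop where
  nonneg : ∀ x, 0 ≤ h x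
  anti : ∀ x y, x ≤ y → h y ≤ h x
  last : ∀ x : Fin n, (x : ℕ) + 1 = n → h x = 0

theorem walkAvg_nonneg {h : Fin n → ℝ} (hh : ∀ x, 0 ≤ h x) (x : Fin n) : 0 ≤ walkAvg h x :=
  mul_nonneg (by positivity) (Finset.sum_nonneg fun _ _ => hh _)

theorem IsProfile.walkOp {h : Fin n → ℝ} (hh : IsProfile h) : IsProfile (walkOp h) where
  nonneg x := by
    unfold LinExt.walkOp
    split_ifs
    · exact le_rfl
    · exact walkAvg_nonneg hh.nonneg x
  anti x y hxy := by
    unfold LinExt.walkOp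
    by_cases hy : (y : ℕ) + 1 = n
    · rw [if_pos hy]
      split_ifs
      · exact le_rfl
      · exact walkAvg_nonneg hh.nonneg x
    · have hx : ¬ (x : ℕ) + 1 = n := by
        rw [Fin.le_def] at hxy
        omega
      rw [if_neg hx, if_neg hy]
      unfold walkAvg
      refine mul_le_mul_of_nonneg_left ?_ (by positivity)
      rw [sum_walkPerm, sum_walkPerm]
      refine Finset.sum_le_sum fun i _ => ?_
      have hlr : ((leftPos i : Fin n) : ℕ) + 1 = (rightPos i : Fin n) := rfl
      generalize leftPos i = l at *
      generalize rightPos i = r at *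
      have h1 := swap_cases (l := l) (r := r) x
      have h2 := swap_cases (l := l) (r := r) y
      -- the exchange reverses the order only of the pair that it exchanges
      by_cases hs : x = l ∧ y = r
      · rw [hs.1, hs.2, Equiv.swap_apply_left, Equiv.swap_apply_right, add_comm]
      · refine add_le_add (hh.anti _ _ ?_) (hh.anti _ _ hxy)
        rcases h1 with ⟨h1, e1⟩ | ⟨h1, e1⟩ | ⟨n1, n1', e1⟩ <;>
        rcases h2 with ⟨h2, e2⟩ | ⟨h2, e2⟩ | ⟨n2, n2', e2⟩ <;> rw [e1, e2] <;>
        simp only [Fin.le_def, ne_eq, Fin.ext_iff] at * <;> omega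
  last x hx := if_pos hx

/-- The walk is symmetric. -/
theorem sum_mul_walkAvg (f g : Fin n → ℝ) :
    ∑ x, f x * walkAvg g x = ∑ x, walkAvg f x * g x := by
  have : ∀ d : Fin (n - 1) × Bool,
      ∑ x, f x * g (walkPerm d x) = ∑ x, f (walkPerm d x) * g x := by
    intro d
    rw [← Equiv.sum_comp (walkPerm d) fun x => f x * g (walkPerm d x)]
    simp_rw [walkPerm_walkPerm]
  unfold walkAvg
  simp_rw [mul_left_comm (f _), mul_assoc, ← Finset.mul_sum, Finset.mul_sum _ _ (f _),
    Finset.sum_mul]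
  rw [Finset.sum_comm, Finset.sum_congr rfl fun d _ => this d, Finset.sum_comm]

/-- The test of Schur: a positive function that the operator multiplies by at most `c` bounds its
norm on square summable functions by `c`. -/
theorem sum_walkOp_sq_le {φ h : Fin n → ℝ} {c : ℝ} (hc : 0 ≤ c) (hφ : ∀ x, 0 ≤ φ x)
    (hφ' : ∀ x : Fin n, (x : ℕ) + 1 ≠ n → 0 < φ x)
    (hφlast : ∀ x : Fin n, (x : ℕ) + 1 = n → φ x = 0)
    (hK : ∀ x : Fin n, (x : ℕ) + 1 ≠ n → walkAvg φ x ≤ c * φ x) (hh : IsProfile h) :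
    ∑ x, walkOp h x ^ 2 ≤ c ^ 2 * ∑ x, h x ^ 2 := by
  set g : Fin n → ℝ := fun x => h x ^ 2 / φ x with hg
  have hg0 : ∀ x, 0 ≤ g x := fun x => div_nonneg (sq_nonneg _) (hφ x)
  have hφg : ∀ x, h x ^ 2 = φ x * g x := by
    intro x
    by_cases hx : (x : ℕ) + 1 = n
    · simp [hh.last x hx, hφlast x hx]
    · rw [hg]
      field_simp [(hφ' x hx).ne']
  have hcs : ∀ x, walkAvg h x ^ 2 ≤ walkAvg φ x * walkAvg g x := by
    intro x
    have := Finset.sum_sq_le_sum_mul_sum_of_sq_le_mul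
      (Finset.univ : Finset (Fin (n - 1) × Bool)) (r := fun d => h (walkPerm d x))
      (f := fun d => φ (walkPerm d x)) (g := fun d => g (walkPerm d x))
      (fun d _ => hφ _) (fun d _ => hg0 _) fun d _ => (hφg _).le
    unfold walkAvg
    rw [mul_pow, mul_mul_mul_comm, ← sq]
    exact mul_le_mul_of_nonneg_left this (sq_nonneg _)
  calc ∑ x, walkOp h x ^ 2 ≤ ∑ x, c * (φ x * walkAvg g x) := by
        refine Finset.sum_le_sum fun x _ => ?_
        unfold walkOp
        by_cases hx : (x : ℕ) + 1 = n
        · simp [hx, hφlast x hx]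
        · rw [if_neg hx, ← mul_assoc]
          exact (hcs x).trans (mul_le_mul_of_nonneg_right (hK x hx) (walkAvg_nonneg hg0 x))
    _ = c * ∑ x, walkAvg φ x * g x := by rw [← Finset.mul_sum, sum_mul_walkAvg]
    _ ≤ c * ∑ x, c * h x ^ 2 := by
        refine mul_le_mul_of_nonneg_left (Finset.sum_le_sum fun x _ => ?_) hc
        by_cases hx : (x : ℕ) + 1 = n
        · simp [hg, hh.last x hx]
        · rw [hφg, ← mul_assoc]
          exact mul_le_mul_of_nonneg_right (hK x hx) (hg0 x)
    _ = c ^ 2 * ∑ x, h x ^ 2 := by rw [← Finset.mul_sum]; ring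

/-- The frequency of the lowest mode of the walk that is reflected at the first position and killed
at the last one. -/
def walkAngle (n : ℕ) : ℝ := Real.pi / (2 * n - 1)

/-- The spectral gap of the killed walk. -/
def walkGap (n : ℕ) : ℝ := (1 - Real.cos (walkAngle n)) / ((n - 1 : ℕ) : ℝ)

/-- The lowest mode of the killed walk. -/
def walkMode (x : Fin n) : ℝ := Real.cos (((x : ℕ) + 1 / 2) * walkAngle n)

theorem walkAngle_pos (hn : 2 ≤ n) : 0 < walkAngle n := by
  have : (2 : ℝ) ≤ n := by exact_mod_cast hn
  exact div_pos Real.pi_pos (by linarith)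

theorem walkAngle_mul (hn : 2 ≤ n) : ((n : ℝ) - 1 / 2) * walkAngle n = Real.pi / 2 := by
  have : (2 : ℝ) ≤ n := by exact_mod_cast hn
  unfold walkAngle
  have h2 : (2 * (n : ℝ) - 1) ≠ 0 := by linarith
  rw [show (n : ℝ) - 1 / 2 = (2 * n - 1) / 2 by ring]
  field_simp

theorem walkMode_last (hn : 2 ≤ n) (x : Fin n) (hx : (x : ℕ) + 1 = n) : walkMode x = 0 := by
  have h1 : ((x : ℕ) : ℝ) = n - 1 := by
    have : (((x : ℕ) + 1 : ℕ) : ℝ) = n := by exact_mod_cast hx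
    push_cast at this
    linarith
  unfold walkMode
  rw [h1, show (n : ℝ) - 1 + 1 / 2 = n - 1 / 2 by ring, walkAngle_mul hn, Real.cos_pi_div_two]

theorem walkMode_pos (hn : 2 ≤ n) (x : Fin n) (hx : (x : ℕ) + 1 ≠ n) : 0 < walkMode x := by
  have h1 : ((x : ℕ) : ℝ) + 1 ≤ n - 1 := by
    have : (x : ℕ) + 1 + 1 ≤ n := by omega
    have : (((x : ℕ) + 1 + 1 : ℕ) : ℝ) ≤ n := by exact_mod_cast this
    push_cast at this
    linarith
  have h0 := walkAngle_pos hn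
  have h2 := walkAngle_mul hn
  have h3 : (0 : ℝ) ≤ ((x : ℕ) : ℝ) := Nat.cast_nonneg _
  refine Real.cos_pos_of_mem_Ioo ⟨?_, ?_⟩
  · have : 0 ≤ (((x : ℕ) : ℝ) + 1 / 2) * walkAngle n := by positivity
    linarith [Real.pi_pos]
  · rw [← h2]
    exact mul_lt_mul_of_pos_right (by linarith) h0

theorem sum_walkPerm_walkMode (x : Fin n) (hx : (x : ℕ) + 1 ≠ n) :
    ∑ i : Fin (n - 1), (walkMode (Equiv.swap (leftPos i) (rightPos i) x) - walkMode x) =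
      -2 * (1 - Real.cos (walkAngle n)) * walkMode x := by
  set c : ℝ → ℝ := fun y => Real.cos ((y + 1 / 2) * walkAngle n) with hcdef
  have hmode : ∀ y : Fin n, walkMode y = c (y : ℕ) := fun y => rfl
  have hterm : ∀ i : Fin (n - 1),
      walkMode (Equiv.swap (leftPos i) (rightPos i) x) - walkMode x =
      (fun k : ℕ => (if k = x then c ((x : ℕ) + 1) - c (x : ℕ) else 0) +
        (if k + 1 = x then c ((x : ℕ) - 1) - c (x : ℕ) else 0)) i := by
    intro i
    have hl : ((leftPos i : Fin n) : ℕ) = i := rfl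
    have hr : ((rightPos i : Fin n) : ℕ) = i + 1 := rfl
    rcases swap_cases (l := leftPos i) (r := rightPos i) x with ⟨h1, e1⟩ | ⟨h1, e1⟩ | ⟨h1, h2, e1⟩
    · have h3 : (i : ℕ) = x := by rw [h1, hl]
      have h4 : ¬ (i : ℕ) + 1 = x := by omega
      simp only [e1, hmode, hr, h3]
      simp
    · have h3 : (i : ℕ) + 1 = x := by rw [h1, hr]
      have h4 : ¬ (i : ℕ) = x := by omega
      have h5 : ((i : ℕ) : ℝ) = ((x : ℕ) : ℝ) - 1 := by rw [← h3]; push_cast; ring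
      simp only [e1, hmode, hl, h3, h4, if_true, if_false, h5, zero_add]
    · have h3 : ¬ (i : ℕ) = x := fun h => h1 (Fin.ext (by rw [hl, h]))
      have h4 : ¬ (i : ℕ) + 1 = x := fun h => h2 (Fin.ext (by rw [hr, h]))
      simp [e1, h3, h4]
  rw [Finset.sum_congr rfl fun i _ => hterm i, Fin.sum_univ_eq_sum_range (fun k : ℕ =>
    (if k = x then c ((x : ℕ) + 1) - c (x : ℕ) else 0) +
        (if k + 1 = x then c ((x : ℕ) - 1) - c (x : ℕ) else 0)) (n - 1), Finset.sum_add_distrib]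
  have hs1 : ∑ k ∈ Finset.range (n - 1), (if k = (x : ℕ) then c ((x : ℕ) + 1) - c (x : ℕ) else 0) =
      c ((x : ℕ) + 1) - c (x : ℕ) := by
    rw [Finset.sum_ite_eq', if_pos (Finset.mem_range.2 (by omega))]
  have hs2 : ∑ k ∈ Finset.range (n - 1),
      (if k + 1 = (x : ℕ) then c ((x : ℕ) - 1) - c (x : ℕ) else 0) =
      c ((x : ℕ) - 1) - c (x : ℕ) := by
    rcases Nat.eq_zero_or_pos (x : ℕ) with h0 | h0
    · -- at the first position the mode is reflected
      have : c ((0 : ℕ) - 1) = c (0 : ℕ) := by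
        simp only [hcdef]
        rw [← Real.cos_neg]
        congr 1
        push_cast
        ring
      rw [h0, this]
      simp
    · have : ∀ k, k + 1 = (x : ℕ) ↔ k = (x : ℕ) - 1 := fun k => by omega
      simp_rw [this]
      rw [Finset.sum_ite_eq', if_pos (Finset.mem_range.2 (by omega))]
  rw [hs1, hs2, hmode]
  have key : c ((x : ℕ) + 1) + c ((x : ℕ) - 1) = 2 * Real.cos (walkAngle n) * c (x : ℕ) := by
    simp only [hcdef]
    rw [show (((x : ℕ) : ℝ) + 1 + 1 / 2) * walkAngle n =
      (((x : ℕ) : ℝ) + 1 / 2) * walkAngle n + walkAngle n by ring,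
      show (((x : ℕ) : ℝ) - 1 + 1 / 2) * walkAngle n =
      (((x : ℕ) : ℝ) + 1 / 2) * walkAngle n - walkAngle n by ring, Real.cos_add, Real.cos_sub]
    ring
  linear_combination key

theorem walkAvg_walkMode (hn : 2 ≤ n) (x : Fin n) (hx : (x : ℕ) + 1 ≠ n) :
    walkAvg walkMode x = (1 - walkGap n) * walkMode x := by
  have h := sum_walkPerm_walkMode x hx
  have hm : ((n - 1 : ℕ) : ℝ) ≠ 0 := Nat.cast_ne_zero.2 (by omega)
  have h2 : ∑ i : Fin (n - 1), (walkMode (Equiv.swap (leftPos i) (rightPos i) x) + walkMode x) =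
      -2 * (1 - Real.cos (walkAngle n)) * walkMode x + 2 * ((n - 1 : ℕ) : ℝ) * walkMode x := by
    rw [← h, Finset.sum_add_distrib, Finset.sum_sub_distrib]
    simp
    ring
  unfold walkAvg walkGap
  rw [sum_walkPerm, h2]
  field_simp
  ring

theorem walkGap_pos (hn : 2 ≤ n) : 0 < walkGap n := by
  have h0 := walkAngle_pos hn
  have hn' : (2 : ℝ) ≤ n := by exact_mod_cast hn
  refine div_pos ?_ (Nat.cast_pos.2 (by omega))
  have h1 : walkAngle n ≤ Real.pi := by
    unfold walkAngle
    exact div_le_self Real.pi_pos.le (by linarith)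
  have := Real.cos_lt_cos_of_nonneg_of_le_pi le_rfl h1 h0
  rw [Real.cos_zero] at this
  linarith

theorem walkGap_le_one (hn : 2 ≤ n) : walkGap n ≤ 1 := by
  have h0 := walkAngle_pos hn
  have hn' : (2 : ℝ) ≤ n := by exact_mod_cast hn
  have h1 : walkAngle n ≤ Real.pi / 2 := by
    rw [← walkAngle_mul hn]
    nlinarith
  have h2 : 0 ≤ Real.cos (walkAngle n) :=
    Real.cos_nonneg_of_mem_Icc ⟨by linarith [Real.pi_pos], h1⟩
  have h3 : (1 : ℝ) ≤ ((n - 1 : ℕ) : ℝ) := by exact_mod_cast (by omega : 1 ≤ n - 1)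
  unfold walkGap
  rw [div_le_one (by linarith)]
  linarith

/-- The profile that counts the symbols `θ`. -/
def countProfile (x : Fin n) : ℝ := if (x : ℕ) + 1 = n then 0 else 1

theorem isProfile_countProfile : IsProfile (countProfile (n := n)) where
  nonneg x := by unfold countProfile; split_ifs <;> norm_num
  anti x y hxy := by
    unfold countProfile
    split_ifs with h1 h2
    · exact le_rfl
    · norm_num
    · rw [Fin.le_def] at hxy; omega
    · exact le_rfl
  last x hx := if_pos hx

theorem isProfile_iterate (k : ℕ) : IsProfile ((walkOp (n := n))^[k] countProfile) := by
  induction k with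
  | zero => exact isProfile_countProfile
  | succ k ih =>
    rw [Function.iterate_succ_apply']
    exact ih.walkOp

theorem sum_countProfile (hn : 2 ≤ n) : ∑ x : Fin n, countProfile x ^ 2 = ((n - 1 : ℕ) : ℝ) := by
  have : ∀ x : Fin n, countProfile x ^ 2 =
      (fun k : ℕ => if k + 1 = n then (0 : ℝ) else 1) x := by
    intro x
    unfold countProfile
    by_cases h : (x : ℕ) + 1 = n <;> simp [h]
  obtain ⟨m, rfl⟩ : ∃ m, n = m + 1 := ⟨n - 1, by omega⟩
  rw [Finset.sum_congr rfl fun x _ => this x, Fin.sum_univ_eq_sum_range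
    (fun k : ℕ => if k + 1 = m + 1 then (0 : ℝ) else 1) (m + 1), Finset.sum_range_succ]
  rw [Finset.sum_congr rfl (g := fun _ => (1 : ℝ)) fun k hk => if_neg (by
    have := Finset.mem_range.1 hk
    omega)]
  simp

theorem sum_iterate_sq_le (hn : 2 ≤ n) (k : ℕ) :
    ∑ x, ((walkOp (n := n))^[k] countProfile x) ^ 2 ≤
      ((1 - walkGap n) ^ k) ^ 2 * ((n - 1 : ℕ) : ℝ) := by
  induction k with
  | zero => simp [sum_countProfile hn]
  | succ k ih =>
    rw [Function.iterate_succ_apply']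
    have hc : 0 ≤ 1 - walkGap n := by linarith [walkGap_le_one hn]
    refine (sum_walkOp_sq_le (φ := walkMode) hc ?_ (walkMode_pos hn) (walkMode_last hn)
      (fun x hx => (walkAvg_walkMode hn x hx).le) (isProfile_iterate k)).trans ?_
    · intro x
      by_cases hx : (x : ℕ) + 1 = n
      · rw [walkMode_last hn x hx]
      · exact (walkMode_pos hn x hx).le
    · rw [pow_succ' _ k, mul_pow, mul_assoc]
      exact mul_le_mul_of_nonneg_left ih (sq_nonneg _)

/-- The expected number of walks, one from each position but the last, that survive `k` steps. -/
theorem sum_iterate_le (hn : 2 ≤ n) (k : ℕ) :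
    ∑ x, (walkOp (n := n))^[k] countProfile x ≤ ((n - 1 : ℕ) : ℝ) * (1 - walkGap n) ^ k := by
  have hc : 0 ≤ 1 - walkGap n := by linarith [walkGap_le_one hn]
  have h1 := Finset.sum_mul_sq_le_sq_mul_sq Finset.univ countProfile
    ((walkOp (n := n))^[k] countProfile)
  rw [sum_countProfile hn] at h1
  have h2 : ∑ x, countProfile x * (walkOp (n := n))^[k] countProfile x =
      ∑ x, (walkOp (n := n))^[k] countProfile x := by
    refine Finset.sum_congr rfl fun x _ => ?_
    by_cases hx : (x : ℕ) + 1 = n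
    · rw [(isProfile_iterate k).last x hx, mul_zero]
    · rw [countProfile, if_neg hx, one_mul]
  rw [h2] at h1
  refine le_of_sq_le_sq (h1.trans ?_) (by positivity)
  have := mul_le_mul_of_nonneg_left (sum_iterate_sq_le hn k) (Nat.cast_nonneg (α := ℝ) (n - 1))
  linarith

end Walk

/-! ### The symbols `θ` disappear, and the comparisons are counted -/

section Decay

theorem ind_le_one (q : Prop) : ind q ≤ 1 := by
  by_cases h : q <;> simp [h]

theorem avgDraw_coin {n : ℕ} (β : ℝ) {X : Fin (n - 1) → Bool → ℝ≥0∞} :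
    avgDraw n β (fun i c _ => X i c) =
      ∑ i, ((n - 1 : ℕ) : ℝ≥0∞)⁻¹ * (2⁻¹ * (X i true + X i false)) := by
  unfold avgDraw
  refine Finset.sum_congr rfl fun i _ => ?_
  simp_rw [← Finset.sum_mul, sum_coinWeight (penalty_pos β).le (penalty_le_one β), one_mul]
  simp only [Fintype.sum_bool, mul_add]

theorem avgDraw_eq_of_coin {n : ℕ} (hn : 2 ≤ n) {β : ℝ} {X : Fin (n - 1) → Bool → ℝ≥0∞}
    {x : ℝ≥0∞} (h : ∀ i, X i true + X i false = 2 * x) : avgDraw n β (fun i c _ => X i c) = x := by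
  rw [avgDraw_coin, ← avgDraw_const hn β x, avgDraw_coin β (X := fun _ _ => x)]
  simp_rw [h, two_mul]

variable {n : ℕ} {α : Type*} [PartialOrder α] {β : ℝ} {home : Fin n ≃ α}

theorem stepOp_iterate_mono {P : State n α → Prop}
    (hP : ∀ s d, P s → P (boundingChainStep β home s d)) {Γ Δ : State n α → ℝ≥0∞}
    (h : ∀ s, P s → Γ s ≤ Δ s) (k : ℕ) : ∀ s, P s →
      (stepOp β home)^[k] Γ s ≤ (stepOp β home)^[k] Δ s := by
  induction k generalizing Γ Δ with
  | zero => exact h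
  | succ k ih =>
    simp_rw [Function.iterate_succ_apply]
    refine ih fun s hs => ?_
    exact avgDraw_mono fun i c a => h _ (hP s _ hs)

/-- The total value of the profile `h` at the positions of the symbols `θ`. -/
def thetaSum (h : Fin n → ℝ) (B : Fin n → Option α) : ℝ :=
  ∑ x, if B x = none then h x else 0

omit [PartialOrder α] in
theorem thetaSum_swap (h : Fin n → ℝ) (B : Fin n → Option α) (l r : Fin n) :
    thetaSum h (B ∘ Equiv.swap l r) = ∑ x, if B x = none then h (Equiv.swap l r x) else 0 := by
  unfold thetaSum
  rw [← Equiv.sum_comp (Equiv.swap l r)]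
  simp

omit [PartialOrder α] in
theorem thetaSum_refill {h : Fin n → ℝ} (hh : IsProfile h) (B : Fin n → Option α) :
    thetaSum h (refill home B) = thetaSum h B := by
  refine Finset.sum_congr rfl fun x _ => ?_
  by_cases hx : (x : ℕ) + 1 = n
  · simp [hh.last x hx]
  · rw [refill_apply_of_ne fun hc => hx hc.1]

omit [PartialOrder α] in
theorem thetaSum_nonneg {h : Fin n → ℝ} (hh : IsProfile h) (B : Fin n → Option α) :
    0 ≤ thetaSum h B :=
  Finset.sum_nonneg fun x _ => by split_ifs; exacts [hh.nonneg x, le_rfl]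

omit [PartialOrder α] in
/-- Refusing an exchange whose left entry is an element cannot bring a symbol `θ` to the left. -/
theorem thetaSum_le_swap {h : Fin n → ℝ} (hh : IsProfile h) {B : Fin n → Option α} {l r : Fin n}
    (hlr : (l : ℕ) + 1 = r) (hl : B l ≠ none) :
    thetaSum h B ≤ thetaSum h (B ∘ Equiv.swap l r) := by
  rw [thetaSum_swap]
  refine Finset.sum_le_sum fun x _ => ?_
  split_ifs with hx
  · rcases swap_cases (l := l) (r := r) x with ⟨h1, -⟩ | ⟨h1, e1⟩ | ⟨-, -, e1⟩
    · exact absurd (h1 ▸ hx) hl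
    · rw [e1, h1]
      exact hh.anti _ _ (by rw [Fin.le_def]; omega)
    · rw [e1]
  · exact le_rfl

theorem thetaSum_step_le {h : Fin n → ℝ} (hh : IsProfile h) (s : State n α) (d : Draw n) :
    thetaSum h (boundingChainStep β home s d).B ≤
      if d.coin = true then thetaSum h (s.B ∘ Equiv.swap (leftPos d.i) (rightPos d.i))
      else thetaSum h s.B := by
  unfold boundingChainStep
  simp only
  rw [thetaSum_refill hh]
  by_cases hc : d.coin = true
  · rw [if_pos hc]
    split_ifs with hs
    · exact le_rfl
    · refine thetaSum_le_swap hh rfl fun hl => hs ⟨hc, ?_, ?_⟩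
      · intro a ha; rw [hl] at ha; exact absurd ha (by simp)
      · intro a ha; rw [hl] at ha; exact absurd ha (by simp)
  · rw [if_neg hc, if_neg fun hs => hc hs.1]

omit [PartialOrder α] in
theorem thetaSum_walkOp {h : Fin n → ℝ} {B : Fin n → Option α}
    (hB : ∀ i : Fin n, (i : ℕ) + 1 = n → B i ≠ none) :
    thetaSum (walkOp h) B = ∑ i : Fin (n - 1), (((n - 1 : ℕ) : ℝ)⁻¹ * (2⁻¹ *
      (thetaSum h (B ∘ Equiv.swap (leftPos i) (rightPos i)) + thetaSum h B))) := by
  have h1 : ∀ x, (if B x = none then walkOp h x else 0) = ∑ i : Fin (n - 1),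
      ((n - 1 : ℕ) : ℝ)⁻¹ * (2⁻¹ *
        ((if B x = none then h (Equiv.swap (leftPos i) (rightPos i) x) else 0) +
          if B x = none then h x else 0)) := by
    intro x
    split_ifs with hx
    · rw [walkOp, if_neg fun hc => hB x hc hx, walkAvg, sum_walkPerm, mul_inv, Finset.mul_sum]
      refine Finset.sum_congr rfl fun i _ => by ring
    · simp
  unfold thetaSum
  rw [Finset.sum_congr rfl fun x _ => h1 x, Finset.sum_comm]
  refine Finset.sum_congr rfl fun i _ => ?_
  rw [← Finset.mul_sum, ← Finset.mul_sum, Finset.sum_add_distrib, ← thetaSum_swap]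
  rfl

/-- The symbols `θ` move to the right at least as easily as in the symmetric walk. -/
theorem stepOp_thetaSum_le (hn : 2 ≤ n) {h : Fin n → ℝ} (hh : IsProfile h) {s : State n α}
    (hs : ∀ i : Fin n, (i : ℕ) + 1 = n → s.B i ≠ none) :
    stepOp β home (fun s => ENNReal.ofReal (thetaSum h s.B)) s ≤
      ENNReal.ofReal (thetaSum (walkOp h) s.B) := by
  have hm : (0 : ℝ) < ((n - 1 : ℕ) : ℝ) := Nat.cast_pos.2 (by omega)
  calc stepOp β home (fun s => ENNReal.ofReal (thetaSum h s.B)) s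
      ≤ avgDraw n β fun i c _ => ENNReal.ofReal (if c = true then
          thetaSum h (s.B ∘ Equiv.swap (leftPos i) (rightPos i)) else thetaSum h s.B) :=
        avgDraw_mono fun i c a => ENNReal.ofReal_le_ofReal (thetaSum_step_le hh s ⟨i, c, a, 0⟩)
    _ = _ := by
        rw [avgDraw_coin, thetaSum_walkOp hs, ENNReal.ofReal_sum_of_nonneg]
        · refine Finset.sum_congr rfl fun i _ => ?_
          rw [ENNReal.ofReal_mul (by positivity), ENNReal.ofReal_mul (by positivity),
            ENNReal.ofReal_add (thetaSum_nonneg hh _) (thetaSum_nonneg hh _),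
            ENNReal.ofReal_inv_of_pos hm, ENNReal.ofReal_inv_of_pos (by norm_num)]
          simp
        · intro i _
          have h1 := thetaSum_nonneg hh (s.B ∘ Equiv.swap (leftPos i) (rightPos i))
          have h2 := thetaSum_nonneg hh s.B
          positivity

theorem stepOp_iterate_thetaSum_le (hn : 2 ≤ n) {h : Fin n → ℝ} (hh : IsProfile h)
    {s : State n α} (hs : ∀ i : Fin n, (i : ℕ) + 1 = n → s.B i ≠ none) (k : ℕ) :
    (stepOp β home)^[k] (fun s => ENNReal.ofReal (thetaSum h s.B)) s ≤
      ENNReal.ofReal (thetaSum (walkOp^[k] h) s.B) := by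
  induction k generalizing h with
  | zero => exact le_rfl
  | succ k ih =>
    rw [Function.iterate_succ_apply, Function.iterate_succ_apply]
    refine (stepOp_iterate_mono (P := fun s => ∀ i : Fin n, (i : ℕ) + 1 = n → s.B i ≠ none)
      (fun s d _ i hi => refill_ne_none _ hi) (fun s hs => stepOp_thetaSum_le hn hh hs)
      k s hs).trans ?_
    exact ih hh.walkOp

/-- The bounding state has no symbol `θ`. -/
def Complete (B : Fin n → Option α) : Prop := ∀ i, (B i).isSome

/-- The probability that a symbol `θ` is left after `t` steps. -/
def failProb (β : ℝ) (home : Fin n ≃ α) (t : ℕ) : ℝ≥0∞ :=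
  (stepOp β home)^[t] (fun s => ind (¬ Complete s.B)) ⟨home, initialBound home, 0⟩

theorem failProb_le (hn : 2 ≤ n) (t : ℕ) :
    failProb β home t ≤ ENNReal.ofReal (((n - 1 : ℕ) : ℝ) * (1 - walkGap n) ^ t) := by
  have h0 : ∀ i : Fin n, (i : ℕ) + 1 = n → initialBound home i ≠ none := by
    intro i hi
    simp [initialBound, hi]
  refine (stepOp_iterate_mono (P := fun s => ∀ i : Fin n, (i : ℕ) + 1 = n → s.B i ≠ none)
    (fun s d _ i hi => refill_ne_none _ hi)
    (Δ := fun s => ENNReal.ofReal (thetaSum countProfile s.B)) ?_ t _ h0).trans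
    ((stepOp_iterate_thetaSum_le hn isProfile_countProfile h0 t).trans ?_)
  · intro s hs
    by_cases hc : Complete s.B
    · rw [ind_not_of (not_not.2 hc)]
      exact zero_le
    · rw [ind_of hc, ENNReal.one_le_ofReal]
      unfold Complete at hc
      push Not at hc
      obtain ⟨x, hx⟩ := hc
      have hx' : s.B x = none := by simpa using hx
      have h1 : (if s.B x = none then countProfile x else 0) = 1 := by
        rw [if_pos hx', countProfile, if_neg fun h => hs x h hx']
      rw [← h1]
      exact Finset.single_le_sum (f := fun x => if s.B x = none then countProfile x else 0)
        (fun y _ => by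
          split_ifs
          · exact isProfile_countProfile.nonneg y
          · exact le_rfl) (Finset.mem_univ x)
  · refine ENNReal.ofReal_le_ofReal ((Finset.sum_le_sum fun x _ => ?_).trans (sum_iterate_le hn t))
    split_ifs
    · exact le_rfl
    · exact (isProfile_iterate t).nonneg x

theorem failProb_le_one (hn : 2 ≤ n) (t : ℕ) : failProb β home t ≤ 1 := by
  have h1 : ∀ k, (stepOp β home)^[k] (fun _ => 1) = fun _ => 1 := by
    intro k
    induction k with
    | zero => rfl
    | succ k ih =>
      rw [Function.iterate_succ_apply, show stepOp β home (fun _ => 1) = fun _ => 1 from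
        funext fun s => avgDraw_const hn β 1, ih]
  refine (stepOp_iterate_mono (P := fun _ => True) (fun _ _ _ => trivial)
    (Δ := fun _ => 1) (fun s _ => ind_le_one _) t _ trivial).trans (by rw [h1])

/-- A step makes one comparison on average: if the element that the state may move to the right is
where the bounding state holds it, exactly one of the two coins asks for a comparison, and otherwise
both or none do. -/
theorem stepOp_comparisons (hn : 2 ≤ n) (m : ℕ) :
    stepOp β home (fun s => ((s.comparisons + m : ℕ) : ℝ≥0∞)) =
      fun s => ((s.comparisons + (m + 1) : ℕ) : ℝ≥0∞) := by
  funext s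
  unfold stepOp
  refine avgDraw_eq_of_coin hn fun i => ?_
  simp only [boundingChainStep]
  split_ifs <;> simp <;> ring

theorem stepOp_iterate_comparisons (hn : 2 ≤ n) (k : ℕ) (s : State n α) :
    (stepOp β home)^[k] (fun s => (s.comparisons : ℝ≥0∞)) s = ((s.comparisons + k : ℕ) : ℝ≥0∞) := by
  have : ∀ k m, (stepOp β home)^[k] (fun s => ((s.comparisons + m : ℕ) : ℝ≥0∞)) =
      fun s => ((s.comparisons + (m + k) : ℕ) : ℝ≥0∞) := by
    intro k
    induction k with
    | zero => intro m; rfl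
    | succ k ih =>
      intro m
      rw [Function.iterate_succ_apply, stepOp_comparisons hn, ih]
      funext s
      congr 1
      omega
  have h := congrFun (this k 0) s
  simpa using h

theorem comparisons_runSteps_le (σ : Fin n → α) (l : List (Draw n)) :
    (runSteps β home σ l).comparisons ≤ 2 * l.length := by
  unfold runSteps
  induction l using List.reverseRecOn with
  | nil => simp
  | append_singleton l d ih =>
    rw [List.foldl_append, List.length_append]
    simp only [List.foldl_cons, List.foldl_nil, boundingChainStep, List.length_cons,
      List.length_nil]
    have h1 := Bool.toNat_le d.coin
    have h2 : ∀ c : Bool, c.toNat ≤ 1 := Bool.toNat_le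
    refine (add_le_add (add_le_add ih (h2 _)) h1).trans ?_
    omega

end Decay

/-! ### The recursive procedure -/

section Generate

variable {n : ℕ} {α : Type*} [PartialOrder α] {β : ℝ} {home : Fin n ≃ α}

instance [Finite α] : Countable (Output n α) := by
  refine Function.Injective.countable (f := fun g : Output n α => (g.σ, g.bits, g.comparisons)) ?_
  rintro ⟨a, b, c⟩ ⟨a', b', c'⟩ h
  simpa using h

/-- The output of a call with the draws `l`, where `g` is the output of the recursive call. -/
def combine (β : ℝ) (home : Fin n ≃ α) (l : List (Draw n)) (g : Option (Output n α)) :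
    Option (Output n α) :=
  if h : ∀ i, ((runSteps β home home l).B i).isSome then
    some ⟨fun i => ((runSteps β home home l).B i).get (h i), (l.map Draw.bits).sum,
      (runSteps β home home l).comparisons⟩
  else g.map fun g => ⟨(runSteps β home g.σ l).σ, (l.map Draw.bits).sum + g.bits,
    (runSteps β home home l).comparisons + g.comparisons + (runSteps β home g.σ l).comparisons⟩

theorem generateDepth_succ (ω : BitSource) (d t : ℕ) :
    generateDepth β home ω (d + 1) t = (drawFirst n β ω t t).bind fun l =>
      combine β home l (generateDepth β home ω d (2 * t)) := rfl

theorem combine_of_complete {l : List (Draw n)} (h : Complete (runSteps β home home l).B) :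
    ∃ b : Fin n → α, (∀ i, (runSteps β home home l).B i = some (b i)) ∧
      ∀ g : Option (Output n α), combine β home l g =
        some ⟨b, (l.map Draw.bits).sum, (runSteps β home home l).comparisons⟩ :=
  ⟨_, fun i => (Option.some_get (h i)).symm, fun _ => dif_pos h⟩

theorem combine_of_not_complete {l : List (Draw n)} (h : ¬ Complete (runSteps β home home l).B)
    (g : Option (Output n α)) :
    combine β home l g = g.map fun g => ⟨(runSteps β home g.σ l).σ,
      (l.map Draw.bits).sum + g.bits, (runSteps β home home l).comparisons + g.comparisons +
        (runSteps β home g.σ l).comparisons⟩ := dif_neg h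

theorem generateDepth_mono_succ (ω : BitSource) (d : ℕ) : ∀ (t : ℕ) (g : Output n α),
    generateDepth β home ω d t = some g → generateDepth β home ω (d + 1) t = some g := by
  induction d with
  | zero => intro t g h; simp [generateDepth] at h
  | succ d ih =>
    intro t g h
    rw [generateDepth_succ] at h ⊢
    obtain ⟨l, hl, h⟩ := Option.bind_eq_some_iff.1 h
    rw [hl, Option.bind_some]
    by_cases hc : Complete (runSteps β home home l).B
    · obtain ⟨b, -, hb⟩ := combine_of_complete hc
      rwa [hb] at h ⊢
    · rw [combine_of_not_complete hc] at h ⊢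
      obtain ⟨g', hg', h⟩ := Option.map_eq_some_iff.1 h
      rw [ih _ _ hg', Option.map_some, h]

theorem generateDepth_mono (ω : BitSource) {d d' t : ℕ} (hd : d ≤ d') {g : Output n α}
    (h : generateDepth β home ω d t = some g) : generateDepth β home ω d' t = some g := by
  induction d', hd using Nat.le_induction with
  | base => exact h
  | succ k _ ih => exact generateDepth_mono_succ ω k t g ih

theorem generate_eq_some_of {ω : BitSource} {d t : ℕ} {g : Output n α}
    (h : generateDepth β home ω d t = some g) : generate β home ω t = some g := by
  have hex : ∃ d, (generateDepth β home ω d t).isSome := ⟨d, by rw [h]; rfl⟩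
  unfold generate
  rw [firstTime_eq_some (Nat.find_spec hex) fun j hj => Nat.find_min hex hj, Option.bind_some]
  obtain ⟨g', hg'⟩ := Option.isSome_iff_exists.1 (Nat.find_spec hex)
  have h1 := generateDepth_mono ω (Nat.find_min' hex (by rw [h]; rfl)) hg'
  simp only
  rw [hg', ← h1, h]

theorem generate_eq_none_of {ω : BitSource} {t : ℕ}
    (h : ∀ d, generateDepth β home ω d t = none) : generate β home ω t = none := by
  unfold generate
  rw [firstTime_eq_none fun d => by rw [h d]; simp]
  rfl

theorem elim_generate_eq_iSup {ω : BitSource} {t : ℕ} (h : (generate β home ω t).isSome)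
    (Ψ : Output n α → ℝ≥0∞) : (generate β home ω t).elim ⊤ Ψ =
      ⨆ d, (generateDepth β home ω d t).elim 0 Ψ := by
  by_cases hex : ∃ d g, generateDepth β home ω d t = some g
  · obtain ⟨d, g, hg⟩ := hex
    rw [generate_eq_some_of hg]
    refine le_antisymm (le_iSup_of_le d (by rw [hg]; exact le_rfl)) (iSup_le fun d' => ?_)
    rcases hg' : generateDepth β home ω d' t with _ | g'
    · exact zero_le
    · have h1 := generate_eq_some_of hg
      rw [generate_eq_some_of hg'] at h1
      rw [Option.some.inj h1]
      exact le_rfl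
  · push Not at hex
    rw [generate_eq_none_of fun d => Option.eq_none_iff_forall_ne_some.2 (hex d)] at h
    exact absurd h (by simp)

variable [Finite α]

theorem readsOnly_generateDepth (d : ℕ) : ∀ t : ℕ,
    ReadsOnly {x | t ≤ x.1} fun ω => generateDepth β home ω d t := by
  induction d with
  | zero => intro t; exact ReadsOnly.const _
  | succ d ih =>
    intro t
    simp_rw [generateDepth_succ]
    have h1 : {x : ℕ × ℕ × Fin 3 × ℕ | x.1 = t ∧ x.2.1 < t} ⊆ {x | t ≤ x.1} :=
      fun x hx => hx.1.ge
    have h2 : {x : ℕ × ℕ × Fin 3 × ℕ | 2 * t ≤ x.1} ⊆ {x | t ≤ x.1} :=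
      fun x hx => le_trans (by omega : t ≤ 2 * t) hx
    exact ((readsOnly_drawFirst n β t t).mono h1).comp₂ ((ih (2 * t)).mono h2)
      fun l g => l.bind fun l => combine β home l g

theorem readsOnly_generate (t : ℕ) :
    ReadsOnly {x | t ≤ x.1} fun ω => generate β home ω t := by
  refine ReadsOnly.firstTime (p := fun d ω => (generateDepth β home ω d t).isSome)
    (X := fun d ω => (generateDepth β home ω d t).getD ⟨home, 0, 0⟩)
    (fun d => (readsOnly_generateDepth d t).comp fun g => (g.isSome : Prop))
    (fun d => (readsOnly_generateDepth d t).comp fun g => g.getD ⟨home, 0, 0⟩) ?_ ?_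
  · intro ω d hd _
    obtain ⟨g, hg⟩ := Option.isSome_iff_exists.1 hd
    rw [generate_eq_some_of hg, hg]
    rfl
  · intro ω h
    exact generate_eq_none_of fun d => by simpa using h d

/-- The draws of a call are independent of its recursive call. -/
theorem lintegral_generateDepth_succ {t : ℕ} (ht : 1 ≤ t) (d : ℕ)
    (Φ : Option (Output n α) → ℝ≥0∞) :
    ∫⁻ ω, Φ (generateDepth β home ω (d + 1) t) ∂fairBits =
      ∫⁻ ω, ∫⁻ ω', Φ ((drawFirst n β ω t t).bind fun l =>
        combine β home l (generateDepth β home ω' d (2 * t))) ∂fairBits ∂fairBits := by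
  have hd : Disjoint {x : ℕ × ℕ × Fin 3 × ℕ | x.1 = t ∧ x.2.1 < t} {x | 2 * t ≤ x.1} :=
    Set.disjoint_left.2 fun x h1 h2 => by
      have h3 : x.1 = t := h1.1
      have h4 : 2 * t ≤ x.1 := h2
      omega
  exact lintegral_of_disjoint hd (readsOnly_drawFirst n β t t)
    (readsOnly_generateDepth d (2 * t)) fun l g => Φ (l.bind fun l => combine β home l g)

omit [Finite α] in
theorem lintegral_ind_not_complete (hn : 2 ≤ n) (t : ℕ) :
    ∫⁻ ω, (drawFirst n β ω t t).elim 0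
      (fun l => ind (¬ Complete (runSteps β home home l).B)) ∂fairBits = failProb β home t :=
  lintegral_drawFirst hn β home t home t fun s => ind (¬ Complete s.B)

theorem lintegral_generateDepth_none_le (hn : 2 ≤ n) {t : ℕ} (ht : 1 ≤ t) (d : ℕ) :
    ∫⁻ ω, ind (generateDepth β home ω (d + 1) t = none) ∂fairBits ≤
      failProb β home t * ∫⁻ ω, ind (generateDepth β home ω d (2 * t) = none) ∂fairBits := by
  rw [lintegral_generateDepth_succ ht d fun g => ind (g = none), ← lintegral_ind_not_complete hn,
    ← lintegral_mul_const _ ((readsOnly_drawFirst n β t t).measurable' fun l => l.elim 0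
      fun l => ind (¬ Complete (runSteps β home home l).B))]
  refine lintegral_mono_ae ?_
  filter_upwards [ae_isSome_drawFirst hn β t t] with ω hω
  obtain ⟨l, hl⟩ := Option.isSome_iff_exists.1 hω
  simp only [hl, Option.bind_some, Option.elim_some]
  by_cases hc : Complete (runSteps β home home l).B
  · have : ∀ g, combine β home l g ≠ none := by
      intro g
      obtain ⟨b, -, hb⟩ := combine_of_complete hc
      rw [hb]; simp
    simp [this]
  · simp_rw [combine_of_not_complete hc]
    simp [hc]

theorem lintegral_ind_le_one (p : BitSource → Prop) : ∫⁻ ω, ind (p ω) ∂fairBits ≤ 1 :=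
  (lintegral_mono fun ω => ind_le_one (p ω)).trans (by simp)

/-- The procedure needs more than `d + 1` nested calls only if the last of them fails. -/
theorem lintegral_generateDepth_none_le_failProb (hn : 2 ≤ n) (d : ℕ) : ∀ {t : ℕ}, 1 ≤ t →
    ∫⁻ ω, ind (generateDepth β home ω (d + 1) t = none) ∂fairBits ≤
      failProb β home (2 ^ d * t) := by
  induction d with
  | zero =>
    intro t ht
    refine (lintegral_generateDepth_none_le hn ht 0).trans ?_
    rw [pow_zero, one_mul]
    exact mul_le_of_le_one_right zero_le (lintegral_ind_le_one _)
  | succ d ih =>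
    intro t ht
    refine (lintegral_generateDepth_none_le hn ht _).trans ?_
    rw [pow_succ, mul_assoc]
    exact (mul_le_of_le_one_left zero_le (failProb_le_one hn t)).trans (ih (by omega))

omit [Finite α] in
theorem tendsto_failProb (hn : 2 ≤ n) {t : ℕ} (ht : 1 ≤ t) :
    Filter.Tendsto (fun d => failProb β home (2 ^ d * t)) Filter.atTop (nhds 0) := by
  have h1 : Filter.Tendsto (fun d : ℕ => 2 ^ d * t) Filter.atTop Filter.atTop := by
    refine Filter.tendsto_atTop_mono (fun d => ?_) Filter.tendsto_id
    exact (Nat.lt_two_pow_self (n := d)).le.trans (Nat.le_mul_of_pos_right _ ht)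
  have h2 : Filter.Tendsto (fun s : ℕ => ((n - 1 : ℕ) : ℝ) * (1 - walkGap n) ^ s)
      Filter.atTop (nhds 0) := by
    simpa using (tendsto_pow_atTop_nhds_zero_of_lt_one
      (by linarith [walkGap_le_one hn] : 0 ≤ 1 - walkGap n)
      (by linarith [walkGap_pos hn])).const_mul ((n - 1 : ℕ) : ℝ)
  have h3 := (ENNReal.continuous_ofReal.tendsto 0).comp h2
  rw [ENNReal.ofReal_zero] at h3
  exact tendsto_of_tendsto_of_tendsto_of_le_of_le tendsto_const_nhds (h3.comp h1)
    (fun _ => zero_le) fun d => failProb_le hn _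

theorem ae_isSome_generate (hn : 2 ≤ n) {t : ℕ} (ht : 1 ≤ t) :
    ∀ᵐ ω ∂fairBits, (generate β home ω t).isSome := by
  have h0 : ∫⁻ ω, ind (generate β home ω t = none) ∂fairBits = 0 := by
    refine le_antisymm (ge_of_tendsto' (tendsto_failProb (β := β) (home := home) hn ht)
      fun d => ?_) zero_le
    refine (lintegral_mono fun ω => ?_).trans (lintegral_generateDepth_none_le_failProb hn d ht)
    by_cases hd : generateDepth β home ω (d + 1) t = none
    · rw [ind_of hd]
      exact ind_le_one _
    · obtain ⟨g, hg⟩ := Option.ne_none_iff_exists'.1 hd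
      rw [generate_eq_some_of hg]
      simp
  rw [lintegral_eq_zero_iff ((readsOnly_generate t).measurable' fun g => ind (g = none))] at h0
  filter_upwards [h0] with ω hω
  by_contra hc
  have : generate β home ω t = none := by simpa using hc
  rw [ind_of this] at hω
  exact absurd hω (by simp)

theorem lintegral_generate (hn : 2 ≤ n) {t : ℕ} (ht : 1 ≤ t) (Ψ : Output n α → ℝ≥0∞) :
    ∫⁻ ω, (generate β home ω t).elim ⊤ Ψ ∂fairBits =
      ⨆ d, ∫⁻ ω, (generateDepth β home ω d t).elim 0 Ψ ∂fairBits := by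
  rw [← lintegral_iSup]
  · refine lintegral_congr_ae ?_
    filter_upwards [ae_isSome_generate (β := β) (home := home) hn ht] with ω hω
    exact elim_generate_eq_iSup hω Ψ
  · exact fun d => (readsOnly_generateDepth (β := β) (home := home) d t).measurable'
      fun g : Option (Output n α) => g.elim 0 Ψ
  · intro d d' hd ω
    show (generateDepth β home ω d t).elim 0 Ψ ≤ (generateDepth β home ω d' t).elim 0 Ψ
    rcases hg : generateDepth β home ω d t with _ | g
    · exact zero_le
    · rw [generateDepth_mono ω hd hg]

end Generate

/-! ### The output has the weighted distribution -/

section Output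

variable {n : ℕ} {α : Type*} [PartialOrder α] {β : ℝ} {home : Fin n ≃ α}

variable [Fintype α]

/-- No value is more likely to be returned than under the weighted distribution: a run from a
random state with this distribution ends in the bounding state, if this is complete. -/
theorem lintegral_generateDepth_state_le (hn : 2 ≤ n) (hhome : IsLinearExtension home)
    (hβ : 0 ≤ β) (d : ℕ) : ∀ {t : ℕ}, 1 ≤ t → ∀ F : (Fin n → α) → ℝ≥0∞,
    ∫⁻ ω, (generateDepth β home ω d t).elim 0 (fun g => F g.σ) ∂fairBits ≤
      ∑ σ, target β home σ * F σ := by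
  induction d with
  | zero => intro t _ F; simp [generateDepth]
  | succ d ih =>
    intro t ht F
    rw [lintegral_generateDepth_succ ht d fun g => g.elim 0 fun g => F g.σ]
    calc _ ≤ ∫⁻ ω, ∑ σ, target β home σ * (drawFirst n β ω t t).elim 0
          (fun l => F (runSteps β home σ l).σ) ∂fairBits := by
          refine lintegral_mono fun ω => ?_
          rcases drawFirst n β ω t t with _ | l
          · simp
          simp only [Option.bind_some, Option.elim_some]
          by_cases hc : Complete (runSteps β home home l).B
          · obtain ⟨b, hb, hcomb⟩ := combine_of_complete hc
            simp_rw [hcomb, Option.elim_some]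
            rw [lintegral_const, measure_univ, mul_one, ← one_mul (F b), ← sum_target hhome hβ,
              Finset.sum_mul]
            refine Finset.sum_le_sum fun σ _ => ?_
            by_cases hσ : target β home σ = 0
            · simp [hσ]
            · have h2 := stateInv_runSteps hhome (by omega) (admissible_of_target_ne_zero hσ) l
              rw [h2.eq_of_complete (b := b) fun i => by rw [runSteps_B_eq σ home]; exact hb i]
          · simp_rw [combine_of_not_complete hc]
            refine Eq.trans_le ?_ (ih (by omega : 1 ≤ 2 * t) fun τ => F (runSteps β home τ l).σ)
            refine lintegral_congr fun ω' => ?_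
            rcases generateDepth β home ω' d (2 * t) with _ | g <;> rfl
      _ = ∑ σ, target β home σ * (chainOp β home)^[t] F σ := by
          rw [lintegral_finsetSum (f := fun (σ : Fin n ≃ α) ω => target β home σ *
            (drawFirst n β ω t t).elim 0 fun l => F (runSteps β home σ l).σ) _
            fun σ _ => ((readsOnly_drawFirst n β t t).measurable'
            fun l => l.elim 0 fun l => F (runSteps β home σ l).σ).const_mul _]
          refine Finset.sum_congr rfl fun σ _ => ?_
          rw [lintegral_const_mul _ ((readsOnly_drawFirst n β t t).measurable'
            fun l => l.elim 0 fun l => F (runSteps β home σ l).σ),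
            lintegral_drawFirst hn β home t σ t fun s => F s.σ, stepOp_iterate_state]
      _ = _ := sum_target_mul_iterate hn F t

/-- The output has the weighted distribution: both are probability distributions, and the first is
nowhere larger than the second. -/
theorem outputProb_eq_target (hn : 2 ≤ n) (hhome : IsLinearExtension home) (hβ : 0 ≤ β) {t : ℕ}
    (ht : 1 ≤ t) (σ : Fin n ≃ α) : outputProb β home t σ = target β home σ := by
  have hae := ae_isSome_generate (β := β) (home := home) hn ht
  have hle : ∀ F : (Fin n → α) → ℝ≥0∞,
      ∫⁻ ω, (generate β home ω t).elim ⊤ (fun g => F g.σ) ∂fairBits ≤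
        ∑ σ, target β home σ * F σ := by
    intro F
    rw [lintegral_generate hn ht]
    exact iSup_le fun d => lintegral_generateDepth_state_le hn hhome hβ d ht F
  have hprob : outputProb β home t σ =
      ∫⁻ ω, (generate β home ω t).elim ⊤ (fun g => ind (g.σ = σ)) ∂fairBits := by
    unfold outputProb
    rw [measure_setOf_eq_lintegral (S := {x | t ≤ x.1}) ((readsOnly_generate t).comp
      fun g => ∃ g', g = some g' ∧ g'.σ = σ)]
    refine lintegral_congr_ae ?_
    filter_upwards [hae] with ω hω
    obtain ⟨g, hg⟩ := Option.isSome_iff_exists.1 hω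
    simp [hg]
  have h1 : ∑ τ, target β home τ * ind ((τ : Fin n → α) = σ) = target β home σ := by
    rw [Finset.sum_eq_single σ]
    · simp
    · intro τ _ hτ
      rw [ind_not_of fun h => hτ (DFunLike.coe_injective h), mul_zero]
    · simp
  have h2 : ∑ τ, target β home τ * ind ((τ : Fin n → α) = σ) +
      ∑ τ, target β home τ * ind ((τ : Fin n → α) ≠ σ) = 1 := by
    rw [← Finset.sum_add_distrib, ← sum_target hhome hβ]
    refine Finset.sum_congr rfl fun τ _ => ?_
    by_cases h : (τ : Fin n → α) = σ <;> simp [h]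
  have h3 : ∫⁻ ω, (generate β home ω t).elim ⊤ (fun g => ind (g.σ = σ)) ∂fairBits +
      ∫⁻ ω, (generate β home ω t).elim ⊤ (fun g => ind (g.σ ≠ σ)) ∂fairBits = 1 := by
    rw [← lintegral_add_left ((readsOnly_generate t).measurable'
      fun g => g.elim ⊤ fun g => ind (g.σ = σ)), lintegral_congr_ae (g := fun _ => 1)]
    · simp
    · filter_upwards [hae] with ω hω
      obtain ⟨g, hg⟩ := Option.isSome_iff_exists.1 hω
      by_cases h : g.σ = σ <;> simp [hg, h]
  have hle1 := hle fun τ => ind (τ = σ)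
  have hle2 := hle fun τ => ind (τ ≠ σ)
  rw [hprob]
  rw [h1] at hle1 h2
  refine le_antisymm hle1 ?_
  -- returning `σ` and not returning `σ` are both at most as likely as under the distribution, and
  -- the probabilities add up to `1` on both sides
  by_contra hlt
  have hfin : ∑ τ, target β home τ * ind ((τ : Fin n → α) ≠ σ) ≠ ⊤ := fun h => by
    rw [h] at h2; simp at h2
  have := ENNReal.add_lt_add_of_lt_of_le (ne_top_of_le_ne_top hfin hle2) (not_le.1 hlt) hle2
  rw [h2, h3] at this
  exact lt_irrefl _ this

end Output

/-! ### Recursion for the expected costs -/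

section Cost

variable {n : ℕ} {α : Type*} [PartialOrder α] [Finite α] {β : ℝ} {home : Fin n ≃ α}

theorem lintegral_generateDepth_bits_le (hn : 2 ≤ n) {t : ℕ} (ht : 1 ≤ t) (d : ℕ) :
    ∫⁻ ω, (generateDepth β home ω (d + 1) t).elim 0 (fun g => (g.bits : ℝ≥0∞)) ∂fairBits ≤
      (t * (Nat.clog 2 (n - 1) + 4) : ℕ) + failProb β home t *
        ∫⁻ ω, (generateDepth β home ω d (2 * t)).elim 0 (fun g => (g.bits : ℝ≥0∞)) ∂fairBits := by
  set W := ∫⁻ ω, (generateDepth β home ω d (2 * t)).elim 0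
    (fun g => (g.bits : ℝ≥0∞)) ∂fairBits with hW
  have hm := readsOnly_drawFirst n β t t
  rw [lintegral_generateDepth_succ ht d fun g => g.elim 0 fun g => (g.bits : ℝ≥0∞)]
  calc _ ≤ ∫⁻ ω, ((drawFirst n β ω t t).elim 0 (fun l => ((l.map Draw.bits).sum : ℝ≥0∞)) +
        (drawFirst n β ω t t).elim 0
          (fun l => ind (¬ Complete (runSteps β home home l).B)) * W) ∂fairBits := by
        refine lintegral_mono fun ω => ?_
        rcases drawFirst n β ω t t with _ | l
        · simp
        simp only [Option.bind_some, Option.elim_some]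
        by_cases hc : Complete (runSteps β home home l).B
        · obtain ⟨b, -, hcomb⟩ := combine_of_complete hc
          simp_rw [hcomb, Option.elim_some]
          simp
        · simp_rw [combine_of_not_complete hc, ind_of hc, one_mul, hW]
          refine (lintegral_mono (g := fun ω' => ((l.map Draw.bits).sum : ℝ≥0∞) +
            (generateDepth β home ω' d (2 * t)).elim 0 (fun g => (g.bits : ℝ≥0∞)))
            fun ω' => ?_).trans ?_
          · beta_reduce
            rcases generateDepth β home ω' d (2 * t) with _ | g <;> simp
          · rw [lintegral_add_left measurable_const]
            simp
    _ ≤ _ := by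
        rw [lintegral_add_left (hm.measurable' fun l => l.elim 0
          fun l => ((l.map Draw.bits).sum : ℝ≥0∞)), lintegral_mul_const _
          (hm.measurable' fun l => l.elim 0
          fun l => ind (¬ Complete (runSteps β home home l).B)), lintegral_ind_not_complete hn]
        exact add_le_add_left (lintegral_drawFirst_bits_le hn β t t) _

/-- The repeated steps cost at most two comparisons each. -/
theorem lintegral_generateDepth_comparisons_le (hn : 2 ≤ n) {t : ℕ} (ht : 1 ≤ t) (d : ℕ) :
    ∫⁻ ω, (generateDepth β home ω (d + 1) t).elim 0
        (fun g => (g.comparisons : ℝ≥0∞)) ∂fairBits ≤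
      t + failProb β home t * (∫⁻ ω, (generateDepth β home ω d (2 * t)).elim 0
        (fun g => (g.comparisons : ℝ≥0∞)) ∂fairBits + (2 * t : ℕ)) := by
  set V := ∫⁻ ω, (generateDepth β home ω d (2 * t)).elim 0
    (fun g => (g.comparisons : ℝ≥0∞)) ∂fairBits with hV
  have hm := readsOnly_drawFirst n β t t
  rw [lintegral_generateDepth_succ ht d fun g => g.elim 0 fun g => (g.comparisons : ℝ≥0∞)]
  calc _ ≤ ∫⁻ ω, ((drawFirst n β ω t t).elim 0
          (fun l => ((runSteps β home home l).comparisons : ℝ≥0∞)) +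
        (drawFirst n β ω t t).elim 0
          (fun l => ind (¬ Complete (runSteps β home home l).B)) * (V + (2 * t : ℕ)))
          ∂fairBits := by
        refine lintegral_mono fun ω => ?_
        rcases hl : drawFirst n β ω t t with _ | l
        · simp
        have hlen := length_of_drawFirst hl
        simp only [Option.bind_some, Option.elim_some]
        by_cases hc : Complete (runSteps β home home l).B
        · obtain ⟨b, -, hcomb⟩ := combine_of_complete hc
          simp_rw [hcomb, Option.elim_some]
          simp
        · simp_rw [combine_of_not_complete hc, ind_of hc, one_mul, hV]
          refine (lintegral_mono (g := fun ω' =>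
            (((runSteps β home home l).comparisons : ℝ≥0∞) + (2 * t : ℕ)) +
            (generateDepth β home ω' d (2 * t)).elim 0 (fun g => (g.comparisons : ℝ≥0∞)))
            fun ω' => ?_).trans ?_
          · beta_reduce
            rcases generateDepth β home ω' d (2 * t) with _ | g
            · simp
            · have h1 := comparisons_runSteps_le (β := β) (home := home) g.σ l
              rw [hlen] at h1
              simp only [Option.map_some, Option.elim_some]
              exact_mod_cast (by omega : (runSteps β home home l).comparisons + g.comparisons +
                (runSteps β home g.σ l).comparisons ≤
                (runSteps β home home l).comparisons + 2 * t + g.comparisons)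
          · rw [lintegral_add_left measurable_const, lintegral_const, measure_univ, mul_one,
              add_assoc, add_comm ((2 * t : ℕ) : ℝ≥0∞)]
    _ ≤ _ := by
        rw [lintegral_add_left (hm.measurable' fun l => l.elim 0
          fun l => ((runSteps β home home l).comparisons : ℝ≥0∞)), lintegral_mul_const _
          (hm.measurable' fun l => l.elim 0
          fun l => ind (¬ Complete (runSteps β home home l).B)), lintegral_ind_not_complete hn,
          lintegral_drawFirst hn β home t home t fun s => (s.comparisons : ℝ≥0∞),
          stepOp_iterate_comparisons hn]
        simp

/-- A bound `G` for the expected number of steps drawn: it dominates the own steps of a call and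
those of its recursive call. -/
def IsStepBound (β : ℝ) (home : Fin n ≃ α) (G : ℕ → ℝ≥0∞) : Prop :=
  ∀ t : ℕ, 1 ≤ t → (t : ℝ≥0∞) + failProb β home t * G (2 * t) ≤ G t

theorem expectedBits_le (hn : 2 ≤ n) {G : ℕ → ℝ≥0∞} (hG : IsStepBound β home G) {t : ℕ}
    (ht : 1 ≤ t) : expectedBits β home t ≤ (Nat.clog 2 (n - 1) + 4 : ℕ) * G t := by
  unfold expectedBits
  rw [lintegral_generate hn ht]
  refine iSup_le fun d => ?_
  induction d generalizing t with
  | zero => simp [generateDepth]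
  | succ d ih =>
    refine (lintegral_generateDepth_bits_le hn ht d).trans ?_
    refine le_trans ?_ (mul_le_mul_right (hG t ht) _)
    rw [mul_add ((Nat.clog 2 (n - 1) + 4 : ℕ) : ℝ≥0∞), mul_left_comm _ (failProb β home t),
      Nat.cast_mul, mul_comm (t : ℝ≥0∞)]
    exact add_le_add_right (mul_le_mul_right (ih (by omega)) _) _

/-- The first runs of all calls cost one comparison per step on average. A call with `t` steps
repeats them only if it makes a call with `2 t` steps, so that the repeated steps at two comparisons
each cost no more than the first runs of the recursive calls. -/
theorem expectedComparisons_le (hn : 2 ≤ n) {G : ℕ → ℝ≥0∞} (hG : IsStepBound β home G) {t : ℕ}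
    (ht : 1 ≤ t) : expectedComparisons β home t ≤ 2 * G t := by
  have key : ∀ d {t : ℕ}, 1 ≤ t → ∫⁻ ω, (generateDepth β home ω d t).elim 0
      (fun g => (g.comparisons : ℝ≥0∞)) ∂fairBits + t ≤ 2 * G t := by
    intro d
    induction d with
    | zero =>
      intro t ht
      have h1 : (t : ℝ≥0∞) ≤ G t := le_self_add.trans (hG t ht)
      simp only [generateDepth, Option.elim_none, lintegral_zero, zero_add, two_mul]
      exact h1.trans le_self_add
    | succ d ih =>
      intro t ht
      refine (add_le_add_left (lintegral_generateDepth_comparisons_le hn ht d) _).trans ?_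
      refine (add_le_add_left (add_le_add_right (mul_le_mul_right (ih (by omega)) _) _) _).trans ?_
      refine le_trans (le_of_eq ?_) (mul_le_mul_right (hG t ht) 2)
      ring
  unfold expectedComparisons
  rw [lintegral_generate hn ht]
  exact iSup_le fun d => le_self_add.trans (key d ht)

end Cost

/-! ### The number of steps -/

section Steps

/-- A bound for the expected number of steps drawn by a call with `t` steps, if a call with `s`
steps fails with probability at most `min 1 (M * exp (-γ * s))`. Here `T = log M / γ` is the time
from which on this is less than `1`. -/
def stepBound (M T t : ℝ) : ℝ :=
  if t ≤ 2 * T then 9 / 2 * ((M - 1) / (M - 2)) * T - t else M / (M - 2) * t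

theorem stepBound_nonneg {M T t : ℝ} (hM : 3 ≤ M) (hT : 0 ≤ T) (ht : 0 ≤ t) :
    0 ≤ stepBound M T t := by
  have h1 : 0 < M - 2 := by linarith
  have h2 : 1 ≤ (M - 1) / (M - 2) := by rw [le_div_iff₀ h1]; linarith
  unfold stepBound
  split_ifs with h
  · nlinarith
  · exact mul_nonneg (div_nonneg (by linarith) h1.le) ht

theorem stepBound_le {M T t N : ℝ} (hM : 3 ≤ M) (ht : 0 ≤ t) (htN : t ≤ N) :
    stepBound M T t ≤ max (9 / 2 * ((M - 1) / (M - 2)) * T) (3 * N) := by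
  have h1 : 0 < M - 2 := by linarith
  have h2 : M / (M - 2) ≤ 3 := by rw [div_le_iff₀ h1]; linarith
  unfold stepBound
  split_ifs with h
  · exact le_max_of_le_left (by linarith)
  · refine le_max_of_le_right ((mul_le_mul_of_nonneg_right h2 ht).trans ?_)
    linarith

theorem exp_neg_mul_log_le {M s : ℝ} (hM : 0 < M) (hs0 : 0 ≤ s) (hs1 : s ≤ 1) :
    Real.exp (-(s * Real.log M)) ≤ 1 - s + s / M := by
  have h := convexOn_exp.2 (Set.mem_univ 0) (Set.mem_univ (-Real.log M))
    (by linarith : 0 ≤ 1 - s) hs0 (by ring)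
  simp only [smul_eq_mul, mul_zero, zero_add, Real.exp_zero, mul_one, Real.exp_neg,
    Real.exp_log hM] at h
  rw [show -(s * Real.log M) = s * -Real.log M by ring]
  rw [div_eq_mul_inv]
  exact h

/-- Up to time `T` all calls may fail; between `T` and `2 T` the exponential is bounded by its
chord, and from `2 T` on a call fails with probability at most `1 / M`. -/
theorem stepBound_recursion {M γ t p : ℝ} (hM : 3 ≤ M) (hγ : 0 < γ) (ht : 0 ≤ t)
    (hp1 : p ≤ 1) (hp : p ≤ M * Real.exp (-γ * t)) :
    t + p * stepBound M (Real.log M / γ) (2 * t) ≤ stepBound M (Real.log M / γ) t := by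
  have hM0 : 0 < M := by linarith
  have h1 : 0 < M - 2 := by linarith
  have hL : 0 < Real.log M := Real.log_pos (by linarith)
  obtain ⟨T, hT⟩ : ∃ T, T = Real.log M / γ := ⟨_, rfl⟩
  have hT0 : 0 < T := hT ▸ div_pos hL hγ
  have hγT : γ * T = Real.log M := by rw [hT]; field_simp
  rw [← hT]
  have hexp : M * Real.exp (-γ * t) = Real.exp (-((t - T) / T * Real.log M)) := by
    rw [← hγT, show -((t - T) / T * (γ * T)) = γ * T + -γ * t by field_simp; ring, Real.exp_add,
      hγT, Real.exp_log hM0]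
  rw [hexp] at hp
  have hg := stepBound_nonneg (t := 2 * t) hM hT0.le (by linarith)
  rcases le_or_gt t T with h | h
  · have h2 : p * stepBound M T (2 * t) ≤ stepBound M T (2 * t) := mul_le_of_le_one_left hg hp1
    refine (add_le_add_right h2 t).trans ?_
    unfold stepBound
    rw [if_pos (by linarith), if_pos (by linarith)]
    linarith
  rcases le_or_gt t (2 * T) with h2 | h2
  · have hs0 : 0 ≤ (t - T) / T := div_nonneg (by linarith) hT0.le
    have hs1 : (t - T) / T ≤ 1 := by rw [div_le_one hT0]; linarith
    have hp' := hp.trans (exp_neg_mul_log_le hM0 hs0 hs1)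
    refine (add_le_add_right (mul_le_mul_of_nonneg_right hp' hg) t).trans ?_
    obtain ⟨s, hs⟩ : ∃ s, s = (t - T) / T := ⟨_, rfl⟩
    rw [← hs] at hs0 hs1 ⊢
    have hts : t = (1 + s) * T := by rw [hs]; field_simp; ring
    unfold stepBound
    rw [if_neg (by linarith), if_pos h2, hts]
    have h3 : (1 - s + s / M) * (M / (M - 2) * (2 * ((1 + s) * T))) =
        2 * (1 + s) * T * ((M - s * (M - 1)) / (M - 2)) := by
      field_simp
      ring
    have h4 : (1 + s) * T + 2 * (1 + s) * T * ((M - s * (M - 1)) / (M - 2)) =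
        (2 * (1 + s) * (2 - s)) * ((M - 1) / (M - 2)) * T - (1 + s) * T := by
      field_simp
      ring
    rw [h3, h4]
    have h5 : 0 ≤ (M - 1) / (M - 2) := div_nonneg (by linarith) h1.le
    have h6 : 2 * (1 + s) * (2 - s) ≤ 9 / 2 := by nlinarith [sq_nonneg (2 * s - 1)]
    have h7 := mul_le_mul_of_nonneg_right (mul_le_mul_of_nonneg_right h6 h5) hT0.le
    linarith
  · have h3 : Real.exp (-((t - T) / T * Real.log M)) ≤ 1 / M := by
      rw [one_div, ← Real.exp_log (inv_pos.2 hM0), Real.log_inv, Real.exp_le_exp]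
      have : 1 ≤ (t - T) / T := by rw [le_div_iff₀ hT0]; linarith
      nlinarith
    refine (add_le_add_right (mul_le_mul_of_nonneg_right (hp.trans h3) hg) t).trans ?_
    unfold stepBound
    rw [if_neg (by linarith), if_neg (by linarith)]
    refine le_of_eq ?_
    field_simp
    ring

/-- The number that takes the place of the number of positions in the bound for the probability of
failure; it is at least `3` so that `M / (M - 2)` is finite. -/
def stepBase (n : ℕ) : ℝ := max 3 n

variable {n : ℕ} {α : Type*} [PartialOrder α] {β : ℝ} {home : Fin n ≃ α}

theorem isStepBound_stepBound (hn : 2 ≤ n) : IsStepBound β home fun t =>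
    ENNReal.ofReal (stepBound (stepBase n) (Real.log (stepBase n) / walkGap n) t) := by
  intro t ht
  have hM : 3 ≤ stepBase n := le_max_left _ _
  have hγ := walkGap_pos hn
  have hfin : failProb β home t ≠ ⊤ :=
    ne_top_of_le_ne_top ENNReal.one_ne_top (failProb_le_one hn t)
  have hp1 : (failProb β home t).toReal ≤ 1 := ENNReal.toReal_le_of_le_ofReal zero_le_one
    (by rw [ENNReal.ofReal_one]; exact failProb_le_one hn t)
  have hp : (failProb β home t).toReal ≤ stepBase n * Real.exp (-walkGap n * t) := by
    refine (ENNReal.toReal_le_of_le_ofReal ?_ (failProb_le hn t)).trans ?_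
    · have : 0 ≤ 1 - walkGap n := by linarith [walkGap_le_one hn]
      positivity
    · have h1 : ((n - 1 : ℕ) : ℝ) ≤ stepBase n :=
        le_max_of_le_right (by exact_mod_cast Nat.sub_le n 1)
      refine mul_le_mul h1 ?_ (pow_nonneg (by linarith [walkGap_le_one hn]) _) (by linarith)
      rw [mul_comm, Real.exp_nat_mul]
      exact pow_le_pow_left₀ (by linarith [walkGap_le_one hn])
        (Real.one_sub_le_exp_neg _) _
  have h := stepBound_recursion hM hγ (Nat.cast_nonneg t) hp1 hp
  have hg := stepBound_nonneg (T := Real.log (stepBase n) / walkGap n) (t := 2 * (t : ℝ)) hM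
    (div_nonneg (Real.log_nonneg (by linarith)) hγ.le) (by positivity)
  rw [← ENNReal.ofReal_toReal hfin]
  push_cast
  rw [← ENNReal.ofReal_mul ENNReal.toReal_nonneg, ← ENNReal.ofReal_natCast t,
    ← ENNReal.ofReal_add (by positivity) (mul_nonneg ENNReal.toReal_nonneg hg)]
  exact ENNReal.ofReal_le_ofReal h

/-! ### Numerical bounds -/

/-- The constants are `π ^ 2 / 2`, rounded down, and `5 * π ^ 2 / 48`, rounded up. -/
theorem one_sub_cos_walkAngle_ge (hn : 3 ≤ n) :
    4.934 / (2 * (n : ℝ) - 1) ^ 2 * (1 - 1.0282 / (2 * (n : ℝ) - 1) ^ 2) ≤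
      1 - Real.cos (walkAngle n) := by
  have hn' : (3 : ℝ) ≤ n := by exact_mod_cast hn
  have hq : 0 < 2 * (n : ℝ) - 1 := by linarith
  have hpi1 := Real.pi_gt_d4
  have hpi2 := Real.pi_lt_d4
  have ha0 := walkAngle_pos (by omega : 2 ≤ n)
  have ha1 : walkAngle n ≤ 1 := by
    unfold walkAngle
    rw [div_le_one hq]
    linarith
  have hb := (abs_le.1 (Real.cos_bound (by rw [abs_of_pos ha0]; exact ha1))).2
  rw [abs_of_pos ha0] at hb
  have h1 : 1 - Real.cos (walkAngle n) ≥
      walkAngle n ^ 2 / 2 * (1 - 5 / 48 * walkAngle n ^ 2) := by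
    nlinarith
  refine le_trans ?_ h1
  have h2 : walkAngle n ^ 2 = Real.pi ^ 2 / (2 * (n : ℝ) - 1) ^ 2 := by
    unfold walkAngle; rw [div_pow]
  have h3 : (9.868 : ℝ) ≤ Real.pi ^ 2 := by nlinarith
  have h4 : Real.pi ^ 2 ≤ 9.87 := by nlinarith
  have hq2 : 0 < (2 * (n : ℝ) - 1) ^ 2 := by positivity
  have h5 : 4.934 / (2 * (n : ℝ) - 1) ^ 2 ≤ walkAngle n ^ 2 / 2 := by
    rw [h2, div_div, mul_comm _ (2 : ℝ), ← div_div]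
    exact div_le_div_of_nonneg_right (by linarith) hq2.le
  have h6 : 5 / 48 * walkAngle n ^ 2 ≤ 1.0282 / (2 * (n : ℝ) - 1) ^ 2 := by
    rw [h2, ← mul_div_assoc]
    exact div_le_div_of_nonneg_right (by linarith) hq2.le
  have h7 : 1.0282 / (2 * (n : ℝ) - 1) ^ 2 ≤ 1 := by
    rw [div_le_one hq2]
    nlinarith
  exact mul_le_mul h5 (by linarith) (by linarith) (by positivity)

/-- The constant of the bound for the expected number of steps. It has to be at most `4.3`, and from
`n = 3` on smaller by the factor `(⌈log₂ n⌉ + 3) / (⌈log₂ n⌉ + 4)`, as a step takes up to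
`⌈log₂ n⌉ + 4` random bits: this factor is `5 / 6` for `n = 3, 4` and at least `6 / 7` for larger
`n`. For `n = 2` a step takes `4` bits. -/
def stepConst (n : ℕ) : ℝ := if n = 2 then 4.3 else if n ≤ 4 then 3.58 else 3.68

theorem poly_bound {x : ℝ} (hx : 5 ≤ x) :
    9 / 2 * (x - 1) ^ 2 * ((2 * x - 1) ^ 2) ^ 2 ≤
      3.68 * 4.934 * x ^ 3 * (x - 2) * ((2 * x - 1) ^ 2 - 1.0282) := by
  -- in powers of `x - 5`, all coefficients of the difference of the two sides are nonnegative
  obtain ⟨y, rfl⟩ : ∃ y, x = 5 + y := ⟨x - 5, by ring⟩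
  have hy : 0 ≤ y := by linarith
  have h2 := pow_nonneg hy 2
  have h3 := pow_nonneg hy 3
  have h4 := pow_nonneg hy 4
  have h5 := pow_nonneg hy 5
  have h6 := pow_nonneg hy 6
  nlinarith

theorem gap_bound (hn : 3 ≤ n) :
    9 / 2 * ((n : ℝ) - 1) ^ 2 ≤
      stepConst n * (n : ℝ) ^ 3 * ((n : ℝ) - 2) * (1 - Real.cos (walkAngle n)) := by
  have hn' : (3 : ℝ) ≤ n := by exact_mod_cast hn
  have hc0 : 0 < stepConst n := by unfold stepConst; split_ifs <;> norm_num
  have h := one_sub_cos_walkAngle_ge hn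
  have hpos : 0 ≤ stepConst n * (n : ℝ) ^ 3 * ((n : ℝ) - 2) :=
    mul_nonneg (by positivity) (by linarith)
  refine le_trans ?_ (mul_le_mul_of_nonneg_left h hpos)
  obtain rfl | rfl | hn5 : n = 3 ∨ n = 4 ∨ 5 ≤ n := by omega
  · norm_num [stepConst]
  · norm_num [stepConst]
  · have hc : stepConst n = 3.68 := by
      unfold stepConst
      rw [if_neg (by omega), if_neg (by omega)]
    have hn5' : (5 : ℝ) ≤ n := by exact_mod_cast hn5
    have hq : 0 < 2 * (n : ℝ) - 1 := by linarith
    rw [hc]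
    have e : 3.68 * (n : ℝ) ^ 3 * ((n : ℝ) - 2) *
        (4.934 / (2 * (n : ℝ) - 1) ^ 2 * (1 - 1.0282 / (2 * (n : ℝ) - 1) ^ 2)) =
        3.68 * 4.934 * (n : ℝ) ^ 3 * ((n : ℝ) - 2) * ((2 * (n : ℝ) - 1) ^ 2 - 1.0282) /
          ((2 * (n : ℝ) - 1) ^ 2) ^ 2 := by
      have hq2 : (2 * (n : ℝ) - 1) ^ 2 ≠ 0 := by positivity
      generalize (2 * (n : ℝ) - 1) ^ 2 = q at hq2 ⊢
      field_simp
    rw [e, le_div_iff₀ (by positivity)]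
    exact poly_bound hn5'

/-- The bound for the expected number of steps of a call with at most `2 * T` steps, in terms of
`n ^ 3 * log n`. -/
theorem stepConst_bound (hn : 2 ≤ n) :
    9 / 2 * ((stepBase n - 1) / (stepBase n - 2)) * (Real.log (stepBase n) / walkGap n) ≤
      stepConst n * ((n : ℝ) ^ 3 * Real.log n) := by
  obtain rfl | hn3 : n = 2 ∨ 3 ≤ n := by omega
  · have h1 : stepBase 2 = 3 := by unfold stepBase; norm_num
    have h2 : walkGap 2 = 1 / 2 := by
      unfold walkGap walkAngle
      rw [show (2 : ℝ) * ((2 : ℕ) : ℝ) - 1 = 3 by norm_num, Real.cos_pi_div_three]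
      norm_num
    have h3 : 5 * Real.log 3 ≤ 8 * Real.log 2 := by
      have : Real.log ((3 : ℝ) ^ 5) ≤ Real.log ((2 : ℝ) ^ 8) :=
        Real.log_le_log (by norm_num) (by norm_num)
      rw [Real.log_pow, Real.log_pow] at this
      exact_mod_cast this
    have h4 : 0 < Real.log 2 := Real.log_pos (by norm_num)
    rw [h1, h2, stepConst, if_pos rfl]
    push_cast
    linarith
  · have hn' : (3 : ℝ) ≤ n := by exact_mod_cast hn3
    have h1 : stepBase n = n := max_eq_right hn'
    have hL : 0 ≤ Real.log n := Real.log_nonneg (by linarith)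
    have hg : 0 < 1 - Real.cos (walkAngle n) := by
      have := walkGap_pos hn
      unfold walkGap at this
      by_contra hc
      exact absurd this (not_lt.2 (div_nonpos_of_nonpos_of_nonneg (by linarith)
        (Nat.cast_nonneg _)))
    have hm : ((n - 1 : ℕ) : ℝ) = n - 1 := by
      rw [Nat.cast_sub (by omega)]; simp
    have hb := gap_bound hn3
    have e : 9 / 2 * (((n : ℝ) - 1) / (n - 2)) * (Real.log n / walkGap n) =
        9 / 2 * ((n : ℝ) - 1) ^ 2 / ((n - 2) * (1 - Real.cos (walkAngle n))) * Real.log n := by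
      have h3 : (n : ℝ) - 2 ≠ 0 := by linarith
      have h4 : (n : ℝ) - 1 ≠ 0 := by linarith
      unfold walkGap
      rw [hm]
      field_simp
    rw [h1, e, ← mul_assoc]
    refine mul_le_mul_of_nonneg_right ?_ hL
    rw [div_le_iff₀ (mul_pos (by linarith) hg)]
    linarith

theorem clog_eq_ceil_logb (n : ℕ) : (Nat.clog 2 n : ℤ) = ⌈Real.logb 2 n⌉ := by
  have h := Real.ceil_logb_natCast (b := 2) (r := (n : ℝ)) (by positivity)
  rw [show ((2 : ℕ) : ℝ) = 2 by norm_num] at h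
  rw [h, Int.clog_natCast]

theorem bits_const_bound (hn : 2 ≤ n) {S N : ℝ} (hN : 0 ≤ N)
    (hS : S ≤ max (stepConst n * N) (3 * N)) :
    ((Nat.clog 2 (n - 1) + 4 : ℕ) : ℝ) * S ≤ 4.3 * N * ((⌈Real.logb 2 n⌉ : ℝ) + 3) := by
  have hceil : (⌈Real.logb 2 n⌉ : ℝ) = (Nat.clog 2 n : ℝ) := by
    rw [← clog_eq_ceil_logb]; simp
  have hmono : Nat.clog 2 (n - 1) ≤ Nat.clog 2 n := Nat.clog_mono_right 2 (Nat.sub_le n 1)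
  have hmono' : (Nat.clog 2 (n - 1) : ℝ) ≤ Nat.clog 2 n := by exact_mod_cast hmono
  rw [hceil]
  push_cast
  have hS' : S ≤ stepConst n * N := by
    refine hS.trans (max_le le_rfl (mul_le_mul_of_nonneg_right ?_ hN))
    unfold stepConst
    split_ifs <;> norm_num
  refine (mul_le_mul_of_nonneg_left hS' (by positivity)).trans ?_
  have key : ((Nat.clog 2 (n - 1) : ℝ) + 4) * stepConst n ≤ 4.3 * ((Nat.clog 2 n : ℝ) + 3) := by
    obtain rfl | hn3 : n = 2 ∨ 3 ≤ n := by omega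
    · have h1 : Nat.clog 2 1 = 0 := by simp
      have h2 : Nat.clog 2 2 = 1 := Nat.clog_eq_one (by norm_num) (by norm_num)
      norm_num [stepConst, h1, h2]
    obtain hn4 | hn5 : n ≤ 4 ∨ 5 ≤ n := by omega
    · have hc : stepConst n = 3.58 := by
        unfold stepConst
        rw [if_neg (by omega), if_pos hn4]
      have h2 : 1 < Nat.clog 2 n := (Nat.lt_clog_iff_pow_lt (by norm_num)).2 (by omega)
      have h3 : (2 : ℝ) ≤ Nat.clog 2 n := by exact_mod_cast h2
      rw [hc]
      nlinarith
    · have hc : stepConst n = 3.68 := by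
        unfold stepConst
        rw [if_neg (by omega), if_neg (by omega)]
      have h2 : 2 < Nat.clog 2 n := (Nat.lt_clog_iff_pow_lt (by norm_num)).2 (by omega)
      have h3 : (3 : ℝ) ≤ Nat.clog 2 n := by exact_mod_cast h2
      rw [hc]
      nlinarith
  nlinarith [mul_le_mul_of_nonneg_right key hN]

end Steps

end LinExt

end

theorem mainTheorem3 {n : ℕ} (hn : 2 ≤ n) {α : Type*} [Fintype α] [PartialOrder α]
    (home : Fin n ≃ α) (hhome : LinExt.IsLinearExtension home)
    (β : ℝ) (hβ0 : 0 ≤ β) (hβn : β ≤ n) (t : ℕ) (ht : 1 ≤ t) :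
    (∀ σ : Fin n ≃ α, LinExt.IsLinearExtension σ →
      LinExt.outputProb β home t σ =
        ENNReal.ofReal (LinExt.weight β home σ / LinExt.partitionFunction β home)) ∧
    ((t : ℝ) ≤ (n : ℝ) ^ 3 * Real.log n →
      LinExt.expectedBits β home t ≤
        ENNReal.ofReal (4.3 * (n : ℝ) ^ 3 * Real.log n * ((⌈Real.logb 2 n⌉ : ℝ) + 3)) ∧
      LinExt.expectedComparisons β home t ≤
        ENNReal.ofReal (8.6 * (n : ℝ) ^ 3 * Real.log n)) := by
  refine ⟨fun σ hσ => ?_, fun htN => ?_⟩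
  · rw [LinExt.outputProb_eq_target hn hhome hβ0 ht, LinExt.target, if_pos hσ]
  have hM : 3 ≤ LinExt.stepBase n := le_max_left _ _
  have hγ := LinExt.walkGap_pos hn
  have hG := LinExt.isStepBound_stepBound (β := β) (home := home) hn
  obtain ⟨N, hNdef⟩ : ∃ N : ℝ, N = (n : ℝ) ^ 3 * Real.log n := ⟨_, rfl⟩
  rw [← hNdef] at htN
  have hN : 0 ≤ N := le_trans (Nat.cast_nonneg t) htN
  have hS0 := LinExt.stepBound_nonneg (T := Real.log (LinExt.stepBase n) / LinExt.walkGap n) hM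
    (div_nonneg (Real.log_nonneg (by linarith)) hγ.le) (Nat.cast_nonneg t)
  have hS := (LinExt.stepBound_le (T := Real.log (LinExt.stepBase n) / LinExt.walkGap n) hM
    (Nat.cast_nonneg t) htN).trans
    (max_le_max_right (3 * N) (hNdef ▸ LinExt.stepConst_bound hn))
  constructor
  · refine (LinExt.expectedBits_le hn hG ht).trans ?_
    rw [← ENNReal.ofReal_natCast, ← ENNReal.ofReal_mul (by positivity)]
    refine ENNReal.ofReal_le_ofReal ((LinExt.bits_const_bound hn hN hS).trans (le_of_eq ?_))
    rw [hNdef]; ring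
  · refine (LinExt.expectedComparisons_le hn hG ht).trans ?_
    rw [← ENNReal.ofReal_ofNat, ← ENNReal.ofReal_mul (by norm_num)]
    refine ENNReal.ofReal_le_ofReal ?_
    have hc : LinExt.stepConst n ≤ 4.3 := by
      unfold LinExt.stepConst
      split_ifs <;> norm_num
    have h1 : LinExt.stepBound (LinExt.stepBase n)
        (Real.log (LinExt.stepBase n) / LinExt.walkGap n) t ≤ 4.3 * N :=
      hS.trans (max_le (mul_le_mul_of_nonneg_right hc hN) (by linarith))
    rw [show 8.6 * (n : ℝ) ^ 3 * Real.log n = 2 * (4.3 * N) by rw [hNdef]; ring]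
    linarith
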